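/- **Theorem 1.1.** Let $n\ge 1$, $0<\alpha\le 1$ and $N_1,N_2,M,\kappa>0$, and let $$L=\sum_{i,j=1}^n a_{ij}(x,t)\partial^2_{ij}+\sum_{i=1}^n b_i(x,t)\partial_i+q(x,t)-\partial_t$$ be an operator on $P=\mathbb{R}^n\times\mathbb{R}$ with real coefficients such that * $a_{ij}$, $b_i$, $q$ are bounded and continuous on $P$; * the matrix $\mathbf a(x,t)=(a_{ij}(x,t))$ is symmetric and $\kappa|\eta|^2\le\langle \mathbf a(x,t)\eta,\eta\rangle\le M|\eta|^2$ for all $(x,t)\in P$, $\eta\in\mathbb{R}^n$; * $\sum_{i,j}[a_{ij}]_\alpha\le N_1$, where $[f]_\alpha=\sup\frac{|f(x,t)-f(x',t')|}{(|x-x'|^2+|t-t'|)^{\alpha/2}}$ over all $(x,t)\ne(x',t')$ in $P$; * $\sum_i\|b_i\|_\infty+\|q\|_\infty\le N_2$; * $\{b_i\}_\alpha<\infty$ and $\{q\}_\alpha<\infty$, where $\{f\}_\alpha=\sup\frac{|f(x,t)-f(x',t)|}{|x-x'|^\alpha}$ over all $x\neq x'$ in $\mathbb{R}^n$ and $t\in\mathbb{R}$.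 For $\tau<t$ let $$Z(x,t;\xi,\tau)=\frac{\sqrt{\det \mathbf a^{-1}(\xi,\tau)}}{(4\pi(t-\tau))^{n/2}}\,e^{-\frac{\langle \mathbf a^{-1}(\xi,\tau)(x-\xi),x-\xi\rangle}{4(t-\tau)}},\qquad \Phi_1(x,t;\xi,\tau)=\big(LZ(\cdot,\cdot;\xi,\tau)\big)(x,t),$$ $$\Phi_{\ell+1}(x,t;\xi,\tau)=\int_\tau^t\int_{\mathbb{R}^n}\Phi_1(x,t;\eta,\sigma)\Phi_\ell(\eta,\sigma;\xi,\tau)\,d\eta\,d\sigma\quad(\ell\ge1),\qquad \Phi=\sum_{\ell\ge1}\Phi_\ell,$$ and let $$E(x,t;\xi,\tau)=Z(x,t;\xi,\tau)+\int_\tau^t\int_{\mathbb{R}^n}Z(x,t;\eta,\sigma)\Phi(\eta,\sigma;\xi,\tau)\,d\eta\,d\sigma$$ be the fundamental solution of $L$ constructed by the parametrix method. Put $$c=\frac1{8M},\qquad d=\frac{4\ln\left[e\,2^{3n}(M\kappa^{-1})^{n/2}\,\Gamma(n/2+1)\right]}{\kappa}.$$ Then there are constants $\aleph_0>0$, $\aleph_1\ge0$,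 $\aleph_2>0$, $\aleph_3\ge0$, depending only on $(n,\alpha,N_1,N_2,M,\kappa)$, such that for every such $L$ and all $x,\xi\in\mathbb{R}^n$, $\tau<t$, the integrals and the series defining $E(x,t;\xi,\tau)$ converge absolutely and $$\aleph_0e^{-\aleph_1(t-\tau)}(t-\tau)^{-\frac n2}e^{-d\frac{|x-\xi|^2}{t-\tau}}\le E(x,t;\xi,\tau)\le\aleph_2e^{\aleph_3(t-\tau)}(t-\tau)^{-\frac n2}e^{-c\frac{|x-\xi|^2}{t-\tau}}.$$ -/

import Mathlib

open MeasureTheory Set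
open scoped ENNReal

noncomputable section

namespace Parabolic

/-- The space `ℝⁿ` with its Euclidean norm. -/
abbrev Space (n : ℕ) : Type := EuclideanSpace ℝ (Fin n)

/-- The space-time `P = ℝⁿ × ℝ`. -/
abbrev SpaceTime (n : ℕ) : Type := Space n × ℝ

/-- `f ∈ C_b⁰(P)`: `f` is continuous and bounded on `P`. -/
def IsBoundedContinuous {n : ℕ} (f : SpaceTime n → ℝ) : Prop :=
  Continuous f ∧ ∃ C : ℝ, ∀ p, |f p| ≤ C

/-- The sup norm `‖f‖_∞`, with values in `[0, ∞]`. -/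
def supNorm {n : ℕ} (f : SpaceTime n → ℝ) : ℝ≥0∞ :=
  ⨆ p : SpaceTime n, ENNReal.ofReal |f p|

/-- The parabolic Hölder seminorm `[f]_α`, with values in `[0, ∞]`: the supremum of
`|f(x,t) - f(x',t')| / (|x-x'|² + |t-t'|)^{α/2}` over all pairs of distinct points. -/
def holderSeminorm {n : ℕ} (α : ℝ) (f : SpaceTime n → ℝ) : ℝ≥0∞ :=
  ⨆ (p : SpaceTime n) (p' : SpaceTime n) (_ : p ≠ p'),
    ENNReal.ofReal (|f p - f p'| / (‖p.1 - p'.1‖ ^ 2 + |p.2 - p'.2|) ^ (α / 2))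

/-- The spatial Hölder seminorm `{f}_α`, with values in `[0, ∞]`: the supremum of
`|f(x,t) - f(x',t)| / |x-x'|^α` over all `x ≠ x'` and all `t`. -/
def spatialHolderSeminorm {n : ℕ} (α : ℝ) (f : SpaceTime n → ℝ) : ℝ≥0∞ :=
  ⨆ (x : Space n) (x' : Space n) (_ : x ≠ x') (t : ℝ),
    ENNReal.ofReal (|f (x, t) - f (x', t)| / ‖x - x'‖ ^ α)

/-- `f ∈ C^α(P)`. -/
def IsHolder {n : ℕ} (α : ℝ) (f : SpaceTime n → ℝ) : Prop :=
  IsBoundedContinuous f ∧ holderSeminorm α f < ⊤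

/-- The quadratic form `⟨A η, η⟩` of a matrix. -/
def quadForm {n : ℕ} (A : Matrix (Fin n) (Fin n) ℝ) (η : Space n) : ℝ :=
  ∑ i, ∑ j, A i j * η i * η j

/-- The coefficients of a second order parabolic operator
`L = ∑ a_{ij} ∂²_{ij} + ∑ b_i ∂_i + q - ∂_t` on `ℝⁿ × ℝ`. -/
structure Operator (n : ℕ) where
  a : SpaceTime n → Matrix (Fin n) (Fin n) ℝ
  b : Fin n → SpaceTime n → ℝ
  q : SpaceTime n → ℝ

/-- The standing assumptions on the coefficients, with Hölder exponent `α`, ellipticity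
constants `κ`, `M` and bounds `N₁`, `N₂`. -/
structure Operator.Admissible {n : ℕ} (L : Operator n) (α N₁ N₂ M κ : ℝ) : Prop where
  holder_a : ∀ i j, IsHolder α (fun p => L.a p i j)
  symm : ∀ p, (L.a p).IsSymm
  elliptic : ∀ p (η : Space n),
    κ * ‖η‖ ^ 2 ≤ quadForm (L.a p) η ∧ quadForm (L.a p) η ≤ M * ‖η‖ ^ 2
  bounded_b : ∀ i, IsBoundedContinuous (L.b i)
  bounded_q : IsBoundedContinuous L.q
  bound_a : ∑ i, ∑ j, holderSeminorm α (fun p => L.a p i j) ≤ ENNReal.ofReal N₁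
  bound_lower : ∑ i, supNorm (L.b i) + supNorm L.q ≤ ENNReal.ofReal N₂
  spatial_b : ∀ i, spatialHolderSeminorm α (L.b i) < ⊤
  spatial_q : spatialHolderSeminorm α L.q < ⊤

/-- The partial derivative `∂_i u` of a function on `ℝⁿ`. -/
def partialDeriv {n : ℕ} (i : Fin n) (u : Space n → ℝ) (x : Space n) : ℝ :=
  lineDeriv ℝ u x (EuclideanSpace.single i 1)

/-- The operator `L` applied to `u = u(x, t)`, evaluated at the point `(x, t)`. -/
def Operator.apply {n : ℕ} (L : Operator n) (u : Space n → ℝ → ℝ) (x : Space n) (t : ℝ) : ℝ :=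
  (∑ i, ∑ j, L.a (x, t) i j * partialDeriv i (partialDeriv j (fun y => u y t)) x)
    + (∑ i, L.b i (x, t) * partialDeriv i (fun y => u y t) x)
    + L.q (x, t) * u x t - deriv (fun s => u x s) t

/-- The generalized Gaussian heat kernel
`G_A(x, t) = √(det A) (4πt)^{-n/2} exp(-⟨A x, x⟩ / (4t))`, used for `t > 0`. -/
def gaussKernel {n : ℕ} (A : Matrix (Fin n) (Fin n) ℝ) (x : Space n) (t : ℝ) : ℝ :=
  Real.sqrt A.det / (4 * Real.pi * t) ^ ((n : ℝ) / 2) * Real.exp (-(quadForm A x / (4 * t)))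

/-- The parametrix `Z(x, t; ξ, τ) = G_{a⁻¹(ξ, τ)}(x - ξ, t - τ)`, used for `τ < t`. -/
def Operator.parametrix {n : ℕ} (L : Operator n) (x : Space n) (t : ℝ) (ξ : Space n) (τ : ℝ) : ℝ :=
  gaussKernel (L.a (ξ, τ))⁻¹ (x - ξ) (t - τ)

/-- The iterated kernels, numbered from `0`: `L.iter 0` is `Φ₁ = L Z` (with `L` acting in the
variables `(x, t)`), and `L.iter ℓ` is `Φ_{ℓ+1}`, where
`Φ_{ℓ+1}(x, t; ξ, τ) = ∫_τ^t ∫_{ℝⁿ} Φ₁(x, t; η, σ) Φ_ℓ(η, σ; ξ, τ) dη dσ`. -/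
def Operator.iter {n : ℕ} (L : Operator n) : ℕ → Space n → ℝ → Space n → ℝ → ℝ
  | 0 => fun x t ξ τ => L.apply (fun y s => L.parametrix y s ξ τ) x t
  | ℓ + 1 => fun x t ξ τ =>
      ∫ σ in τ..t, ∫ η : Space n,
        L.apply (fun y s => L.parametrix y s η σ) x t * Operator.iter L ℓ η σ ξ τ

/-- The kernel `Φ = ∑_{ℓ ≥ 1} Φ_ℓ`. -/
def Operator.levi {n : ℕ} (L : Operator n) (x : Space n) (t : ℝ) (ξ : Space n) (τ : ℝ) : ℝ :=
  ∑' ℓ : ℕ, L.iter ℓ x t ξ τ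

/-- The fundamental solution constructed by the parametrix method, for `τ < t`:
`E(x, t; ξ, τ) = Z(x, t; ξ, τ) + ∫_τ^t ∫_{ℝⁿ} Z(x, t; η, σ) Φ(η, σ; ξ, τ) dη dσ`. -/
def Operator.fundSol {n : ℕ} (L : Operator n) (x : Space n) (t : ℝ) (ξ : Space n) (τ : ℝ) : ℝ :=
  L.parametrix x t ξ τ +
    ∫ σ in τ..t, ∫ η : Space n, L.parametrix x t η σ * L.levi η σ ξ τ

/-- The integrals and the series that define `L.fundSol x t ξ τ` converge absolutely. -/
def Operator.ConvergesAt {n : ℕ} (L : Operator n) (x : Space n) (t : ℝ) (ξ : Space n) (τ : ℝ) :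
    Prop :=
  (∀ ℓ : ℕ, IntegrableOn (fun p : ℝ × Space n => L.iter 0 x t p.2 p.1 * L.iter ℓ p.2 p.1 ξ τ)
      (Ioo τ t ×ˢ univ)) ∧
  Summable (fun ℓ : ℕ => |L.iter ℓ x t ξ τ|) ∧
  IntegrableOn (fun p : ℝ × Space n => L.parametrix x t p.2 p.1 * L.levi p.2 p.1 ξ τ)
    (Ioo τ t ×ˢ univ)

end Parabolic

end

/-!
The upper bound is the classical estimate of Levi's series. The parametrix is bounded by a scalar
heat kernel with rate `c = 1/(8M)`. Because the leading coefficients are Hölder continuous, `L Z` is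
bounded by the same heat kernel times `(t - τ)^(α/2 - 1)`, an integrable singularity. Scalar heat
kernels convolve exactly, so spatial integrals reproduce the majorant, and a factor `e^{λ(t-τ)}`
with `λ` large turns the remaining time integral into a contraction (`iterated_bound`,
`resolvent_bound`).

The lower bound needs that `E` is nonnegative and satisfies the Chapman–Kolmogorov identity. Both
usually come from the maximum principle and uniqueness for the Cauchy problem. Here they are
obtained by discretizing time, which uses nothing but Gaussian integrals. One Euler step
`e^{s q(x,t)} · gauss (s a(x,t)) (x + s b(x,t) - η)` is a positive kernel. Composed with the
parametrix at the previous grid time it gives, since covariances of Gaussians add under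
convolution, a Gaussian whose covariance has its last step frozen at `(x,t)` instead of at the pole.
The difference to the parametrix, divided by the step `s`, is a difference quotient of `L Z`
(`exists_segment_slope`) and obeys the same bounds as `L Z`, uniformly in `s`. The iterated Euler
scheme therefore has a parametrix expansion of the same form as Levi's (`discreteSolution_grid`,
`discreteSolution_succ`). It is nonnegative (`discreteSolution_nonneg`), it has the semigroup
property on the grid by construction (`discreteSolution_semigroup`), and it converges to `E` as
`s → 0` by dominated convergence (`tendsto_discreteSolution`). To treat the series and its
discretization at once, every estimate is proved for kernels read on a *clock*, which is either the
identity or the rounding of time to a grid (`IsClock`).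

Finally, for a short time `u` and `|x - ξ|² ≤ κ u` the parametrix dominates the correction, so the
discrete solution is at least `e⁻¹ (4πMu)^{-n/2}` uniformly in the step
(`exists_discreteSolution_lower`). A chain of `m` such steps through balls of radius `√(κu)/4` along
the segment from `ξ` to `x` multiplies this bound at each step by the volume of the ball
(`discreteSolution_chain`), which is the factor `1/Q` with `Q = e 2^{3n} (M/κ)^{n/2} Γ(n/2+1)`
(`step_mul_volume`). With `m` about `4|x-ξ|²/(κ(t-τ)) + (t-τ)/δ` the product is the asserted
Gaussian with rate `d = 4 log Q / κ`.
-/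

noncomputable section

namespace Parabolic

variable {n : ℕ}

/-! ### Symmetric elliptic matrices -/

/-- A matrix as a linear map of the Euclidean space. -/
def act (A : Matrix (Fin n) (Fin n) ℝ) : Space n →ₗ[ℝ] Space n := Matrix.toLpLin 2 2 A

lemma act_apply (A : Matrix (Fin n) (Fin n) ℝ) (y : Space n) (i : Fin n) :
    act A y i = ∑ j, A i j * y j := by
  simp [act, Matrix.toLpLin_apply, Matrix.mulVec, dotProduct]

lemma act_add (A B : Matrix (Fin n) (Fin n) ℝ) (y : Space n) :
    act (A + B) y = act A y + act B y := by simp [act]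

lemma act_smul (r : ℝ) (A : Matrix (Fin n) (Fin n) ℝ) (y : Space n) :
    act (r • A) y = r • act A y := by simp [act]

lemma act_one (y : Space n) : act (1 : Matrix (Fin n) (Fin n) ℝ) y = y := by
  simp [act]

lemma act_mul (A B : Matrix (Fin n) (Fin n) ℝ) (y : Space n) :
    act (A * B) y = act A (act B y) := by
  simp [act, Matrix.toLpLin_apply]

lemma inner_eq_sum (x y : Space n) : inner ℝ x y = ∑ i, x i * y i := by
  simp [PiLp.inner_apply, mul_comm]

lemma quadForm_eq_inner (A : Matrix (Fin n) (Fin n) ℝ) (y : Space n) :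
    quadForm A y = inner ℝ (act A y) y := by
  simp only [inner_eq_sum, act_apply, quadForm, Finset.sum_mul]
  exact Finset.sum_congr rfl fun i _ => Finset.sum_congr rfl fun j _ => by ring

lemma inner_act_comm {A : Matrix (Fin n) (Fin n) ℝ} (hA : A.IsSymm) (x y : Space n) :
    inner ℝ (act A x) y = inner ℝ x (act A y) := by
  simp only [inner_eq_sum, act_apply, Finset.sum_mul, Finset.mul_sum]
  rw [Finset.sum_comm]
  refine Finset.sum_congr rfl fun i _ => Finset.sum_congr rfl fun j _ => ?_
  rw [hA.apply i j]; ring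

/-- `A` is symmetric with `k |η|² ≤ ⟨A η, η⟩ ≤ m |η|²`. -/
structure Elliptic (k m : ℝ) (A : Matrix (Fin n) (Fin n) ℝ) : Prop where
  symm : A.IsSymm
  lower : ∀ η : Space n, k * ‖η‖ ^ 2 ≤ quadForm A η
  upper : ∀ η : Space n, quadForm A η ≤ m * ‖η‖ ^ 2

lemma quadForm_add (A B : Matrix (Fin n) (Fin n) ℝ) (y : Space n) :
    quadForm (A + B) y = quadForm A y + quadForm B y := by
  simp [quadForm_eq_inner, act_add, inner_add_left]

lemma quadForm_smul (r : ℝ) (A : Matrix (Fin n) (Fin n) ℝ) (y : Space n) :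
    quadForm (r • A) y = r * quadForm A y := by
  simp [quadForm_eq_inner, act_smul, real_inner_smul_left]

namespace Elliptic

variable {k m k' m' : ℝ} {A B : Matrix (Fin n) (Fin n) ℝ}

lemma add (hA : Elliptic k m A) (hB : Elliptic k' m' B) : Elliptic (k + k') (m + m') (A + B) where
  symm := hA.symm.add hB.symm
  lower η := by rw [quadForm_add]; linarith [hA.lower η, hB.lower η]
  upper η := by rw [quadForm_add]; linarith [hA.upper η, hB.upper η]

lemma smul (hA : Elliptic k m A) {r : ℝ} (hr : 0 ≤ r) : Elliptic (r * k) (r * m) (r • A) where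
  symm := hA.symm.smul r
  lower η := by rw [quadForm_smul, mul_assoc]; exact mul_le_mul_of_nonneg_left (hA.lower η) hr
  upper η := by rw [quadForm_smul, mul_assoc]; exact mul_le_mul_of_nonneg_left (hA.upper η) hr

lemma mix (hA : Elliptic k m A) (hB : Elliptic k m B) {r s : ℝ} (hr : 0 ≤ r) (hs : 0 ≤ s) :
    Elliptic ((r + s) * k) ((r + s) * m) (r • A + s • B) := by
  have := (hA.smul hr).add (hB.smul hs)
  rwa [← add_mul, ← add_mul] at this

lemma posDef (hA : Elliptic k m A) (hk : 0 < k) : A.PosDef := by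
  refine Matrix.posDef_iff_dotProduct_mulVec.mpr ⟨by
    simpa [Matrix.IsHermitian] using hA.symm.eq, ?_⟩
  intro x hx
  have h := hA.lower (WithLp.toLp 2 x)
  have h0 : WithLp.toLp 2 x ≠ 0 := by simpa using hx
  have : 0 < k * ‖WithLp.toLp 2 x‖ ^ 2 := by positivity
  have e : star x ⬝ᵥ A.mulVec x = quadForm A (WithLp.toLp 2 x) := by
    simp only [quadForm, dotProduct, Matrix.mulVec, Finset.mul_sum]
    exact Finset.sum_congr rfl fun i _ => Finset.sum_congr rfl fun j _ => by simp; ring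
  rw [e]; linarith

lemma det_pos (hA : Elliptic k m A) (hk : 0 < k) : 0 < A.det := (hA.posDef hk).det_pos

lemma isUnit_det (hA : Elliptic k m A) (hk : 0 < k) : IsUnit A.det :=
  (hA.det_pos hk).ne'.isUnit

lemma act_inv (hA : Elliptic k m A) (hk : 0 < k) (y : Space n) : act A (act A⁻¹ y) = y := by
  rw [← act_mul, Matrix.mul_nonsing_inv _ (hA.isUnit_det hk), act_one]

lemma inv_act (hA : Elliptic k m A) (hk : 0 < k) (y : Space n) : act A⁻¹ (act A y) = y := by
  rw [← act_mul, Matrix.nonsing_inv_mul _ (hA.isUnit_det hk), act_one]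

lemma inv_symm (hA : Elliptic k m A) : (A⁻¹).IsSymm := hA.symm.inv

lemma det_bounds (hA : Elliptic k m A) (hk : 0 < k) : k ^ n ≤ A.det ∧ A.det ≤ m ^ n := by
  have hH : A.IsHermitian := (hA.posDef hk).isHermitian
  have hev : ∀ i, k ≤ hH.eigenvalues i ∧ hH.eigenvalues i ≤ m := by
    intro i
    have e : hH.eigenvalues i = quadForm A (hH.eigenvectorBasis i) := by
      rw [hH.eigenvalues_eq]
      simp only [quadForm, dotProduct, Matrix.mulVec, Finset.mul_sum, RCLike.re_to_real]
      exact Finset.sum_congr rfl fun i _ => Finset.sum_congr rfl fun j _ => by simp; ring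
    have h1 := hA.lower (hH.eigenvectorBasis i)
    have h2 := hA.upper (hH.eigenvectorBasis i)
    rw [hH.eigenvectorBasis.orthonormal.1 i] at h1 h2
    rw [e]; constructor <;> linarith
  rw [hH.det_eq_prod_eigenvalues]
  simp only [RCLike.ofReal_real_eq_id, id]
  constructor
  · calc k ^ n = ∏ _i : Fin n, k := by simp
      _ ≤ _ := Finset.prod_le_prod (fun _ _ => hk.le) fun i _ => (hev i).1
  · calc _ ≤ ∏ _i : Fin n, m :=
          Finset.prod_le_prod (fun i _ => hk.le.trans (hev i).1) fun i _ => (hev i).2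
      _ = _ := by simp

lemma norm_inv_le (hA : Elliptic k m A) (hk : 0 < k) (y : Space n) :
    ‖act A⁻¹ y‖ ≤ ‖y‖ / k := by
  set w := act A⁻¹ y
  have h1 := hA.lower w
  rw [quadForm_eq_inner, hA.act_inv hk] at h1
  have h2 := real_inner_le_norm y w
  rw [le_div_iff₀ hk]
  by_cases h0 : ‖w‖ = 0
  · rw [h0]; simp
  · have : 0 < ‖w‖ := lt_of_le_of_ne (norm_nonneg _) (Ne.symm h0)
    nlinarith

lemma quadForm_inv_le (hA : Elliptic k m A) (hk : 0 < k) (y : Space n) :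
    quadForm A⁻¹ y ≤ ‖y‖ ^ 2 / k := by
  rw [quadForm_eq_inner]
  calc _ ≤ ‖act A⁻¹ y‖ * ‖y‖ := real_inner_le_norm _ _
    _ ≤ ‖y‖ / k * ‖y‖ := by gcongr; exact hA.norm_inv_le hk y
    _ = _ := by ring

lemma le_quadForm_inv (hA : Elliptic k m A) (hk : 0 < k) (hm : 0 < m) (y : Space n) :
    ‖y‖ ^ 2 / m ≤ quadForm A⁻¹ y := by
  set w := act A⁻¹ y with hw
  have h1 := hA.lower (w - m⁻¹ • y)
  have h0 : 0 ≤ k * ‖w - m⁻¹ • y‖ ^ 2 := by positivity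
  have h2 := hA.upper y
  have hAw : act A w = y := hA.act_inv hk y
  have e : quadForm A (w - m⁻¹ • y)
      = quadForm A⁻¹ y - 2 * m⁻¹ * ‖y‖ ^ 2 + m⁻¹ ^ 2 * quadForm A y := by
    rw [quadForm_eq_inner, quadForm_eq_inner, quadForm_eq_inner, map_sub, map_smul, hAw,
      inner_sub_left, inner_sub_right, inner_sub_right, real_inner_smul_left,
      real_inner_smul_left, real_inner_smul_right, real_inner_smul_right,
      inner_act_comm hA.symm y w, hAw, real_inner_self_eq_norm_sq, real_inner_comm y w]
    ring
  have h3 : m⁻¹ ^ 2 * quadForm A y ≤ m⁻¹ ^ 2 * (m * ‖y‖ ^ 2) := by gcongr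
  have h4 : m⁻¹ ^ 2 * (m * ‖y‖ ^ 2) = m⁻¹ * ‖y‖ ^ 2 := by field_simp
  rw [div_eq_inv_mul]
  linarith

lemma abs_inv_apply_le (hA : Elliptic k m A) (hk : 0 < k) (i j : Fin n) :
    |A⁻¹ i j| ≤ 1 / k := by
  have h := hA.norm_inv_le hk (EuclideanSpace.single j 1)
  have e : act A⁻¹ (EuclideanSpace.single j 1) i = A⁻¹ i j := by
    simp [act_apply]
  have h2 := PiLp.norm_apply_le (act A⁻¹ (EuclideanSpace.single j 1)) i
  rw [e, Real.norm_eq_abs] at h2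
  simpa using h2.trans h

end Elliptic

/-! ### The Gaussian density of a covariance matrix -/

/-- The Gaussian `(4π)^{-n/2} (det C)^{-1/2} exp(-⟨C⁻¹ y, y⟩ / 4)`, whose covariance
matrix is `2 C`. -/
def gauss (C : Matrix (Fin n) (Fin n) ℝ) (y : Space n) : ℝ :=
  (4 * Real.pi) ^ (-((n : ℝ) / 2)) * (Real.sqrt C.det)⁻¹ * Real.exp (-(quadForm C⁻¹ y / 4))

lemma gauss_nonneg (C : Matrix (Fin n) (Fin n) ℝ) (y : Space n) : 0 ≤ gauss C y := by
  unfold gauss; positivity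

lemma quadForm_transpose_mul_self (B : Matrix (Fin n) (Fin n) ℝ) (y : Space n) :
    quadForm (B.transpose * B) y = ‖act B y‖ ^ 2 := by
  rw [← real_inner_self_eq_norm_sq, inner_eq_sum]
  simp only [quadForm, act_apply, Matrix.mul_apply, Matrix.transpose_apply, Finset.sum_mul,
    Finset.mul_sum]
  rw [Finset.sum_comm_cycle]
  refine Finset.sum_congr rfl fun i _ => ?_
  rw [Finset.sum_comm]
  exact Finset.sum_congr rfl fun j _ => Finset.sum_congr rfl fun l _ => by ring

lemma integrable_exp_norm_sq {b : ℝ} (hb : 0 < b) :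
    Integrable (fun y : Space n => Real.exp (-b * ‖y‖ ^ 2)) := by
  by_contra h
  have h1 := GaussianFourier.integral_rexp_neg_mul_sq_norm (V := Space n) hb
  rw [integral_undef h] at h1
  have : 0 < (Real.pi / b) ^ ((Module.finrank ℝ (Space n) : ℝ) / 2) := by positivity
  linarith

lemma integral_exp_quadForm {B : Matrix (Fin n) (Fin n) ℝ} (hB : B.PosDef) :
    Integrable (fun y : Space n => Real.exp (-(quadForm B y / 4))) ∧
    ∫ y : Space n, Real.exp (-(quadForm B y / 4))
      = (4 * Real.pi) ^ ((n : ℝ) / 2) * (Real.sqrt B.det)⁻¹ := by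
  obtain ⟨R, hR⟩ : ∃ R : Matrix (Fin n) (Fin n) ℝ, B = R.transpose * R := by
    open scoped MatrixOrder Matrix.Norms.L2Operator in
    obtain ⟨R, hR⟩ := CStarAlgebra.nonneg_iff_eq_star_mul_self.mp hB.posSemidef.nonneg
    exact ⟨R, by simpa [Matrix.star_eq_conjTranspose] using hR⟩
  have hdet : B.det = R.det ^ 2 := by rw [hR, Matrix.det_mul, Matrix.det_transpose]; ring
  have hpos := hB.det_pos
  have hdR : R.det ≠ 0 := by
    intro h; rw [hdet, h] at hpos; simp at hpos
  have hlin : LinearMap.det (act R) = R.det := by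
    have := LinearMap.det_toLin (PiLp.basisFun 2 ℝ (Fin n)) R
    rw [← this]; congr 1
  have hmap := Measure.map_linearMap_addHaar_eq_smul_addHaar (volume : Measure (Space n))
    (f := act R) (by rw [hlin]; exact hdR)
  have hcont : Continuous (act R) := (act R).continuous_of_finiteDimensional
  have hmeas : AEMeasurable (act R) (volume : Measure (Space n)) := hcont.measurable.aemeasurable
  have hI := integrable_exp_norm_sq (n := n) (b := 1 / 4) (by norm_num)
  have heq : ∀ y : Space n, Real.exp (-(quadForm B y / 4))
      = (fun z : Space n => Real.exp (-(1 / 4) * ‖z‖ ^ 2)) (act R y) := by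
    intro y; rw [hR, quadForm_transpose_mul_self]; simp only; congr 1; ring
  simp_rw [heq]
  have hI' : Integrable (fun z : Space n => Real.exp (-(1 / 4) * ‖z‖ ^ 2))
      (Measure.map (act R) volume) := by
    rw [hmap]; exact hI.smul_measure ENNReal.ofReal_ne_top
  refine ⟨hI'.comp_aemeasurable hmeas, ?_⟩
  rw [← integral_map hmeas hI'.aestronglyMeasurable, hmap, integral_smul_measure,
    GaussianFourier.integral_rexp_neg_mul_sq_norm (by norm_num), hlin, hdet,
    Real.sqrt_sq_eq_abs, ENNReal.toReal_ofReal (abs_nonneg _), abs_inv]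
  simp only [finrank_euclideanSpace, Fintype.card_fin, smul_eq_mul]
  rw [mul_comm]; congr 2; ring

/-- Completing the square in the convolution of two Gaussians. -/
lemma quadForm_complete_square {B C : Matrix (Fin n) (Fin n) ℝ} {k m k' m' : ℝ} (hk : 0 < k) (hk' : 0 < k')
    (hB : Elliptic k m B) (hC : Elliptic k' m' C) (v ζ : Space n) :
    quadForm B⁻¹ (v - (ζ + act C (act (B + C)⁻¹ v)))
      + quadForm C⁻¹ (ζ + act C (act (B + C)⁻¹ v))
      = quadForm (B⁻¹ + C⁻¹) ζ + quadForm (B + C)⁻¹ v := by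
  have hS := (hB.add hC)
  set w := act (B + C)⁻¹ v with hw
  have hv : v = act B w + act C w := by rw [← act_add, hw, hS.act_inv (by linarith)]
  have e1 : v - (ζ + act C w) = act B w - ζ := by rw [hv]; abel
  rw [e1, quadForm_add, quadForm_eq_inner, quadForm_eq_inner, quadForm_eq_inner,
    quadForm_eq_inner, quadForm_eq_inner, map_sub, map_add, hB.inv_act hk, hC.inv_act hk',
    ← hw]
  simp only [inner_sub_left, inner_sub_right, inner_add_left, inner_add_right]
  rw [inner_act_comm hB.inv_symm ζ (act B w), hB.inv_act hk,
    inner_act_comm hC.inv_symm ζ (act C w), hC.inv_act hk']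
  have hwv : inner ℝ w v = inner ℝ w (act B w) + inner ℝ w (act C w) := by
    rw [← inner_add_right, ← hv]
  rw [hwv, real_inner_comm w ζ]
  ring

/-- Gaussian densities form a convolution semigroup: covariances add. -/
lemma gauss_conv {B C : Matrix (Fin n) (Fin n) ℝ} {k m k' m' : ℝ} (hk : 0 < k) (hk' : 0 < k')
    (hB : Elliptic k m B) (hC : Elliptic k' m' C) (x ξ : Space n) :
    Integrable (fun η : Space n => gauss B (x - η) * gauss C (η - ξ)) ∧
    ∫ η : Space n, gauss B (x - η) * gauss C (η - ξ) = gauss (B + C) (x - ξ) := by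
  have hS := (hB.add hC)
  set s : Space n := ξ + act C (act (B + C)⁻¹ (x - ξ)) with hs
  set F : Space n → ℝ := fun η => gauss B (x - η) * gauss C (η - ξ) with hF
  have hBd := hB.det_pos hk
  have hCd := hC.det_pos hk'
  have hSd := hS.det_pos (by linarith)
  have hPD : (B⁻¹ + C⁻¹).PosDef := (hB.posDef hk).inv.add (hC.posDef hk').inv
  have hdet : (B⁻¹ + C⁻¹).det = (B + C).det / (B.det * C.det) := by
    have : B⁻¹ + C⁻¹ = B⁻¹ * (B + C) * C⁻¹ := by
      rw [Matrix.mul_add, Matrix.add_mul, Matrix.nonsing_inv_mul _ (hB.isUnit_det hk),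
        Matrix.mul_assoc, Matrix.mul_nonsing_inv _ (hC.isUnit_det hk')]
      simp [add_comm]
    rw [this, Matrix.det_mul, Matrix.det_mul, Matrix.det_nonsing_inv, Matrix.det_nonsing_inv]
    simp only [Ring.inverse_eq_inv']
    field_simp
  obtain ⟨hI, hv⟩ := integral_exp_quadForm hPD
  have key : ∀ ζ : Space n, F (ζ + s) = ((4 * Real.pi) ^ (-((n : ℝ) / 2))) ^ 2
      * ((Real.sqrt B.det)⁻¹ * (Real.sqrt C.det)⁻¹) * Real.exp (-(quadForm (B + C)⁻¹ (x - ξ) / 4))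
      * Real.exp (-(quadForm (B⁻¹ + C⁻¹) ζ / 4)) := by
    intro ζ
    have e1 : x - (ζ + s) = (x - ξ) - (ζ + act C (act (B + C)⁻¹ (x - ξ))) := by
      rw [hs]; abel
    have e2 : ζ + s - ξ = ζ + act C (act (B + C)⁻¹ (x - ξ)) := by rw [hs]; abel
    have h := quadForm_complete_square hk hk' hB hC (x - ξ) ζ
    simp only [hF, gauss]
    rw [e1, e2, mul_assoc _ (Real.exp _) (Real.exp _), ← Real.exp_add,
      show -(quadForm (B + C)⁻¹ (x - ξ) / 4) + -(quadForm (B⁻¹ + C⁻¹) ζ / 4)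
        = -((quadForm (B⁻¹ + C⁻¹) ζ + quadForm (B + C)⁻¹ (x - ξ)) / 4) by ring, ← h]
    have e3 : ∀ a b c d e : ℝ, a * b * d * (a * c * e) = a ^ 2 * (b * c) * (d * e) := by
      intros; ring
    rw [e3, ← Real.exp_add]
    congr 2; ring
  have hFs : Integrable (fun ζ => F (ζ + s)) := by
    simp_rw [key]; exact hI.const_mul _
  refine ⟨by simpa using hFs.comp_add_right (-s), ?_⟩
  rw [← integral_add_right_eq_self F s]
  simp_rw [key]
  rw [integral_const_mul, hv, hdet, Real.sqrt_div hSd.le, Real.sqrt_mul hBd.le, gauss,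
    Real.rpow_neg (by positivity)]
  have h1 : (4 * Real.pi) ^ ((n : ℝ) / 2) ≠ 0 := by positivity
  have h2 : √B.det ≠ 0 := by positivity
  have h3 : √C.det ≠ 0 := by positivity
  have h4 : √(B + C).det ≠ 0 := by positivity
  field_simp

/-! ### Differentiating a Gaussian along a segment of covariance matrices -/

/-- Jacobi's formula along a segment of matrices. -/
lemma hasDerivAt_det_segment {C₀ D : Matrix (Fin n) (Fin n) ℝ} {θ : ℝ}
    (h : IsUnit (C₀ + θ • D).det) :
    HasDerivAt (fun r : ℝ => (C₀ + r • D).det)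
      ((C₀ + θ • D).det * ((C₀ + θ • D)⁻¹ * D).trace) θ := by
  set C := C₀ + θ • D with hC
  set N := C⁻¹ * D
  have e : ∀ r : ℝ, (C₀ + r • D).det = C.det * (1 + (r - θ) • N).det := by
    intro r
    rw [← Matrix.det_mul]
    congr 1
    rw [Matrix.mul_add, Matrix.mul_one, Matrix.mul_smul, ← Matrix.mul_assoc,
      Matrix.mul_nonsing_inv _ h, Matrix.one_mul, hC, sub_smul]
    abel
  rw [show (fun r : ℝ => (C₀ + r • D).det) = fun r => C.det * (1 + N.trace * (r - θ)
      + (1 + (Polynomial.X : Polynomial ℝ) • N.map Polynomial.C).det.divX.divX.eval (r - θ)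
        * (r - θ) ^ 2) from funext fun r => by rw [e, Matrix.det_one_add_smul]]
  refine HasDerivAt.const_mul _ ?_
  set p := (1 + (Polynomial.X : Polynomial ℝ) • N.map Polynomial.C).det.divX.divX
  have h1 : HasDerivAt (fun r : ℝ => r - θ) 1 θ := (hasDerivAt_id θ).sub_const θ
  have h2 : HasDerivAt (fun r : ℝ => p.eval (r - θ)) (p.derivative.eval (θ - θ) * 1) θ :=
    HasDerivAt.comp (h₂ := fun z => p.eval z) θ (p.hasDerivAt (θ - θ)) h1
  have h3 := ((h1.const_mul N.trace).const_add 1).add (h2.mul (h1.pow 2))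
  exact h3.congr_deriv (by simp)

lemma tendsto_inv_matrix {X : Type*} {l : Filter X} {C : X → Matrix (Fin n) (Fin n) ℝ}
    {C₀ : Matrix (Fin n) (Fin n) ℝ} (hC : Filter.Tendsto C l (nhds C₀)) (h0 : C₀.det ≠ 0) :
    Filter.Tendsto (fun p => (C p)⁻¹) l (nhds C₀⁻¹) := by
  simp only [Matrix.inv_def, Ring.inverse_eq_inv']
  have h1 : Filter.Tendsto (fun p => (C p).det) l (nhds C₀.det) :=
    (continuous_id.matrix_det.tendsto C₀).comp hC
  exact (h1.inv₀ h0).smul ((continuous_id.matrix_adjugate.tendsto C₀).comp hC)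

lemma tendsto_matrix {X : Type*} {l : Filter X} {C : X → Matrix (Fin n) (Fin n) ℝ}
    {C₀ : Matrix (Fin n) (Fin n) ℝ} :
    Filter.Tendsto C l (nhds C₀) ↔ ∀ i j, Filter.Tendsto (fun p => C p i j) l (nhds (C₀ i j)) := by
  rw [show Filter.Tendsto C l (nhds C₀) ↔ _ from tendsto_pi_nhds]
  exact forall_congr' fun i => tendsto_pi_nhds

lemma hasDerivAt_inv_segment {C₀ D : Matrix (Fin n) (Fin n) ℝ} {θ : ℝ}
    (h : IsUnit (C₀ + θ • D).det) (i j : Fin n) :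
    HasDerivAt (fun r : ℝ => (C₀ + r • D)⁻¹ i j)
      (-((C₀ + θ • D)⁻¹ * D * (C₀ + θ • D)⁻¹) i j) θ := by
  set C := C₀ + θ • D with hC
  have hlim : Filter.Tendsto (fun r : ℝ => C₀ + r • D) (nhds θ) (nhds C) :=
    (continuous_const.add (continuous_id.smul continuous_const)).tendsto θ
  have hdet : Filter.Tendsto (fun r : ℝ => (C₀ + r • D).det) (nhds θ) (nhds C.det) :=
    (continuous_id.matrix_det.tendsto C).comp hlim
  have hlim2 := ((tendsto_matrix.mp ((((tendsto_inv_matrix hlim h.ne_zero).mul_const D).mul_const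
    C⁻¹).neg) i j)).mono_left (nhdsWithin_le_nhds (s := {θ}ᶜ))
  rw [hasDerivAt_iff_tendsto_slope]
  refine hlim2.congr' ?_
  filter_upwards [nhdsWithin_le_nhds (hdet.eventually_ne h.ne_zero), self_mem_nhdsWithin]
    with r hr hrθ
  have hrθ' : r - θ ≠ 0 := sub_ne_zero.mpr hrθ
  have e : (C₀ + r • D)⁻¹ - C⁻¹ = (r - θ) • -((C₀ + r • D)⁻¹ * D * C⁻¹) := by
    have e1 : (r - θ) • D = (C₀ + r • D) - C := by rw [hC, sub_smul]; abel
    rw [smul_neg, ← smul_mul_assoc, ← mul_smul_comm, e1, mul_sub, sub_mul,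
      Matrix.nonsing_inv_mul _ (Ne.isUnit hr), one_mul, mul_assoc, Matrix.mul_nonsing_inv _ h,
      mul_one, neg_sub]
  have e2 := congrFun (congrFun e i) j
  rw [Matrix.sub_apply, Matrix.smul_apply, smul_eq_mul] at e2
  rw [slope_def_field, e2, mul_div_cancel_left₀ _ hrθ']

/-- The ratio `(d/dθ) gauss C y / gauss C y` when `C` moves with velocity `D` and `y` with
velocity `b`. -/
def gaussRate (C D : Matrix (Fin n) (Fin n) ℝ) (b y : Space n) : ℝ :=
  -(1 / 2) * (C⁻¹ * D).trace - 1 / 2 * inner ℝ (act C⁻¹ y) b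
    + 1 / 4 * inner ℝ (act D (act C⁻¹ y)) (act C⁻¹ y)

lemma hasDerivAt_gauss {C₀ D : Matrix (Fin n) (Fin n) ℝ} {y b : Space n} {θ k m : ℝ} (hk : 0 < k)
    (h : Elliptic k m (C₀ + θ • D)) :
    HasDerivAt (fun r : ℝ => gauss (C₀ + r • D) (y + r • b))
      (gauss (C₀ + θ • D) (y + θ • b) * gaussRate (C₀ + θ • D) D b (y + θ • b)) θ := by
  have hu := h.isUnit_det hk
  have hp := h.det_pos hk
  have hdet := hasDerivAt_det_segment hu
  have hinv := fun i j => hasDerivAt_inv_segment (D := D) hu i j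
  have hy : ∀ i, HasDerivAt (fun r : ℝ => (y + r • b) i) (b i) θ := by
    intro i
    simpa using ((hasDerivAt_id θ).mul_const (b i)).const_add (y i)
  set C := C₀ + θ • D with hC
  set z := y + θ • b with hz
  have hq : HasDerivAt (fun r : ℝ => quadForm (C₀ + r • D)⁻¹ (y + r • b))
      (2 * inner ℝ (act C⁻¹ z) b - inner ℝ (act D (act C⁻¹ z)) (act C⁻¹ z)) θ := by
    have h1 : HasDerivAt (fun r : ℝ => quadForm (C₀ + r • D)⁻¹ (y + r • b))
        (∑ i, ∑ j, ((-(C⁻¹ * D * C⁻¹) i j * z i + C⁻¹ i j * b i) * z j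
          + C⁻¹ i j * z i * b j)) θ := by
      unfold quadForm
      refine HasDerivAt.fun_sum fun i _ => HasDerivAt.fun_sum fun j _ => ?_
      exact ((hinv i j).mul (hy i)).mul (hy j)
    refine h1.congr_deriv ?_
    have e1 : inner ℝ (act D (act C⁻¹ z)) (act C⁻¹ z) = quadForm (C⁻¹ * D * C⁻¹) z := by
      rw [quadForm_eq_inner, act_mul, act_mul, inner_act_comm h.inv_symm]
    have e2 : inner ℝ (act C⁻¹ z) b = ∑ i, ∑ j, C⁻¹ i j * b i * z j := by
      simp only [inner_eq_sum, act_apply, Finset.sum_mul]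
      exact Finset.sum_congr rfl fun i _ => Finset.sum_congr rfl fun j _ => by ring
    have e3 : inner ℝ (act C⁻¹ z) b = ∑ i, ∑ j, C⁻¹ i j * z i * b j := by
      rw [inner_act_comm h.inv_symm]
      simp only [inner_eq_sum, act_apply, Finset.mul_sum]
      exact Finset.sum_congr rfl fun i _ => Finset.sum_congr rfl fun j _ => by ring
    rw [two_mul]
    nth_rewrite 1 [e2]
    rw [e1, e3, quadForm, ← Finset.sum_add_distrib, ← Finset.sum_sub_distrib]
    refine Finset.sum_congr rfl fun i _ => ?_
    rw [← Finset.sum_add_distrib, ← Finset.sum_sub_distrib]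
    exact Finset.sum_congr rfl fun j _ => by ring
  have hs : HasDerivAt (fun r : ℝ => (Real.sqrt (C₀ + r • D).det)⁻¹)
      ((Real.sqrt C.det)⁻¹ * (-(1 / 2) * (C⁻¹ * D).trace)) θ := by
    have h1 := (hdet.sqrt hp.ne').inv (by positivity)
    refine h1.congr_deriv ?_
    have h2 : Real.sqrt C.det ≠ 0 := by positivity
    have h3 : C.det = Real.sqrt C.det ^ 2 := (Real.sq_sqrt hp.le).symm
    rw [← hC]
    field_simp
    rw [← h3]
    ring
  have he := (hq.div_const 4).neg.exp
  have := (hs.const_mul ((4 * Real.pi) ^ (-((n : ℝ) / 2)))).mul he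
  refine this.congr_deriv ?_
  simp only [gauss, gaussRate, Pi.neg_apply, ← hC, ← hz]
  ring

/-! ### Measurability and continuity of the Gaussian -/

section Regularity

variable {X : Type*}

lemma measurable_gauss [MeasurableSpace X] {C : X → Matrix (Fin n) (Fin n) ℝ} {y : X → Space n}
    (hC : ∀ i j, Measurable fun p => C p i j) (hy : Measurable y) :
    Measurable fun p => gauss (C p) (y p) := by
  have hdet : Measurable fun p => (C p).det := by
    simp only [Matrix.det_apply]
    fun_prop
  have hyi : ∀ i, Measurable fun p => y p i := fun i => by fun_prop
  have hadj : ∀ i j, Measurable fun p => (C p).adjugate i j := by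
    intro i j
    simp only [Matrix.adjugate_apply, Matrix.det_apply]
    refine Finset.measurable_sum _ fun σ _ => ?_
    refine Measurable.const_smul (Finset.measurable_prod _ fun l _ => ?_) _
    simp only [Matrix.updateRow_apply]
    split_ifs
    · exact measurable_const
    · exact hC _ _
  have hinv : ∀ i j, Measurable fun p => (C p)⁻¹ i j := by
    intro i j
    simp only [Matrix.inv_def, Matrix.smul_apply, Ring.inverse_eq_inv', smul_eq_mul]
    exact hdet.inv.mul (hadj i j)
  unfold gauss quadForm
  refine (measurable_const.mul (hdet.sqrt.inv)).mul ?_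
  refine (Measurable.div_const ?_ 4).neg.exp
  exact Finset.measurable_sum _ fun i _ => Finset.measurable_sum _ fun j _ =>
    ((hinv i j).mul (hyi i)).mul (hyi j)

lemma tendsto_act {l : Filter X} {C : X → Matrix (Fin n) (Fin n) ℝ} {y : X → Space n}
    {C₀ : Matrix (Fin n) (Fin n) ℝ} {y₀ : Space n} (hC : Filter.Tendsto C l (nhds C₀))
    (hy : Filter.Tendsto y l (nhds y₀)) :
    Filter.Tendsto (fun p => act (C p) (y p)) l (nhds (act C₀ y₀)) := by
  rw [tendsto_matrix] at hC
  have hyi : ∀ i, Filter.Tendsto (fun p => y p i) l (nhds (y₀ i)) := fun i =>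
    ((by fun_prop : Continuous fun z : Space n => z i).tendsto y₀).comp hy
  have h : Filter.Tendsto (fun p => (act (C p) (y p)).ofLp) l (nhds (act C₀ y₀).ofLp) := by
    refine tendsto_pi_nhds.mpr fun i => ?_
    simp only [act_apply]
    exact tendsto_finsetSum _ fun j _ => (hC i j).mul (hyi j)
  exact ((PiLp.continuous_toLp 2 _).tendsto _).comp h

lemma tendsto_gauss {l : Filter X} {C : X → Matrix (Fin n) (Fin n) ℝ} {y : X → Space n}
    {C₀ : Matrix (Fin n) (Fin n) ℝ} {y₀ : Space n} (hC : Filter.Tendsto C l (nhds C₀))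
    (h0 : 0 < C₀.det) (hy : Filter.Tendsto y l (nhds y₀)) :
    Filter.Tendsto (fun p => gauss (C p) (y p)) l (nhds (gauss C₀ y₀)) := by
  have h1 : Filter.Tendsto (fun p => (C p).det) l (nhds C₀.det) :=
    (continuous_id.matrix_det.tendsto C₀).comp hC
  have h2 := (tendsto_act (tendsto_inv_matrix hC h0.ne') hy).inner (𝕜 := ℝ) hy
  unfold gauss
  simp only [quadForm_eq_inner]
  exact (tendsto_const_nhds.mul (h1.sqrt.inv₀ (by positivity))).mul
    ((h2.div_const 4).neg.rexp)

lemma tendsto_gaussRate {l : Filter X} {C D : X → Matrix (Fin n) (Fin n) ℝ} {b y : X → Space n}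
    {C₀ D₀ : Matrix (Fin n) (Fin n) ℝ} {b₀ y₀ : Space n} (hC : Filter.Tendsto C l (nhds C₀))
    (h0 : C₀.det ≠ 0) (hD : Filter.Tendsto D l (nhds D₀)) (hb : Filter.Tendsto b l (nhds b₀))
    (hy : Filter.Tendsto y l (nhds y₀)) :
    Filter.Tendsto (fun p => gaussRate (C p) (D p) (b p) (y p)) l
      (nhds (gaussRate C₀ D₀ b₀ y₀)) := by
  have hi := tendsto_inv_matrix hC h0
  have h1 := tendsto_act hi hy
  have h2 : Filter.Tendsto (fun p => ((C p)⁻¹ * D p).trace) l (nhds (C₀⁻¹ * D₀).trace) :=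
    (continuous_id.matrix_trace.tendsto _).comp (hi.mul hD)
  exact ((tendsto_const_nhds.mul h2).sub (tendsto_const_nhds.mul (h1.inner (𝕜 := ℝ) hb))).add
    (tendsto_const_nhds.mul ((tendsto_act hD h1).inner (𝕜 := ℝ) h1))

end Regularity

/-! ### The scalar heat kernel used as a majorant -/

/-- The normalized Gaussian `(πT/c)^{-n/2} exp(-c |y|² / T)`. For `n ≥ 1` it vanishes at `T = 0`. -/
def heat (c T : ℝ) (y : Space n) : ℝ :=
  (Real.pi * T / c) ^ (-((n : ℝ) / 2)) * Real.exp (-c * (‖y‖ ^ 2 / T))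

lemma heat_zero (hn : 1 ≤ n) (c : ℝ) (y : Space n) : heat c 0 y = 0 := by
  have : (-((n : ℝ) / 2)) ≠ 0 := by
    have : (0 : ℝ) < n := by exact_mod_cast hn
    intro h; linarith
  simp [heat, Real.zero_rpow this]

lemma heat_nonneg {c T : ℝ} (hc : 0 < c) (hT : 0 ≤ T) (y : Space n) : 0 ≤ heat c T y := by
  unfold heat; positivity

lemma elliptic_smul_one (r : ℝ) : Elliptic r r (r • (1 : Matrix (Fin n) (Fin n) ℝ)) where
  symm := by simp [Matrix.IsSymm]
  lower η := by
    rw [quadForm_smul, quadForm_eq_inner, act_one, real_inner_self_eq_norm_sq]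
  upper η := by
    rw [quadForm_smul, quadForm_eq_inner, act_one, real_inner_self_eq_norm_sq]

lemma heat_eq_gauss {c T : ℝ} (hc : 0 < c) (hT : 0 < T) (y : Space n) :
    heat c T y = gauss ((T / (4 * c)) • (1 : Matrix (Fin n) (Fin n) ℝ)) y := by
  have hr : 0 < T / (4 * c) := by positivity
  have hinv : ((T / (4 * c)) • (1 : Matrix (Fin n) (Fin n) ℝ))⁻¹ = (T / (4 * c))⁻¹ • 1 := by
    refine Matrix.inv_eq_left_inv ?_
    rw [smul_mul_smul_comm, inv_mul_cancel₀ hr.ne', one_mul, one_smul]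
  have hq : quadForm ((T / (4 * c)) • (1 : Matrix (Fin n) (Fin n) ℝ))⁻¹ y
      = 4 * c / T * ‖y‖ ^ 2 := by
    rw [hinv, quadForm_smul, quadForm_eq_inner, act_one, real_inner_self_eq_norm_sq]
    simp
  rw [gauss, hq, heat]
  congr 1
  · rw [Matrix.det_smul, Matrix.det_one, mul_one, Fintype.card_fin, Real.sqrt_eq_rpow,
      ← Real.rpow_natCast, ← Real.rpow_mul hr.le, ← Real.rpow_neg hr.le,
      show -((n : ℝ) * (1 / 2)) = -((n : ℝ) / 2) by ring,
      ← Real.mul_rpow (by positivity) hr.le]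
    congr 1
    field_simp
  · congr 1; ring

/-- The heat kernels form a convolution semigroup with no loss in the constants, so that iterated
integrals keep the same majorant. -/
lemma heat_conv {c T S : ℝ} (hc : 0 < c) (hT : 0 < T) (hS : 0 < S) (x ξ : Space n) :
    Integrable (fun η : Space n => heat c T (x - η) * heat c S (η - ξ)) ∧
    ∫ η : Space n, heat c T (x - η) * heat c S (η - ξ) = heat c (T + S) (x - ξ) := by
  have hr : 0 < T / (4 * c) := by positivity
  have hs : 0 < S / (4 * c) := by positivity
  have := gauss_conv hr hs (elliptic_smul_one (n := n) _) (elliptic_smul_one _) x ξ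
  rw [← add_smul, ← add_div, ← heat_eq_gauss hc (by positivity)] at this
  simp_rw [heat_eq_gauss hc hT, heat_eq_gauss hc hS]
  exact this

/-! ### The operator applied to the parametrix -/

/-- The vector `b(x, t)` of first order coefficients. -/
def Operator.drift (L : Operator n) (p : SpaceTime n) : Space n := WithLp.toLp 2 fun i => L.b i p

lemma gaussKernel_inv_eq_gauss {A : Matrix (Fin n) (Fin n) ℝ} {k m T : ℝ} (hk : 0 < k)
    (hA : Elliptic k m A) (hT : 0 < T) (y : Space n) :
    gaussKernel A⁻¹ y T = gauss (T • A) y := by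
  have hinv : (T • A)⁻¹ = T⁻¹ • A⁻¹ := by
    refine Matrix.inv_eq_left_inv ?_
    rw [smul_mul_smul_comm, inv_mul_cancel₀ hT.ne', Matrix.nonsing_inv_mul _ (hA.isUnit_det hk),
      one_smul]
  have hd := hA.det_pos hk
  rw [gauss, gaussKernel, hinv, quadForm_smul, Matrix.det_nonsing_inv, Matrix.det_smul,
    Fintype.card_fin, Ring.inverse_eq_inv', Real.sqrt_mul (by positivity), Real.sqrt_inv,
    Real.mul_rpow (by positivity) hT.le, Real.rpow_neg (by positivity),
    Real.sqrt_eq_rpow (T ^ n), ← Real.rpow_natCast, ← Real.rpow_mul hT.le,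
    show (n : ℝ) * (1 / 2) = n / 2 by ring,
    show quadForm A⁻¹ y / (4 * T) = T⁻¹ * quadForm A⁻¹ y / 4 by field_simp]
  field_simp

lemma gaussRate_zero_left (C : Matrix (Fin n) (Fin n) ℝ) (b y : Space n) :
    gaussRate C 0 b y = -(1 / 2) * inner ℝ (act C⁻¹ y) b := by
  simp [gaussRate, act]

lemma hasLineDerivAt_gauss {C : Matrix (Fin n) (Fin n) ℝ} {k m : ℝ} (hk : 0 < k)
    (hC : Elliptic k m C) (ξ x : Space n) (i : Fin n) :
    HasLineDerivAt ℝ (fun y => gauss C (y - ξ)) (-(1 / 2) * act C⁻¹ (x - ξ) i * gauss C (x - ξ)) x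
      (EuclideanSpace.single i 1) := by
  have h := hasDerivAt_gauss (C₀ := C) (D := 0) (y := x - ξ) (b := EuclideanSpace.single i 1)
    (θ := 0) hk (by simpa using hC)
  simp only [smul_zero, add_zero, zero_smul, gaussRate_zero_left] at h
  unfold HasLineDerivAt
  have e : ∀ r : ℝ, x + r • EuclideanSpace.single i 1 - ξ
      = x - ξ + r • EuclideanSpace.single i (1 : ℝ) := fun r => by abel
  simp only [e]
  refine h.congr_deriv ?_
  simp [EuclideanSpace.inner_single_right]
  ring

lemma partialDeriv_gauss {C : Matrix (Fin n) (Fin n) ℝ} {k m : ℝ} (hk : 0 < k)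
    (hC : Elliptic k m C) (ξ : Space n) (i : Fin n) :
    partialDeriv i (fun y => gauss C (y - ξ))
      = fun x => -(1 / 2) * act C⁻¹ (x - ξ) i * gauss C (x - ξ) :=
  funext fun x => (hasLineDerivAt_gauss hk hC ξ x i).lineDeriv

lemma partialDeriv_partialDeriv_gauss {C : Matrix (Fin n) (Fin n) ℝ} {k m : ℝ} (hk : 0 < k)
    (hC : Elliptic k m C) (ξ x : Space n) (i j : Fin n) :
    partialDeriv i (partialDeriv j (fun y => gauss C (y - ξ))) x
      = (-(1 / 2) * C⁻¹ j i + 1 / 4 * act C⁻¹ (x - ξ) j * act C⁻¹ (x - ξ) i)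
        * gauss C (x - ξ) := by
  rw [partialDeriv_gauss hk hC]
  have h1 := hasLineDerivAt_gauss hk hC ξ x i
  have h2 : HasLineDerivAt ℝ (fun y => -(1 / 2) * act C⁻¹ (y - ξ) j) (-(1 / 2) * C⁻¹ j i) x
      (EuclideanSpace.single i 1) := by
    unfold HasLineDerivAt
    have e : ∀ r : ℝ, -(1 / 2) * act C⁻¹ (x + r • EuclideanSpace.single i 1 - ξ) j
        = -(1 / 2) * act C⁻¹ (x - ξ) j + r * (-(1 / 2) * C⁻¹ j i) := by
      intro r
      have e1 : x + r • EuclideanSpace.single i 1 - ξ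
        = x - ξ + r • EuclideanSpace.single i (1 : ℝ) := by abel
      have e2 : act C⁻¹ (EuclideanSpace.single i 1) j = C⁻¹ j i := by simp [act_apply]
      rw [e1, map_add, map_smul, PiLp.add_apply, PiLp.smul_apply, e2, smul_eq_mul]
      ring
    simp only [e]
    simpa using ((hasDerivAt_id (0 : ℝ)).mul_const (-(1 / 2) * C⁻¹ j i)).const_add
      (-(1 / 2) * act C⁻¹ (x - ξ) j)
  have h3 : HasDerivAt _ _ _ := HasDerivAt.mul h2 h1
  have h4 : HasLineDerivAt ℝ (fun y => -(1 / 2) * act C⁻¹ (y - ξ) j * gauss C (y - ξ)) _ x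
      (EuclideanSpace.single i 1) := h3
  rw [partialDeriv, h4.lineDeriv]
  simp only [zero_smul, add_zero]
  ring

namespace Operator.Admissible

variable {L : Operator n} {α N₁ N₂ M κ : ℝ}

lemma elliptic_a (h : L.Admissible α N₁ N₂ M κ) (p : SpaceTime n) : Elliptic κ M (L.a p) :=
  ⟨h.symm p, fun η => (h.elliptic p η).1, fun η => (h.elliptic p η).2⟩

lemma parametrix_eq (h : L.Admissible α N₁ N₂ M κ) (hκ : 0 < κ) {t τ : ℝ} (hτ : τ < t)
    (x ξ : Space n) : L.parametrix x t ξ τ = gauss ((t - τ) • L.a (ξ, τ)) (x - ξ) :=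
  gaussKernel_inv_eq_gauss hκ (h.elliptic_a _) (sub_pos.mpr hτ) _

/-- The parametrix solves the heat equation of the frozen operator, so `L Z` only sees the
oscillation of the leading coefficients and the lower order terms. -/
lemma apply_parametrix (h : L.Admissible α N₁ N₂ M κ) (hκ : 0 < κ) {t τ : ℝ} (hτ : τ < t)
    (x ξ : Space n) :
    L.apply (fun y s => L.parametrix y s ξ τ) x t = gauss ((t - τ) • L.a (ξ, τ)) (x - ξ)
      * (L.q (x, t) + gaussRate ((t - τ) • L.a (ξ, τ)) (L.a (x, t) - L.a (ξ, τ))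
          (L.drift (x, t)) (x - ξ)) := by
  set A' := L.a (ξ, τ) with hA'
  set C := (t - τ) • A' with hCdef
  have hT : 0 < t - τ := sub_pos.mpr hτ
  have hC : Elliptic ((t - τ) * κ) ((t - τ) * M) C := (h.elliptic_a _).smul hT.le
  have hk : 0 < (t - τ) * κ := by positivity
  have hsp : (fun y => L.parametrix y t ξ τ) = fun y => gauss C (y - ξ) :=
    funext fun y => h.parametrix_eq hκ hτ y ξ
  have htime : deriv (fun s => L.parametrix x s ξ τ) t
      = gauss C (x - ξ) * gaussRate C A' 0 (x - ξ) := by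
    have h1 := hasDerivAt_gauss (C₀ := -τ • A') (D := A') (y := x - ξ) (b := 0) (θ := t) hk
      (by rw [← add_smul]; convert hC using 2; ring)
    have e : ∀ s : ℝ, -τ • A' + s • A' = (s - τ) • A' := fun s => by rw [← add_smul]; ring_nf
    simp only [e, smul_zero, add_zero] at h1
    refine HasDerivAt.deriv (h1.congr_of_eventuallyEq ?_)
    filter_upwards [lt_mem_nhds hτ] with s hs
    exact h.parametrix_eq hκ hs x ξ
  have hd : gaussRate C A' 0 (x - ξ) = -(1 / 2) * (C⁻¹ * A').trace
      + 1 / 4 * inner ℝ (act A' (act C⁻¹ (x - ξ))) (act C⁻¹ (x - ξ)) := by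
    simp [gaussRate]
  have hsplit : gaussRate C (L.a (x, t) - A') (L.drift (x, t)) (x - ξ)
      = -(1 / 2) * (C⁻¹ * L.a (x, t)).trace - 1 / 2 * inner ℝ (act C⁻¹ (x - ξ)) (L.drift (x, t))
        + 1 / 4 * inner ℝ (act (L.a (x, t)) (act C⁻¹ (x - ξ))) (act C⁻¹ (x - ξ))
        - gaussRate C A' 0 (x - ξ) := by
    rw [hd, gaussRate, Matrix.mul_sub, Matrix.trace_sub, sub_eq_add_neg (L.a (x, t)) A', act_add,
      show -A' = (-1 : ℝ) • A' by simp, act_smul, inner_add_left, real_inner_smul_left]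
    ring
  have h2 : ∑ i, ∑ j, L.a (x, t) i j * partialDeriv i (partialDeriv j
      (fun y => L.parametrix y t ξ τ)) x = gauss C (x - ξ) * (-(1 / 2) * (C⁻¹ * L.a (x, t)).trace
        + 1 / 4 * inner ℝ (act (L.a (x, t)) (act C⁻¹ (x - ξ))) (act C⁻¹ (x - ξ))) := by
    rw [hsp, ← quadForm_eq_inner, Matrix.trace_mul_comm]
    simp only [partialDeriv_partialDeriv_gauss hk hC, quadForm, Matrix.trace, Matrix.diag,
      Matrix.mul_apply, Finset.mul_sum, ← Finset.sum_add_distrib]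
    exact Finset.sum_congr rfl fun i _ => Finset.sum_congr rfl fun j _ => by ring
  have h3 : ∑ i, L.b i (x, t) * partialDeriv i (fun y => L.parametrix y t ξ τ) x
      = gauss C (x - ξ) * (-(1 / 2) * inner ℝ (act C⁻¹ (x - ξ)) (L.drift (x, t))) := by
    rw [hsp, inner_eq_sum]
    simp only [partialDeriv_gauss hk hC, Finset.mul_sum, Operator.drift]
    exact Finset.sum_congr rfl fun i _ => by ring
  rw [Operator.apply, h2, h3, htime, hsplit, h.parametrix_eq hκ hτ, ← hA', ← hCdef]
  ring

/-! ### Pointwise consequences of the norm assumptions -/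

lemma abs_sub_le (h : L.Admissible α N₁ N₂ M κ) (hN₁ : 0 < N₁) (hα : 0 < α) (p p' : SpaceTime n) :
    ∑ i, ∑ j, |L.a p i j - L.a p' i j|
      ≤ N₁ * (‖p.1 - p'.1‖ ^ 2 + |p.2 - p'.2|) ^ (α / 2) := by
  by_cases hp : p = p'
  · subst hp; simp [Real.zero_rpow (by linarith : α / 2 ≠ 0)]
  set r := (‖p.1 - p'.1‖ ^ 2 + |p.2 - p'.2|) ^ (α / 2) with hr
  have hr0 : 0 < r := by
    refine Real.rpow_pos_of_pos ?_ _
    by_contra hc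
    have h1 : 0 ≤ ‖p.1 - p'.1‖ ^ 2 := by positivity
    have h2 := abs_nonneg (p.2 - p'.2)
    have h3 : ‖p.1 - p'.1‖ ^ 2 = 0 := by linarith
    have h4 : |p.2 - p'.2| = 0 := by linarith
    refine hp (Prod.ext ?_ ?_)
    · simpa [sub_eq_zero] using h3
    · simpa [sub_eq_zero] using h4
  have h1 : ENNReal.ofReal (∑ i, ∑ j, |L.a p i j - L.a p' i j| / r) ≤ ENNReal.ofReal N₁ := by
    refine le_trans ?_ h.bound_a
    rw [ENNReal.ofReal_sum_of_nonneg fun i _ => Finset.sum_nonneg fun j _ => by positivity]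
    refine Finset.sum_le_sum fun i _ => ?_
    rw [ENNReal.ofReal_sum_of_nonneg fun j _ => by positivity]
    refine Finset.sum_le_sum fun j _ => ?_
    exact le_iSup_of_le p (le_iSup_of_le p' (le_iSup_of_le hp le_rfl))
  rw [ENNReal.ofReal_le_ofReal_iff hN₁.le] at h1
  simp_rw [← Finset.sum_div] at h1
  rwa [div_le_iff₀ hr0] at h1

lemma lower_order_le (h : L.Admissible α N₁ N₂ M κ) (hN₂ : 0 < N₂) (p : SpaceTime n) :
    ‖L.drift p‖ ≤ N₂ ∧ |L.q p| ≤ N₂ := by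
  have h1 : ENNReal.ofReal (∑ i, |L.b i p| + |L.q p|) ≤ ENNReal.ofReal N₂ := by
    refine le_trans ?_ h.bound_lower
    rw [ENNReal.ofReal_add (by positivity) (by positivity),
      ENNReal.ofReal_sum_of_nonneg fun i _ => by positivity]
    gcongr with i
    · exact le_iSup (fun p => ENNReal.ofReal |L.b i p|) p
    · exact le_iSup (fun p => ENNReal.ofReal |L.q p|) p
  rw [ENNReal.ofReal_le_ofReal_iff hN₂.le] at h1
  have h2 : 0 ≤ ∑ i, |L.b i p| := by positivity
  have h3 := abs_nonneg (L.q p)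
  refine ⟨?_, by linarith⟩
  refine le_trans ?_ (by linarith : ∑ i, |L.b i p| ≤ N₂)
  have h4 : L.drift p = ∑ i, L.b i p • EuclideanSpace.single i (1 : ℝ) := by
    ext j
    simp [Operator.drift, Finset.sum_apply, Pi.single_apply]
  rw [h4]
  refine (norm_sum_le _ _).trans (Finset.sum_le_sum fun i _ => ?_)
  simp [norm_smul]

end Operator.Admissible

/-! ### The Gaussian bound for the derivative along a segment -/

lemma abs_inner_act_le (D : Matrix (Fin n) (Fin n) ℝ) (w : Space n) :
    |inner ℝ (act D w) w| ≤ (∑ i, ∑ j, |D i j|) * ‖w‖ ^ 2 := by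
  rw [← quadForm_eq_inner, quadForm, Finset.sum_mul]
  refine (Finset.abs_sum_le_sum_abs _ _).trans (Finset.sum_le_sum fun i _ => ?_)
  rw [Finset.sum_mul]
  refine (Finset.abs_sum_le_sum_abs _ _).trans (Finset.sum_le_sum fun j _ => ?_)
  rw [abs_mul, abs_mul, mul_assoc, pow_two]
  have h1 := PiLp.norm_apply_le w i
  have h2 := PiLp.norm_apply_le w j
  rw [Real.norm_eq_abs] at h1 h2
  gcongr

lemma abs_gaussRate_le {C D : Matrix (Fin n) (Fin n) ℝ} {k m : ℝ} (hk : 0 < k)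
    (hC : Elliptic k m C) (b z : Space n) :
    |gaussRate C D b z| ≤ (∑ i, ∑ j, |D i j|) / (2 * k) + ‖b‖ * ‖z‖ / (2 * k)
      + (∑ i, ∑ j, |D i j|) * ‖z‖ ^ 2 / (4 * k ^ 2) := by
  set δ := ∑ i, ∑ j, |D i j| with hδ
  have hδ0 : 0 ≤ δ := by positivity
  have h1 : |(C⁻¹ * D).trace| ≤ δ / k := by
    rw [Matrix.trace_mul_comm]
    simp only [Matrix.trace, Matrix.diag, Matrix.mul_apply]
    rw [hδ, Finset.sum_div]
    refine (Finset.abs_sum_le_sum_abs _ _).trans (Finset.sum_le_sum fun i _ => ?_)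
    rw [Finset.sum_div]
    refine (Finset.abs_sum_le_sum_abs _ _).trans (Finset.sum_le_sum fun j _ => ?_)
    rw [abs_mul, div_eq_mul_one_div]
    gcongr
    exact hC.abs_inv_apply_le hk j i
  have hw := hC.norm_inv_le hk z
  have h2 : |inner ℝ (act C⁻¹ z) b| ≤ ‖z‖ / k * ‖b‖ :=
    (abs_real_inner_le_norm _ _).trans (by gcongr)
  have h3 : |inner ℝ (act D (act C⁻¹ z)) (act C⁻¹ z)| ≤ δ * (‖z‖ / k) ^ 2 :=
    (abs_inner_act_le _ _).trans (by gcongr)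
  unfold gaussRate
  have e : δ / (2 * k) + ‖b‖ * ‖z‖ / (2 * k) + δ * ‖z‖ ^ 2 / (4 * k ^ 2)
      = 1 / 2 * (δ / k) + 1 / 2 * (‖z‖ / k * ‖b‖) + 1 / 4 * (δ * (‖z‖ / k) ^ 2) := by
    field_simp
  rw [e]
  rw [abs_le] at h1 h2 h3 ⊢
  constructor <;> linarith

lemma gauss_le {C : Matrix (Fin n) (Fin n) ℝ} {k m : ℝ} (hk : 0 < k) (hm : 0 < m)
    (hC : Elliptic k m C) (z : Space n) :
    gauss C z ≤ (4 * Real.pi * k) ^ (-((n : ℝ) / 2)) * Real.exp (-(‖z‖ ^ 2 / m / 4)) := by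
  rw [gauss, Real.mul_rpow (by positivity) hk.le]
  have h1 : (Real.sqrt C.det)⁻¹ ≤ k ^ (-((n : ℝ) / 2)) := by
    rw [Real.rpow_neg hk.le]
    refine inv_anti₀ (by positivity) ?_
    rw [show k ^ ((n : ℝ) / 2) = Real.sqrt (k ^ n) by
      rw [Real.sqrt_eq_rpow, ← Real.rpow_natCast, ← Real.rpow_mul hk.le]; congr 1; ring]
    exact Real.sqrt_le_sqrt (hC.det_bounds hk).1
  have h2 := hC.le_quadForm_inv hk hm z
  gcongr

lemma le_gauss {C : Matrix (Fin n) (Fin n) ℝ} {k m : ℝ} (hk : 0 < k) (hm : 0 < m)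
    (hC : Elliptic k m C) (z : Space n) :
    (4 * Real.pi * m) ^ (-((n : ℝ) / 2)) * Real.exp (-(‖z‖ ^ 2 / k / 4)) ≤ gauss C z := by
  rw [gauss, Real.mul_rpow (by positivity) hm.le]
  have hd := hC.det_pos hk
  have h1 : m ^ (-((n : ℝ) / 2)) ≤ (Real.sqrt C.det)⁻¹ := by
    rw [Real.rpow_neg hm.le]
    refine inv_anti₀ (by positivity) ?_
    rw [show m ^ ((n : ℝ) / 2) = Real.sqrt (m ^ n) by
      rw [Real.sqrt_eq_rpow, ← Real.rpow_natCast, ← Real.rpow_mul hm.le]; congr 1; ring]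
    exact Real.sqrt_le_sqrt (hC.det_bounds hk).2
  have h2 := hC.quadForm_inv_le hk z
  gcongr

lemma rpow_le_one_add {T p : ℝ} (hT : 0 < T) (hp0 : 0 ≤ p) (hp1 : p ≤ 1) : T ^ p ≤ 1 + T := by
  rcases le_total T 1 with h | h
  · exact (Real.rpow_le_one hT.le h hp0).trans (by linarith)
  · calc T ^ p ≤ T ^ (1 : ℝ) := Real.rpow_le_rpow_of_exponent_le h hp1
      _ ≤ _ := by rw [Real.rpow_one]; linarith

/-- The frozen quantity `d/dθ [e^{θ q} gauss (C₀ + θ D) (y + θ b)]`, written at the point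
`C = C₀ + θ D`. -/
def segmentDeriv (q θ : ℝ) (C D : Matrix (Fin n) (Fin n) ℝ) (b y : Space n) : ℝ :=
  Real.exp (θ * q) * (gauss C (y + θ • b) * (q + gaussRate C D b (y + θ • b)))

/-- The exponential rate in the bound of `abs_segmentDeriv_le`. -/
def segmentRate (N₂ M : ℝ) : ℝ := N₂ + 2 + 3 * N₂ ^ 2 / (4 * M)

/-- The constant in the bound of `abs_segmentDeriv_le`. -/
def segmentConst (n : ℕ) (N₁ N₂ M κ : ℝ) : ℝ :=
  (N₂ + N₁ / (2 * κ) + 3 * N₂ * (1 + N₂ ^ 2) / (2 * κ) + N₁ * (1 + N₂ ^ 2) / (2 * κ ^ 2))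
    * (1 + 32 * M) ^ 2 * (2 * M / κ) ^ ((n : ℝ) / 2)

lemma segmentRate_nonneg {N₂ M : ℝ} (hN₂ : 0 < N₂) (hM : 0 < M) : 0 ≤ segmentRate N₂ M := by
  unfold segmentRate; positivity

lemma segmentConst_nonneg {N₁ N₂ M κ : ℝ} (hN₁ : 0 < N₁) (hN₂ : 0 < N₂) (hM : 0 < M)
    (hκ : 0 < κ) : 0 ≤ segmentConst n N₁ N₂ M κ := by
  unfold segmentConst; positivity

/-- The scalar inequality behind `abs_segmentDeriv_le`, with `R` for `|y|² / T`, `z` for the norm of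
the shifted point and `δ` for the oscillation of the leading coefficients. -/
lemma rate_polynomial_bound {β N₁ N₂ κ T R Y z δ r : ℝ} (hβ0 : 0 < β) (hβ : β ≤ 1 / 2)
    (hN₁ : 0 < N₁) (hN₂ : 0 < N₂) (hκ : 0 < κ) (hT : 0 < T) (hR : 0 ≤ R) (hY : Y = R * T)
    (hδ : δ ≤ N₁ * (Y + T) ^ β)
    (hz : z ^ 2 ≤ 2 * T * (R + T * N₂ ^ 2))
    (hr : r ≤ N₂ + (δ / (2 * (T * κ)) + N₂ * z / (2 * (T * κ)) + δ * z ^ 2 / (4 * (T * κ) ^ 2))) :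
    r ≤ (N₂ + N₁ / (2 * κ) + 3 * N₂ * (1 + N₂ ^ 2) / (2 * κ) + N₁ * (1 + N₂ ^ 2) / (2 * κ ^ 2))
      * (1 + T) ^ 2 * (1 + R) ^ 2 * T ^ (β - 1) := by
  set V := 1 + N₂ ^ 2 with hV
  set S := R + T * N₂ ^ 2 with hS
  set P := T ^ (β - 1) with hP
  have hP0 : 0 < P := by positivity
  have hV1 : 1 ≤ V := by rw [hV]; nlinarith
  have hS0 : 0 ≤ S := by positivity
  have hone : 1 ≤ P * (1 + T) := by
    calc (1 : ℝ) = P * T ^ (1 - β) := by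
          rw [hP, ← Real.rpow_add hT]; norm_num
      _ ≤ _ := by gcongr; exact rpow_le_one_add hT (by linarith) (by linarith)
  have hdT : δ / T ≤ N₁ * (1 + R) * P := by
    have h1 : (Y + T) ^ β ≤ T ^ β * (1 + R) := by
      rw [hY, show R * T + T = T * (1 + R) by ring, Real.mul_rpow hT.le (by linarith)]
      gcongr
      calc (1 + R) ^ β ≤ (1 + R) ^ (1 : ℝ) :=
            Real.rpow_le_rpow_of_exponent_le (by linarith) (by linarith)
        _ = _ := Real.rpow_one _
    rw [div_le_iff₀ hT]
    calc δ ≤ N₁ * (T ^ β * (1 + R)) := hδ.trans (by gcongr)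
      _ = N₁ * (1 + R) * P * T := by
          have : T ^ β = P * T := by
            rw [hP, Real.rpow_sub_one hT.ne']; field_simp
          rw [this]; ring
  have hzT : z / T ≤ P * (1 + T) * (1 + 2 * S) := by
    have hs : 0 < Real.sqrt T := by positivity
    have hss : Real.sqrt T ^ 2 = T := Real.sq_sqrt hT.le
    have h1 : (Real.sqrt T)⁻¹ ≤ P * (1 + T) := by
      calc (Real.sqrt T)⁻¹ = P * T ^ (1 / 2 - β) := by
            rw [hP, ← Real.rpow_add hT, Real.sqrt_eq_rpow, ← Real.rpow_neg hT.le]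
            congr 1; ring
        _ ≤ _ := by gcongr; exact rpow_le_one_add hT (by linarith) (by linarith)
    have h2 : z ≤ Real.sqrt T * (1 + 2 * S) := by
      have h3 : z ^ 2 ≤ (Real.sqrt T * (1 + 2 * S)) ^ 2 := by
        rw [mul_pow, hss]; nlinarith
      exact (abs_le_of_sq_le_sq' h3 (by positivity)).2
    calc z / T ≤ Real.sqrt T * (1 + 2 * S) / T := by gcongr
      _ = (Real.sqrt T)⁻¹ * (1 + 2 * S) := by
          nth_rewrite 2 [← hss]; field_simp
      _ ≤ _ := by gcongr
  have hSb : 1 + 2 * S ≤ 3 * V * ((1 + T) * (1 + R)) := by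
    have : S ≤ V * ((1 + T) * (1 + R)) - 1 := by
      rw [hS, hV]
      nlinarith [mul_nonneg hT.le hR, sq_nonneg N₂, mul_nonneg (sq_nonneg N₂) hR,
        mul_nonneg (sq_nonneg N₂) (mul_nonneg hT.le hR)]
    nlinarith [mul_nonneg hT.le hR]
  have hSb' : S ≤ V * ((1 + T) * (1 + R)) := by
    rw [hS, hV]
    nlinarith [mul_nonneg hT.le hR, sq_nonneg N₂, mul_nonneg (sq_nonneg N₂) hR,
        mul_nonneg (sq_nonneg N₂) (mul_nonneg hT.le hR)]
  have hA : 1 ≤ 1 + T := by linarith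
  have hB : 1 ≤ 1 + R := by linarith
  have t1 : N₂ ≤ N₂ * ((1 + T) ^ 2 * (1 + R) ^ 2 * P) := by
    have : 1 ≤ (1 + T) ^ 2 * (1 + R) ^ 2 * P := by
      calc 1 ≤ P * (1 + T) := hone
        _ = P * ((1 + T) * 1 * 1) := by ring
        _ ≤ P * ((1 + T) * (1 + T) * (1 + R) ^ 2) := by
            have : 1 ≤ (1 + R) ^ 2 := one_le_pow₀ hB
            gcongr
        _ = _ := by ring
    nlinarith
  have t2 : δ / (2 * (T * κ)) ≤ N₁ / (2 * κ) * ((1 + T) ^ 2 * (1 + R) ^ 2 * P) := by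
    calc δ / (2 * (T * κ)) = δ / T / (2 * κ) := by field_simp
      _ ≤ N₁ * (1 + R) * P / (2 * κ) := by gcongr
      _ = N₁ / (2 * κ) * (1 * ((1 + R) * 1) * P) := by ring
      _ ≤ N₁ / (2 * κ) * ((1 + T) ^ 2 * ((1 + R) * (1 + R)) * P) := by
          have : 1 ≤ (1 + T) ^ 2 := one_le_pow₀ hA
          gcongr
      _ = _ := by ring
  have t3 : N₂ * z / (2 * (T * κ))
      ≤ 3 * N₂ * V / (2 * κ) * ((1 + T) ^ 2 * (1 + R) ^ 2 * P) := by
    calc N₂ * z / (2 * (T * κ)) = N₂ * (z / T) / (2 * κ) := by field_simp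
      _ ≤ N₂ * (P * (1 + T) * (3 * V * ((1 + T) * (1 + R)))) / (2 * κ) := by
          have h := hzT.trans (mul_le_mul_of_nonneg_left hSb (by positivity))
          gcongr
      _ = 3 * N₂ * V / (2 * κ) * ((1 + T) ^ 2 * ((1 + R) * 1) * P) := by ring
      _ ≤ 3 * N₂ * V / (2 * κ) * ((1 + T) ^ 2 * ((1 + R) * (1 + R)) * P) := by gcongr
      _ = _ := by ring
  have t4 : δ * z ^ 2 / (4 * (T * κ) ^ 2)
      ≤ N₁ * V / (2 * κ ^ 2) * ((1 + T) ^ 2 * (1 + R) ^ 2 * P) := by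
    calc δ * z ^ 2 / (4 * (T * κ) ^ 2) = (δ / T) * (z ^ 2 / T) / (4 * κ ^ 2) := by field_simp
      _ ≤ (N₁ * (1 + R) * P) * (2 * (V * ((1 + T) * (1 + R)))) / (4 * κ ^ 2) := by
          have h : z ^ 2 / T ≤ 2 * (V * ((1 + T) * (1 + R))) := by
            rw [div_le_iff₀ hT]
            calc z ^ 2 ≤ 2 * T * S := hz
              _ ≤ 2 * T * (V * ((1 + T) * (1 + R))) := by gcongr
              _ = _ := by ring
          gcongr
      _ = N₁ * V / (2 * κ ^ 2) * ((1 + T) * 1 * (1 + R) ^ 2 * P) := by ring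
      _ ≤ N₁ * V / (2 * κ ^ 2) * ((1 + T) * (1 + T) * (1 + R) ^ 2 * P) := by gcongr
      _ = _ := by ring
  calc r ≤ _ := hr
    _ ≤ _ := add_le_add t1 (add_le_add (add_le_add t2 t3) t4)
    _ = _ := by ring

/-- Uniform bound for the derivative along the segment of covariances: the Hölder condition
improves the scaling `T⁻¹` to `T^{α/2-1}`, and half of the Gaussian decay absorbs the
polynomial factors in `|y|² / T`. -/
lemma abs_segmentDeriv_le {α N₁ N₂ M κ : ℝ} (hα : 0 < α) (hα1 : α ≤ 1) (hN₁ : 0 < N₁)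
    (hN₂ : 0 < N₂) (hM : 0 < M) (hκ : 0 < κ) {T θ q : ℝ} (hT : 0 < T) (hθ0 : 0 ≤ θ) (hθ : θ ≤ T)
    {C D : Matrix (Fin n) (Fin n) ℝ} {b y : Space n} (hC : Elliptic (T * κ) (T * M) C)
    (hq : |q| ≤ N₂) (hb : ‖b‖ ≤ N₂)
    (hD : ∑ i, ∑ j, |D i j| ≤ N₁ * (‖y‖ ^ 2 + T) ^ (α / 2)) :
    |segmentDeriv q θ C D b y| ≤ segmentConst n N₁ N₂ M κ * T ^ (α / 2 - 1)
      * Real.exp (segmentRate N₂ M * T) * heat (1 / (8 * M)) T y := by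
  set z := y + θ • b with hz
  set R := ‖y‖ ^ 2 / T with hR
  have hR0 : 0 ≤ R := by positivity
  have hθb : ‖θ • b‖ ≤ T * N₂ := by
    rw [norm_smul, Real.norm_eq_abs, abs_of_nonneg hθ0]; gcongr
  have hz1 : ‖z‖ ^ 2 ≤ 2 * T * (R + T * N₂ ^ 2) := by
    have h1 : ‖z‖ ≤ ‖y‖ + T * N₂ := (norm_add_le _ _).trans (by gcongr)
    have h2 : ‖z‖ ^ 2 ≤ (‖y‖ + T * N₂) ^ 2 := by gcongr
    have h3 : T * R = ‖y‖ ^ 2 := by rw [hR]; field_simp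
    nlinarith [sq_nonneg (‖y‖ - T * N₂)]
  have hz2 : 3 / 4 * ‖y‖ ^ 2 - 3 * (T * N₂) ^ 2 ≤ ‖z‖ ^ 2 := by
    have h1 : ‖y‖ ≤ ‖z‖ + T * N₂ := by
      have : y = z - θ • b := by rw [hz]; abel
      rw [this]; exact (norm_sub_le _ _).trans (by gcongr)
    have h2 : ‖y‖ ^ 2 ≤ (‖z‖ + T * N₂) ^ 2 := by gcongr
    nlinarith [sq_nonneg (‖z‖ - 3 * (T * N₂))]
  have hrate : |q + gaussRate C D b z|
      ≤ (N₂ + N₁ / (2 * κ) + 3 * N₂ * (1 + N₂ ^ 2) / (2 * κ) + N₁ * (1 + N₂ ^ 2) / (2 * κ ^ 2))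
      * (1 + T) ^ 2 * (1 + R) ^ 2 * T ^ (α / 2 - 1) := by
    refine rate_polynomial_bound (δ := ∑ i, ∑ j, |D i j|) (by linarith) (by linarith) hN₁ hN₂ hκ hT
      hR0 (Y := ‖y‖ ^ 2) (by rw [hR]; field_simp) hD hz1 ?_
    refine (abs_add_le _ _).trans (add_le_add hq ?_)
    refine (abs_gaussRate_le (by positivity) hC b z).trans ?_
    gcongr
  have hgauss : gauss C z ≤ (2 * M / κ) ^ ((n : ℝ) / 2) * (Real.pi * T / (1 / (8 * M)))
      ^ (-((n : ℝ) / 2)) * (Real.exp (-(1 / (8 * M)) * R) * Real.exp (-(R / (16 * M)))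
        * Real.exp (3 * N₂ ^ 2 / (4 * M) * T)) := by
    refine (gauss_le (by positivity) (by positivity) hC z).trans ?_
    have e1 : (4 * Real.pi * (T * κ)) ^ (-((n : ℝ) / 2)) = (2 * M / κ) ^ ((n : ℝ) / 2)
        * (Real.pi * T / (1 / (8 * M))) ^ (-((n : ℝ) / 2)) := by
      rw [show 2 * M / κ = (κ / (2 * M))⁻¹ by rw [inv_div], Real.inv_rpow (by positivity),
        ← Real.rpow_neg (by positivity), ← Real.mul_rpow (by positivity) (by positivity)]
      congr 1; field_simp; ring
    rw [e1, ← Real.exp_add, ← Real.exp_add]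
    gcongr
    have h3 : ‖y‖ ^ 2 = T * R := by rw [hR]; field_simp
    rw [h3] at hz2
    have h4 : (3 / 4 * (T * R) - 3 * (T * N₂) ^ 2) / (T * M) / 4 ≤ ‖z‖ ^ 2 / (T * M) / 4 := by
      gcongr
    have h5 : (3 / 4 * (T * R) - 3 * (T * N₂) ^ 2) / (T * M) / 4
        = 1 / (8 * M) * R + R / (16 * M) - 3 * N₂ ^ 2 / (4 * M) * T := by
      field_simp; ring
    linarith
  have hexpq : Real.exp (θ * q) ≤ Real.exp (N₂ * T) := by
    refine Real.exp_le_exp.mpr ?_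
    calc θ * q ≤ θ * N₂ := by gcongr; exact (le_abs_self q).trans hq
      _ ≤ T * N₂ := by gcongr
      _ = _ := mul_comm _ _
  have hTexp : (1 + T) ^ 2 ≤ Real.exp (2 * T) := by
    rw [show 2 * T = T + T by ring, Real.exp_add, ← pow_two]
    have := Real.add_one_le_exp T
    have h0 : 0 ≤ 1 + T := by linarith
    gcongr; linarith
  have hRexp : (1 + R) ^ 2 * Real.exp (-(R / (16 * M))) ≤ (1 + 32 * M) ^ 2 := by
    have h1 : 1 + R ≤ (1 + 32 * M) * Real.exp (R / (32 * M)) := by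
      have h2 := Real.add_one_le_exp (R / (32 * M))
      have h3 : (1 + 32 * M) * (R / (32 * M) + 1) = 1 + R + (R / (32 * M) + 32 * M) := by
        field_simp; ring
      have h4 : 0 ≤ R / (32 * M) + 32 * M := by positivity
      nlinarith
    have h5 : Real.exp (-(R / (16 * M))) = (Real.exp (R / (32 * M)) ^ 2)⁻¹ := by
      rw [← Real.exp_nat_mul, ← Real.exp_neg]; congr 1; push_cast; field_simp; ring
    rw [h5, ← div_eq_mul_inv, div_le_iff₀ (by positivity), ← mul_pow]
    gcongr
  unfold segmentDeriv
  rw [abs_mul, abs_mul, Real.abs_exp, abs_of_nonneg (gauss_nonneg _ _), ← hz]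
  set c₀ := N₂ + N₁ / (2 * κ) + 3 * N₂ * (1 + N₂ ^ 2) / (2 * κ) + N₁ * (1 + N₂ ^ 2) / (2 * κ ^ 2)
    with hc₀
  have hc₀0 : 0 ≤ c₀ := by positivity
  set G := (2 * M / κ) ^ ((n : ℝ) / 2) with hG
  have hG0 : 0 ≤ G := by positivity
  set H := (Real.pi * T / (1 / (8 * M))) ^ (-((n : ℝ) / 2)) with hH
  have hH0 : 0 ≤ H := by positivity
  have hgz := gauss_nonneg C z
  calc Real.exp (θ * q) * (gauss C z * |q + gaussRate C D b z|)
      ≤ Real.exp (N₂ * T) * ((G * H * (Real.exp (-(1 / (8 * M)) * R) * Real.exp (-(R / (16 * M)))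
        * Real.exp (3 * N₂ ^ 2 / (4 * M) * T))) *
          (c₀ * (1 + T) ^ 2 * (1 + R) ^ 2 * T ^ (α / 2 - 1))) := by
        gcongr
    _ = c₀ * G * H * Real.exp (-(1 / (8 * M)) * R) * T ^ (α / 2 - 1) * Real.exp (N₂ * T)
          * Real.exp (3 * N₂ ^ 2 / (4 * M) * T) * (1 + T) ^ 2
          * ((1 + R) ^ 2 * Real.exp (-(R / (16 * M)))) := by ring
    _ ≤ c₀ * G * H * Real.exp (-(1 / (8 * M)) * R) * T ^ (α / 2 - 1) * Real.exp (N₂ * T)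
          * Real.exp (3 * N₂ ^ 2 / (4 * M) * T) * Real.exp (2 * T) * (1 + 32 * M) ^ 2 := by
        gcongr
    _ = _ := by
        have e : Real.exp (segmentRate N₂ M * T) = Real.exp (N₂ * T) * Real.exp (2 * T)
            * Real.exp (3 * N₂ ^ 2 / (4 * M) * T) := by
          rw [← Real.exp_add, ← Real.exp_add, segmentRate]; congr 1; ring
        rw [segmentConst, heat, e, ← hc₀, ← hG, ← hH]
        ring

/-! ### Weakly singular time integrals -/

/-- The weakly singular time weight `(t-σ)^{b-1} (σ-τ)^{β-1} e^{-μ(t-σ)}`. -/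
def timeWeight (b β μ τ t σ : ℝ) : ℝ :=
  (t - σ) ^ (b - 1) * (σ - τ) ^ (β - 1) * Real.exp (-μ * (t - σ))

/-- An explicit majorant of `timeWeight`, which separates the two singularities. -/
def timeMajorant (b β μ τ t σ : ℝ) : ℝ :=
  ((t - τ) / 2) ^ (β - 1) * ((t - σ) ^ (b - 1) * Real.exp (-μ * (t - σ)))
    + ((t - τ) / 2) ^ (b - 1) * Real.exp (-μ * ((t - τ) / 2)) * (σ - τ) ^ (β - 1)

lemma timeWeight_nonneg {b β μ τ t σ : ℝ} (h : σ ∈ Ioo τ t) : 0 ≤ timeWeight b β μ τ t σ := by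
  have h1 : 0 ≤ t - σ := by linarith [h.2]
  have h2 : 0 ≤ σ - τ := by linarith [h.1]
  unfold timeWeight; positivity

lemma timeWeight_le {b β μ τ t σ : ℝ} (hb1 : b ≤ 1) (hβ1 : β ≤ 1) (hμ : 0 ≤ μ)
    (h : σ ∈ Ioo τ t) : timeWeight b β μ τ t σ ≤ timeMajorant b β μ τ t σ := by
  have h1 : 0 < t - σ := by linarith [h.2]
  have h2 : 0 < σ - τ := by linarith [h.1]
  have h3 : 0 < (t - τ) / 2 := by linarith
  unfold timeWeight timeMajorant
  rcases le_total ((t - τ) / 2) (σ - τ) with h4 | h4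
  · have e : (σ - τ) ^ (β - 1) ≤ ((t - τ) / 2) ^ (β - 1) :=
      Real.rpow_le_rpow_of_nonpos h3 h4 (by linarith)
    have : 0 ≤ ((t - τ) / 2) ^ (b - 1) * Real.exp (-μ * ((t - τ) / 2)) * (σ - τ) ^ (β - 1) := by
      positivity
    calc (t - σ) ^ (b - 1) * (σ - τ) ^ (β - 1) * Real.exp (-μ * (t - σ))
        ≤ (t - σ) ^ (b - 1) * ((t - τ) / 2) ^ (β - 1) * Real.exp (-μ * (t - σ)) := by gcongr
      _ = ((t - τ) / 2) ^ (β - 1) * ((t - σ) ^ (b - 1) * Real.exp (-μ * (t - σ))) := by ring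
      _ ≤ _ := by linarith
  · have h5 : (t - τ) / 2 ≤ t - σ := by linarith
    have e : (t - σ) ^ (b - 1) ≤ ((t - τ) / 2) ^ (b - 1) :=
      Real.rpow_le_rpow_of_nonpos h3 h5 (by linarith)
    have e2 : Real.exp (-μ * (t - σ)) ≤ Real.exp (-μ * ((t - τ) / 2)) := by
      refine Real.exp_le_exp.mpr ?_
      nlinarith
    have : 0 ≤ ((t - τ) / 2) ^ (β - 1) * ((t - σ) ^ (b - 1) * Real.exp (-μ * (t - σ))) := by
      positivity
    calc (t - σ) ^ (b - 1) * (σ - τ) ^ (β - 1) * Real.exp (-μ * (t - σ))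
        ≤ ((t - τ) / 2) ^ (b - 1) * (σ - τ) ^ (β - 1) * Real.exp (-μ * ((t - τ) / 2)) := by gcongr
      _ = ((t - τ) / 2) ^ (b - 1) * Real.exp (-μ * ((t - τ) / 2)) * (σ - τ) ^ (β - 1) := by ring
      _ ≤ _ := by linarith

lemma intervalIntegrable_sub_rpow {β : ℝ} (hβ : 0 < β) (τ t : ℝ) :
    IntervalIntegrable (fun σ => (σ - τ) ^ (β - 1)) volume τ t := by
  have h := (intervalIntegral.intervalIntegrable_rpow' (a := 0) (b := t - τ)
    (by linarith : -1 < β - 1)).comp_sub_right τ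
  simpa using h

lemma intervalIntegrable_rpow_mul_exp {b : ℝ} (hb : 0 < b) (μ τ t : ℝ) :
    IntervalIntegrable (fun σ => (t - σ) ^ (b - 1) * Real.exp (-μ * (t - σ))) volume τ t := by
  have h := ((intervalIntegral.intervalIntegrable_rpow' (a := 0) (b := t - τ)
    (by linarith : -1 < b - 1)).mul_continuousOn
    (g := fun u => Real.exp (-μ * u)) (by fun_prop)).comp_sub_left t
  simpa using h.symm

lemma intervalIntegrable_timeMajorant {b β : ℝ} (hb : 0 < b) (hβ : 0 < β) (μ τ t : ℝ) :
    IntervalIntegrable (timeMajorant b β μ τ t) volume τ t :=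
  ((intervalIntegrable_rpow_mul_exp hb μ τ t).const_mul _).add
    ((intervalIntegrable_sub_rpow hβ τ t).const_mul _)

lemma integrableOn_timeWeight {b β μ τ t : ℝ} (hb : 0 < b) (hβ : 0 < β) (hb1 : b ≤ 1)
    (hβ1 : β ≤ 1) (hμ : 0 ≤ μ) (hτ : τ < t) :
    IntegrableOn (timeWeight b β μ τ t) (Ioo τ t) := by
  have h := (intervalIntegrable_iff_integrableOn_Ioo_of_le hτ.le).mp
    (intervalIntegrable_timeMajorant hb hβ μ τ t)
  refine Integrable.mono' h ?_ ?_
  · unfold timeWeight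
    exact (by fun_prop : Measurable fun σ => (t - σ) ^ (b - 1) * (σ - τ) ^ (β - 1)
      * Real.exp (-μ * (t - σ))).aestronglyMeasurable
  · filter_upwards [ae_restrict_mem measurableSet_Ioo] with σ hσ
    rw [Real.norm_eq_abs, abs_of_nonneg (timeWeight_nonneg hσ)]
    exact timeWeight_le hb1 hβ1 hμ hσ

lemma integral_sub_rpow {β : ℝ} (hβ : 0 < β) (τ t : ℝ) :
    ∫ σ in τ..t, (σ - τ) ^ (β - 1) = (t - τ) ^ β / β := by
  rw [intervalIntegral.integral_comp_sub_right (fun u => u ^ (β - 1)), sub_self,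
    integral_rpow (Or.inl (by linarith))]
  simp [Real.zero_rpow hβ.ne']

lemma integral_timeWeight_one_le {β μ τ t : ℝ} (hβ : 0 < β) (hβ1 : β ≤ 1) (hμ : 0 ≤ μ)
    (hτ : τ < t) : ∫ σ in Ioo τ t, timeWeight 1 β μ τ t σ ≤ (t - τ) ^ β / β := by
  rw [← integral_sub_rpow hβ, intervalIntegral.integral_of_le hτ.le, integral_Ioc_eq_integral_Ioo]
  refine setIntegral_mono_on (integrableOn_timeWeight one_pos hβ le_rfl hβ1 hμ hτ)
    ((intervalIntegrable_iff_integrableOn_Ioo_of_le hτ.le).mp (intervalIntegrable_sub_rpow hβ τ t))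
    measurableSet_Ioo fun σ hσ => ?_
  have h1 : 0 < t - σ := by linarith [hσ.2]
  have h2 : 0 < σ - τ := by linarith [hσ.1]
  unfold timeWeight
  simp only [sub_self, Real.rpow_zero, one_mul]
  refine mul_le_of_le_one_right (by positivity) (Real.exp_le_one_iff.mpr ?_)
  nlinarith

/-- A large exponential weight turns the weakly singular Volterra operator into a contraction. -/
lemma exists_integral_timeWeight_le {β : ℝ} (hβ : 0 < β) (hβ1 : β ≤ 1) {ε : ℝ} (hε : 0 < ε) :
    ∃ μ : ℝ, 0 ≤ μ ∧ ∀ τ t : ℝ, τ < t →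
      ∫ σ in Ioo τ t, timeWeight β β μ τ t σ ≤ ε * (t - τ) ^ (β - 1) := by
  set B := 2 * (Real.Gamma β + 2 / β) with hB
  have hG : 0 < Real.Gamma β := Real.Gamma_pos_of_pos hβ
  have hlim : Filter.Tendsto (fun μ : ℝ => B * μ ^ (-β)) Filter.atTop (nhds 0) := by
    simpa using (tendsto_rpow_neg_atTop hβ).const_mul B
  obtain ⟨μ, hμε, hμ⟩ := ((hlim.eventually_lt_const hε).and (Filter.eventually_gt_atTop 0)).exists
  refine ⟨μ, hμ.le, fun τ t hτ => ?_⟩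
  set s := t - τ with hs
  have hs0 : 0 < s := sub_pos.mpr hτ
  have h2 : (s / 2) ^ (β - 1) ≤ 2 * s ^ (β - 1) := by
    rw [Real.div_rpow hs0.le (by norm_num), div_eq_mul_inv, ← Real.rpow_neg (by norm_num), mul_comm]
    gcongr
    calc (2 : ℝ) ^ (-(β - 1)) ≤ 2 ^ (1 : ℝ) :=
          Real.rpow_le_rpow_of_exponent_le (by norm_num) (by linarith)
      _ = 2 := Real.rpow_one 2
  have hI1 : ∫ σ in τ..t, (t - σ) ^ (β - 1) * Real.exp (-μ * (t - σ))
      ≤ μ ^ (-β) * Real.Gamma β := by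
    rw [intervalIntegral.integral_comp_sub_left (fun u => u ^ (β - 1) * Real.exp (-μ * u)), sub_self,
      intervalIntegral.integral_of_le hs0.le]
    have h := Real.integral_rpow_mul_exp_neg_mul_Ioi hβ hμ
    have hi : IntegrableOn (fun u : ℝ => u ^ (β - 1) * Real.exp (-μ * u)) (Ioi 0) := by
      by_contra hc
      have h0 : ∫ u in Ioi (0 : ℝ), u ^ (β - 1) * Real.exp (-(μ * u)) = 0 := by
        simp only [neg_mul] at hc
        exact integral_undef hc
      rw [h0] at h
      have : 0 < (1 / μ) ^ β * Real.Gamma β := by positivity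
      linarith
    calc _ ≤ ∫ u in Ioi (0 : ℝ), u ^ (β - 1) * Real.exp (-μ * u) := by
          refine setIntegral_mono_set hi ?_ (Filter.Eventually.of_forall fun x hx => hx.1)
          filter_upwards [ae_restrict_mem measurableSet_Ioi] with u hu
          have : (0 : ℝ) < u := hu
          simp only [Pi.zero_apply]
          positivity
      _ = _ := by
          simp only [neg_mul]
          rw [h, one_div, Real.inv_rpow hμ.le, Real.rpow_neg hμ.le]
  have hI2 : Real.exp (-μ * (s / 2)) * (s ^ β / β) ≤ μ ^ (-β) * (2 / β) := by
    have h3 : (μ * s / 2) ^ β ≤ Real.exp (μ * s / 2) := by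
      calc (μ * s / 2) ^ β ≤ 1 + μ * s / 2 := rpow_le_one_add (by positivity) hβ.le hβ1
        _ ≤ _ := by linarith [Real.add_one_le_exp (μ * s / 2)]
    have h4 : s ^ β = (μ * s / 2) ^ β * (μ ^ (-β) * 2 ^ β) := by
      rw [Real.rpow_neg hμ.le, ← Real.inv_rpow hμ.le, ← Real.mul_rpow (by positivity) (by norm_num),
        ← Real.mul_rpow (by positivity) (by positivity)]
      congr 1; field_simp
    have h5 : (2 : ℝ) ^ β ≤ 2 := by
      calc (2 : ℝ) ^ β ≤ 2 ^ (1 : ℝ) := Real.rpow_le_rpow_of_exponent_le (by norm_num) hβ1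
        _ = 2 := Real.rpow_one 2
    have h6 : Real.exp (-μ * (s / 2)) * Real.exp (μ * s / 2) = 1 := by
      rw [← Real.exp_add]; ring_nf; simp
    calc Real.exp (-μ * (s / 2)) * (s ^ β / β)
        = Real.exp (-μ * (s / 2)) * (μ * s / 2) ^ β * (μ ^ (-β) * 2 ^ β) / β := by
          rw [h4]; ring
      _ ≤ Real.exp (-μ * (s / 2)) * Real.exp (μ * s / 2) * (μ ^ (-β) * 2) / β := by gcongr
      _ = _ := by rw [h6]; ring
  calc ∫ σ in Ioo τ t, timeWeight β β μ τ t σ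
      ≤ ∫ σ in Ioo τ t, timeMajorant β β μ τ t σ :=
        setIntegral_mono_on (integrableOn_timeWeight hβ hβ hβ1 hβ1 hμ.le hτ)
          ((intervalIntegrable_iff_integrableOn_Ioo_of_le hτ.le).mp
            (intervalIntegrable_timeMajorant hβ hβ μ τ t)) measurableSet_Ioo
          fun σ hσ => timeWeight_le hβ1 hβ1 hμ.le hσ
    _ = ∫ σ in τ..t, timeMajorant β β μ τ t σ := by
        rw [intervalIntegral.integral_of_le hτ.le, integral_Ioc_eq_integral_Ioo]
    _ = (s / 2) ^ (β - 1) * (∫ σ in τ..t, (t - σ) ^ (β - 1) * Real.exp (-μ * (t - σ)))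
        + (s / 2) ^ (β - 1) * (Real.exp (-μ * (s / 2)) * (s ^ β / β)) := by
        unfold timeMajorant
        rw [intervalIntegral.integral_add ((intervalIntegrable_rpow_mul_exp hβ μ τ t).const_mul _)
          ((intervalIntegrable_sub_rpow hβ τ t).const_mul _), intervalIntegral.integral_const_mul,
          intervalIntegral.integral_const_mul, integral_sub_rpow hβ, ← hs]
        ring
    _ ≤ (2 * s ^ (β - 1)) * (μ ^ (-β) * Real.Gamma β) + (2 * s ^ (β - 1)) * (μ ^ (-β) * (2 / β)) := by
        gcongr
        refine intervalIntegral.integral_nonneg hτ.le fun σ hσ => ?_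
        have : 0 ≤ t - σ := by linarith [hσ.2]
        positivity
    _ = B * μ ^ (-β) * s ^ (β - 1) := by rw [hB]; ring
    _ ≤ ε * s ^ (β - 1) := by gcongr

/-! ### Clocks and Gaussian majorants -/

/-- A clock: either the identity or a rounding of time to a grid. Treating both at once gives the
parametrix series and its time discretization the same estimates. The factor `2` is that of the
rounding: distinct rounded times differ by at least one step, and rounding changes a time lag by
less than one step. -/
structure IsClock (ρ : ℝ → ℝ) : Prop where
  mono : Monotone ρ
  gap : ∀ σ t, ρ σ < ρ t → t - σ ≤ 2 * (ρ t - ρ σ)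

lemma isClock_id : IsClock (fun t => t) :=
  ⟨fun _ _ h => h, fun σ t h => by linarith⟩

/-- The Gaussian majorant `e^{λ T} heat c T (x - ξ)` with `T = ρ t - ρ τ`. -/
def majorant (c lam : ℝ) (ρ : ℝ → ℝ) (x : Space n) (t : ℝ) (ξ : Space n) (τ : ℝ) : ℝ :=
  Real.exp (lam * (ρ t - ρ τ)) * heat c (ρ t - ρ τ) (x - ξ)

lemma majorant_nonneg {c lam : ℝ} {ρ : ℝ → ℝ} (hc : 0 < c) (hρ : IsClock ρ) (x ξ : Space n)
    {t τ : ℝ} (h : τ ≤ t) : 0 ≤ majorant c lam ρ x t ξ τ :=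
  mul_nonneg (Real.exp_nonneg _) (heat_nonneg hc (sub_nonneg.mpr (hρ.mono h)) _)

lemma majorant_mono {c lam lam' : ℝ} {ρ : ℝ → ℝ} (hc : 0 < c) (hρ : IsClock ρ) (hl : lam ≤ lam')
    (x ξ : Space n) {t τ : ℝ} (h : τ ≤ t) :
    majorant c lam ρ x t ξ τ ≤ majorant c lam' ρ x t ξ τ := by
  have := sub_nonneg.mpr (hρ.mono h)
  exact mul_le_mul_of_nonneg_right (Real.exp_le_exp.mpr (by gcongr)) (heat_nonneg hc this _)

lemma majorant_conv (hn : 1 ≤ n) {c lam₀ lam : ℝ} {ρ : ℝ → ℝ} (hc : 0 < c) (hρ : IsClock ρ)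
    (hl : lam₀ ≤ lam) (x ξ : Space n) {t σ τ : ℝ} (h1 : τ ≤ σ) (h2 : σ ≤ t) :
    Integrable (fun η => majorant c lam₀ ρ x t η σ * majorant c lam ρ η σ ξ τ) ∧
    ∫ η, majorant c lam₀ ρ x t η σ * majorant c lam ρ η σ ξ τ
      ≤ Real.exp (-((lam - lam₀) / 2) * (t - σ)) * majorant c lam ρ x t ξ τ := by
  have h0 : 0 ≤ Real.exp (-((lam - lam₀) / 2) * (t - σ)) * majorant c lam ρ x t ξ τ :=
    mul_nonneg (Real.exp_nonneg _) (majorant_nonneg hc hρ _ _ (h1.trans h2))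
  -- when two times are rounded to the same value, both sides vanish because `heat c 0 = 0`
  rcases (hρ.mono h2).eq_or_lt with h3 | h3
  · simp only [majorant, h3, sub_self, heat_zero hn, mul_zero, zero_mul, integral_zero]
    rw [majorant] at h0; exact ⟨integrable_zero _ _ _, h0⟩
  rcases (hρ.mono h1).eq_or_lt with h4 | h4
  · simp only [majorant, h4, sub_self, heat_zero hn, mul_zero, integral_zero]
    rw [majorant, h4] at h0; exact ⟨integrable_zero _ _ _, h0⟩
  obtain ⟨hI, hv⟩ := heat_conv (n := n) hc (sub_pos.mpr h3) (sub_pos.mpr h4) x ξ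
  have e : ∀ η, majorant c lam₀ ρ x t η σ * majorant c lam ρ η σ ξ τ
      = (Real.exp (lam₀ * (ρ t - ρ σ)) * Real.exp (lam * (ρ σ - ρ τ)))
        * (heat c (ρ t - ρ σ) (x - η) * heat c (ρ σ - ρ τ) (η - ξ)) := by
    intro η; unfold majorant; ring
  simp_rw [e]
  refine ⟨hI.const_mul _, ?_⟩
  rw [integral_const_mul, hv, sub_add_sub_cancel, majorant, ← mul_assoc, ← Real.exp_add,
    ← Real.exp_add]
  refine mul_le_mul_of_nonneg_right (Real.exp_le_exp.mpr ?_)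
    (heat_nonneg hc (sub_nonneg.mpr (h4.trans h3).le) _)
  have := hρ.gap σ t h3
  nlinarith

/-- A Gaussian bound that is uniform for times comparable with `T₀`. -/
lemma majorant_le_of_near {c lam : ℝ} {ρ : ℝ → ℝ} (hc : 0 < c) (hl : 0 ≤ lam) {T₀ : ℝ}
    (hT₀ : 0 < T₀) {x ξ : Space n} {t τ : ℝ} (h1 : T₀ / 2 ≤ ρ t - ρ τ) (h2 : ρ t - ρ τ ≤ 2 * T₀) :
    majorant c lam ρ x t ξ τ ≤ Real.exp (lam * (2 * T₀)) * (Real.pi * (T₀ / 2) / c)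
      ^ (-((n : ℝ) / 2)) * Real.exp (-(c / (2 * T₀)) * ‖x - ξ‖ ^ 2) := by
  have h3 : 0 < ρ t - ρ τ := by linarith
  rw [majorant, heat, mul_assoc]
  have e1 : (Real.pi * (ρ t - ρ τ) / c) ^ (-((n : ℝ) / 2))
      ≤ (Real.pi * (T₀ / 2) / c) ^ (-((n : ℝ) / 2)) := by
    refine Real.rpow_le_rpow_of_nonpos (by positivity) (by gcongr) ?_
    have : (0 : ℝ) ≤ n := by positivity
    linarith
  have e2 : -c * (‖x - ξ‖ ^ 2 / (ρ t - ρ τ)) ≤ -(c / (2 * T₀)) * ‖x - ξ‖ ^ 2 := by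
    have : ‖x - ξ‖ ^ 2 / (2 * T₀) ≤ ‖x - ξ‖ ^ 2 / (ρ t - ρ τ) := by gcongr
    have e : -(c / (2 * T₀)) * ‖x - ξ‖ ^ 2 = -c * (‖x - ξ‖ ^ 2 / (2 * T₀)) := by field_simp
    rw [e]; nlinarith
  gcongr

/-! ### Volterra series of weakly singular Gaussian kernels -/

/-- A measurable kernel on space-time with
`|K(x,t;η,σ)| ≤ C (t-σ)^{b-1} e^{λ T} heat c T (x-η)`, where `T = ρ t - ρ σ`. -/
structure KernelBound (c lam C b : ℝ) (ρ : ℝ → ℝ) (K : Space n → ℝ → Space n → ℝ → ℝ) : Prop where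
  meas : Measurable fun p : SpaceTime n × SpaceTime n => K p.1.1 p.1.2 p.2.1 p.2.2
  bound : ∀ x t η σ, σ < t → |K x t η σ| ≤ C * (t - σ) ^ (b - 1) * majorant c lam ρ x t η σ

/-- The corresponding bound for a function `f(x,t)` with pole `(ξ, τ)`. -/
structure PoleBound (c lam F β : ℝ) (ρ : ℝ → ℝ) (ξ : Space n) (τ : ℝ) (f : Space n → ℝ → ℝ) :
    Prop where
  meas : Measurable fun p : SpaceTime n => f p.1 p.2
  bound : ∀ x t, τ < t → |f x t| ≤ F * (t - τ) ^ (β - 1) * majorant c lam ρ x t ξ τ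

/-- The Volterra operator `f ↦ ∫_τ^t ∫ K(x,t;η,σ) f(η,σ) dη dσ`. -/
def volterra (K : Space n → ℝ → Space n → ℝ → ℝ) (τ : ℝ) (f : Space n → ℝ → ℝ) (x : Space n)
    (t : ℝ) : ℝ :=
  ∫ σ in τ..t, ∫ η, K x t η σ * f η σ

section Estimates

variable {c lam₀ lam C F b β : ℝ} {ρ : ℝ → ℝ} {K : Space n → ℝ → Space n → ℝ → ℝ}
  {ξ : Space n} {τ : ℝ} {f : Space n → ℝ → ℝ}

lemma volterra_eq (x : Space n) {t : ℝ} (hτ : τ ≤ t) :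
    volterra K τ f x t = ∫ σ in Ioo τ t, ∫ η, K x t η σ * f η σ := by
  rw [volterra, intervalIntegral.integral_of_le hτ, integral_Ioc_eq_integral_Ioo]

lemma KernelBound.measurable_mul (hK : KernelBound c lam₀ C b ρ K)
    (hf : Measurable fun p : SpaceTime n => f p.1 p.2) :
    Measurable fun p : (SpaceTime n × ℝ) × Space n => K p.1.1.1 p.1.1.2 p.2 p.1.2 * f p.2 p.1.2 := by
  have h1 := hK.meas.comp (f := fun p : (SpaceTime n × ℝ) × Space n =>
    ((p.1.1, (p.2, p.1.2)) : SpaceTime n × SpaceTime n)) (by fun_prop)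
  have h2 := hf.comp (f := fun p : (SpaceTime n × ℝ) × Space n => ((p.2, p.1.2) : SpaceTime n))
    (by fun_prop)
  exact h1.mul h2

lemma measurable_volterra (hK : KernelBound c lam₀ C b ρ K)
    (hf : Measurable fun p : SpaceTime n => f p.1 p.2) :
    Measurable fun p : SpaceTime n => volterra K τ f p.1 p.2 := by
  have h1 : StronglyMeasurable fun q : SpaceTime n × ℝ =>
      ∫ η, K q.1.1 q.1.2 η q.2 * f η q.2 :=
    (hK.measurable_mul hf).stronglyMeasurable.integral_prod_right'
  have h2 : ∀ s : Set (SpaceTime n × ℝ), MeasurableSet s → StronglyMeasurable fun p : SpaceTime n =>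
      ∫ σ, s.indicator (fun q : SpaceTime n × ℝ => ∫ η, K q.1.1 q.1.2 η q.2 * f η q.2) (p, σ) :=
    fun s hs => (h1.indicator hs).integral_prod_right'
  have ha := h2 {q | q.2 ∈ Ioc τ q.1.2} (by
    simp only [mem_Ioc]
    exact (measurableSet_lt measurable_const measurable_snd).inter
      (measurableSet_le measurable_snd measurable_fst.snd))
  have hb := h2 {q | q.2 ∈ Ioc q.1.2 τ} (by
    simp only [mem_Ioc]
    exact (measurableSet_lt measurable_fst.snd measurable_snd).inter
      (measurableSet_le measurable_snd measurable_const))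
  have e : (fun p : SpaceTime n => volterra K τ f p.1 p.2) = fun p =>
      (∫ σ, {q : SpaceTime n × ℝ | q.2 ∈ Ioc τ q.1.2}.indicator
        (fun q => ∫ η, K q.1.1 q.1.2 η q.2 * f η q.2) (p, σ))
      - ∫ σ, {q : SpaceTime n × ℝ | q.2 ∈ Ioc q.1.2 τ}.indicator
        (fun q => ∫ η, K q.1.1 q.1.2 η q.2 * f η q.2) (p, σ) := by
    funext p
    rw [volterra, intervalIntegral, ← integral_indicator measurableSet_Ioc,
      ← integral_indicator measurableSet_Ioc]
    rfl
  rw [e]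
  exact (ha.sub hb).measurable

/-- The spatial integral in the Volterra operator. -/
lemma inner_bound (hn : 1 ≤ n) (hc : 0 < c) (hρ : IsClock ρ) (hl : lam₀ ≤ lam) (hC : 0 ≤ C)
    (hF : 0 ≤ F) (hK : KernelBound c lam₀ C b ρ K) (hf : PoleBound c lam F β ρ ξ τ f) (x : Space n)
    {t σ : ℝ} (hσ : σ ∈ Ioo τ t) :
    Integrable (fun η => K x t η σ * f η σ) ∧
    ∫ η, ‖K x t η σ * f η σ‖ ≤ C * F * majorant c lam ρ x t ξ τ
      * timeWeight b β ((lam - lam₀) / 2) τ t σ := by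
  have h1 : 0 < t - σ := by linarith [hσ.2]
  have h2 : 0 < σ - τ := by linarith [hσ.1]
  obtain ⟨hI, hv⟩ := majorant_conv hn hc hρ hl x ξ hσ.1.le hσ.2.le
  have hpt : ∀ η, ‖K x t η σ * f η σ‖ ≤ C * F * ((t - σ) ^ (b - 1) * (σ - τ) ^ (β - 1))
      * (majorant c lam₀ ρ x t η σ * majorant c lam ρ η σ ξ τ) := by
    intro η
    rw [norm_mul, Real.norm_eq_abs, Real.norm_eq_abs]
    have m1 := majorant_nonneg (lam := lam₀) hc hρ x η hσ.2.le
    calc _ ≤ (C * (t - σ) ^ (b - 1) * majorant c lam₀ ρ x t η σ)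
          * (F * (σ - τ) ^ (β - 1) * majorant c lam ρ η σ ξ τ) :=
          mul_le_mul (hK.bound x t η σ hσ.2) (hf.bound η σ hσ.1) (abs_nonneg _) (by positivity)
      _ = _ := by ring
  have hmeas : Measurable fun η => K x t η σ * f η σ :=
    (hK.measurable_mul hf.meas).comp (f := fun η => (((x, t), σ), η)) (by fun_prop)
  have hint : Integrable (fun η => K x t η σ * f η σ) :=
    Integrable.mono' (hI.const_mul _) hmeas.aestronglyMeasurable (Filter.Eventually.of_forall hpt)
  refine ⟨hint, (integral_mono hint.norm (hI.const_mul _) hpt).trans ?_⟩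
  rw [integral_const_mul, timeWeight]
  calc _ ≤ C * F * ((t - σ) ^ (b - 1) * (σ - τ) ^ (β - 1))
        * (Real.exp (-((lam - lam₀) / 2) * (t - σ)) * majorant c lam ρ x t ξ τ) := by gcongr
    _ = _ := by ring

lemma integrableOn_product (hn : 1 ≤ n) (hc : 0 < c) (hρ : IsClock ρ) (hl : lam₀ ≤ lam)
    (hC : 0 ≤ C) (hF : 0 ≤ F) (hb : 0 < b) (hb1 : b ≤ 1) (hβ : 0 < β) (hβ1 : β ≤ 1)
    (hK : KernelBound c lam₀ C b ρ K) (hf : PoleBound c lam F β ρ ξ τ f) (x : Space n)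
    {t : ℝ} (hτ : τ < t) :
    IntegrableOn (fun p : ℝ × Space n => K x t p.2 p.1 * f p.2 p.1) (Ioo τ t ×ˢ univ) := by
  have hmeas : Measurable fun p : ℝ × Space n => K x t p.2 p.1 * f p.2 p.1 :=
    (hK.measurable_mul hf.meas).comp (f := fun p : ℝ × Space n => (((x, t), p.1), p.2))
      (by fun_prop)
  rw [IntegrableOn, Measure.volume_eq_prod, ← Measure.prod_restrict, Measure.restrict_univ,
    integrable_prod_iff hmeas.aestronglyMeasurable]
  refine ⟨?_, ?_⟩
  · filter_upwards [ae_restrict_mem measurableSet_Ioo] with σ hσ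
    exact (inner_bound hn hc hρ hl hC hF hK hf x hσ).1
  · refine Integrable.mono' ((integrableOn_timeWeight hb hβ hb1 hβ1
      (by linarith : 0 ≤ (lam - lam₀) / 2) hτ).const_mul (C * F * majorant c lam ρ x t ξ τ)) ?_ ?_
    · exact (hmeas.norm.stronglyMeasurable.integral_prod_right').aestronglyMeasurable
    · filter_upwards [ae_restrict_mem measurableSet_Ioo] with σ hσ
      rw [Real.norm_eq_abs, abs_of_nonneg (integral_nonneg fun _ => norm_nonneg _)]
      exact (inner_bound hn hc hρ hl hC hF hK hf x hσ).2

lemma abs_volterra_le (hn : 1 ≤ n) (hc : 0 < c) (hρ : IsClock ρ) (hl : lam₀ ≤ lam)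
    (hC : 0 ≤ C) (hF : 0 ≤ F) (hb : 0 < b) (hb1 : b ≤ 1) (hβ : 0 < β) (hβ1 : β ≤ 1)
    (hK : KernelBound c lam₀ C b ρ K) (hf : PoleBound c lam F β ρ ξ τ f) (x : Space n)
    {t : ℝ} (hτ : τ < t) :
    |volterra K τ f x t| ≤ C * F * majorant c lam ρ x t ξ τ
      * ∫ σ in Ioo τ t, timeWeight b β ((lam - lam₀) / 2) τ t σ := by
  rw [volterra_eq x hτ.le, ← integral_const_mul, ← Real.norm_eq_abs]
  refine norm_integral_le_of_norm_le ((integrableOn_timeWeight hb hβ hb1 hβ1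
    (by linarith : 0 ≤ (lam - lam₀) / 2) hτ).const_mul _) ?_
  filter_upwards [ae_restrict_mem measurableSet_Ioo] with σ hσ
  exact (norm_integral_le_integral_norm _).trans (inner_bound hn hc hρ hl hC hF hK hf x hσ).2

end Estimates

/-- The iterated kernels `Φ_{ℓ+1}(·,·;ξ,τ)` of `K`, extended by zero to `t ≤ τ`. -/
def iterated (K : Space n → ℝ → Space n → ℝ → ℝ) (ξ : Space n) (τ : ℝ) : ℕ → Space n → ℝ → ℝ
  | 0 => fun x t => if τ < t then K x t ξ τ else 0
  | l + 1 => volterra K τ (iterated K ξ τ l)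

/-- The resolvent kernel `Φ = ∑ Φ_ℓ`. -/
def resolvent (K : Space n → ℝ → Space n → ℝ → ℝ) (ξ : Space n) (τ : ℝ) (x : Space n) (t : ℝ) :
    ℝ := ∑' l, iterated K ξ τ l x t

/-- Levi's formula `Z + Z * Φ`. -/
def leviSolution (Z K : Space n → ℝ → Space n → ℝ → ℝ) (ξ : Space n) (τ : ℝ) (x : Space n)
    (t : ℝ) : ℝ := Z x t ξ τ + volterra Z τ (resolvent K ξ τ) x t

lemma iterated_of_le (K : Space n → ℝ → Space n → ℝ → ℝ) (ξ : Space n) (τ : ℝ) (l : ℕ)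
    (x : Space n) {t : ℝ} (ht : t ≤ τ) : iterated K ξ τ l x t = 0 := by
  induction l generalizing x t with
  | zero => simp [iterated, not_lt.mpr ht]
  | succ l ih =>
    rw [iterated, volterra, intervalIntegral.integral_symm, intervalIntegral.integral_of_le ht,
      neg_eq_zero]
    refine setIntegral_eq_zero_of_forall_eq_zero fun σ hσ => ?_
    simp [ih _ hσ.2]

section Series

variable {c lam₀ lam C β : ℝ} {ρ : ℝ → ℝ} {K : Space n → ℝ → Space n → ℝ → ℝ}

lemma iterated_bound (hn : 1 ≤ n) (hc : 0 < c) (hρ : IsClock ρ) (hl : lam₀ ≤ lam)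
    (hC : 0 ≤ C) (hβ : 0 < β) (hβ1 : β ≤ 1) (hK : KernelBound c lam₀ C β ρ K)
    (hlam : ∀ τ t : ℝ, τ < t → C * ∫ σ in Ioo τ t, timeWeight β β ((lam - lam₀) / 2) τ t σ
      ≤ 1 / 2 * (t - τ) ^ (β - 1)) (ξ : Space n) (τ : ℝ) (l : ℕ) :
    PoleBound c lam (C * (1 / 2) ^ l) β ρ ξ τ (iterated K ξ τ l) := by
  induction l with
  | zero =>
    refine ⟨?_, fun x t ht => ?_⟩
    · exact Measurable.ite (measurableSet_lt measurable_const measurable_snd)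
        (hK.meas.comp (f := fun p : SpaceTime n => (p, (ξ, τ))) (by fun_prop)) measurable_const
    · have h1 := majorant_mono hc hρ hl x ξ ht.le
      have h2 : 0 < t - τ := sub_pos.mpr ht
      simp only [iterated, if_pos ht, pow_zero, mul_one]
      exact (hK.bound x t ξ τ ht).trans (by gcongr)
  | succ l ih =>
    refine ⟨measurable_volterra hK ih.meas, fun x t ht => ?_⟩
    have h1 := abs_volterra_le hn hc hρ hl hC (by positivity) hβ hβ1 hβ hβ1 hK ih x ht
    have h2 := majorant_nonneg (lam := lam) hc hρ x ξ ht.le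
    calc _ ≤ _ := h1
      _ = C * (1 / 2) ^ l * majorant c lam ρ x t ξ τ
          * (C * ∫ σ in Ioo τ t, timeWeight β β ((lam - lam₀) / 2) τ t σ) := by ring
      _ ≤ C * (1 / 2) ^ l * majorant c lam ρ x t ξ τ * (1 / 2 * (t - τ) ^ (β - 1)) := by
          exact mul_le_mul_of_nonneg_left (hlam τ t ht) (by positivity)
      _ = _ := by ring

lemma summable_iterated (hK : ∀ l, PoleBound c lam (C * (1 / 2) ^ l) β ρ ξ τ (iterated K ξ τ l))
    (x : Space n) (t : ℝ) : Summable fun l => |iterated K ξ τ l x t| := by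
  rcases le_or_gt t τ with h | h
  · simp [iterated_of_le K ξ τ _ x h, summable_zero]
  · refine Summable.of_nonneg_of_le (fun _ => abs_nonneg _) (fun l => (hK l).bound x t h) ?_
    have : Summable fun l : ℕ => (1 / 2 : ℝ) ^ l := summable_geometric_two
    refine (this.mul_left (C * ((t - τ) ^ (β - 1) * majorant c lam ρ x t ξ τ))).congr fun l => ?_
    ring

lemma resolvent_bound (hK : ∀ l, PoleBound c lam (C * (1 / 2) ^ l) β ρ ξ τ (iterated K ξ τ l)) :
    PoleBound c lam (2 * C) β ρ ξ τ (resolvent K ξ τ) := by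
  refine ⟨?_, fun x t ht => ?_⟩
  · refine measurable_of_tendsto_metrizable (f := fun (N : ℕ) (p : SpaceTime n) =>
      ∑ l ∈ Finset.range N, iterated K ξ τ l p.1 p.2)
      (fun N => Finset.measurable_sum _ fun l _ => (hK l).meas) ?_
    exact tendsto_pi_nhds.mpr fun p => (summable_iterated hK p.1 p.2).of_abs.hasSum.tendsto_sum_nat
  · have hs := (hasSum_geometric_two).mul_left (C * ((t - τ) ^ (β - 1) * majorant c lam ρ x t ξ τ))
    have := tsum_of_norm_bounded hs (f := fun l => iterated K ξ τ l x t) fun l => by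
      rw [Real.norm_eq_abs]
      exact ((hK l).bound x t ht).trans (le_of_eq (by ring))
    rw [Real.norm_eq_abs] at this
    exact this.trans (le_of_eq (by ring))

end Series

/-! ### Passage to the limit in Volterra series -/

section Limit

variable {c lam₀ lam C F b β : ℝ} {ρ : ℕ → ℝ → ℝ} {K : ℕ → Space n → ℝ → Space n → ℝ → ℝ}
  {K₀ : Space n → ℝ → Space n → ℝ → ℝ} {ξ : Space n} {τ : ℝ} {f : ℕ → Space n → ℝ → ℝ}
  {f₀ : Space n → ℝ → ℝ}

lemma eventually_clock_near (hlim : ∀ σ, Filter.Tendsto (fun N => ρ N σ) Filter.atTop (nhds σ))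
    {σ t : ℝ} (h : σ < t) : ∀ᶠ N in Filter.atTop,
      (t - σ) / 2 ≤ ρ N t - ρ N σ ∧ ρ N t - ρ N σ ≤ 2 * (t - σ) := by
  have h1 := (hlim t).sub (hlim σ)
  have h2 : 0 < t - σ := sub_pos.mpr h
  exact (h1.eventually_const_le (by linarith)).and (h1.eventually_le_const (by linarith))

lemma exists_majorant_le (hc : 0 < c) (hl : 0 ≤ lam)
    (hlim : ∀ σ, Filter.Tendsto (fun N => ρ N σ) Filter.atTop (nhds σ)) {σ t : ℝ} (h : σ < t) :
    ∃ B a : ℝ, 0 ≤ B ∧ 0 < a ∧ ∀ᶠ N in Filter.atTop, ∀ x ξ : Space n,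
      majorant c lam (ρ N) x t ξ σ ≤ B * Real.exp (-a * ‖x - ξ‖ ^ 2) := by
  have h2 : 0 < t - σ := sub_pos.mpr h
  refine ⟨Real.exp (lam * (2 * (t - σ))) * (Real.pi * ((t - σ) / 2) / c) ^ (-((n : ℝ) / 2)),
    c / (2 * (t - σ)), by positivity, by positivity, ?_⟩
  filter_upwards [eventually_clock_near hlim h] with N hN x ξ
  exact majorant_le_of_near hc hl h2 hN.1 hN.2

lemma tendsto_volterra_inner (hc : 0 < c) (hl₀ : 0 ≤ lam₀) (hl : 0 ≤ lam) (hC : 0 ≤ C) (hF : 0 ≤ F)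
    (hlim : ∀ σ, Filter.Tendsto (fun N => ρ N σ) Filter.atTop (nhds σ))
    (hK : ∀ N, KernelBound c lam₀ C b (ρ N) (K N))
    (hK₀ : ∀ x t η σ, σ < t → Filter.Tendsto (fun N => K N x t η σ) Filter.atTop
      (nhds (K₀ x t η σ)))
    (hf : ∀ N, PoleBound c lam F β (ρ N) ξ τ (f N))
    (hf₀ : ∀ η σ, τ < σ → Filter.Tendsto (fun N => f N η σ) Filter.atTop (nhds (f₀ η σ)))
    (x : Space n) {t σ : ℝ} (hσ : σ ∈ Ioo τ t) :
    Filter.Tendsto (fun N => ∫ η, K N x t η σ * f N η σ) Filter.atTop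
      (nhds (∫ η, K₀ x t η σ * f₀ η σ)) := by
  have h1 : 0 < t - σ := by linarith [hσ.2]
  have h2 : 0 < σ - τ := by linarith [hσ.1]
  obtain ⟨B₁, a₁, hB₁, ha₁, hM₁⟩ := exists_majorant_le (n := n) hc hl₀ hlim hσ.2
  obtain ⟨B₂, a₂, hB₂, ha₂, hM₂⟩ := exists_majorant_le (n := n) hc hl hlim hσ.1
  refine tendsto_integral_filter_of_dominated_convergence
    (fun η => C * (t - σ) ^ (b - 1) * B₁ * (F * (σ - τ) ^ (β - 1) * B₂)
      * Real.exp (-a₂ * ‖η - ξ‖ ^ 2)) ?_ ?_ ?_ ?_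
  · exact Filter.Eventually.of_forall fun N => (((hK N).measurable_mul (hf N).meas).comp
      (f := fun η => (((x, t), σ), η)) (by fun_prop)).aestronglyMeasurable
  · filter_upwards [hM₁, hM₂] with N hN₁ hN₂
    refine Filter.Eventually.of_forall fun η => ?_
    rw [norm_mul, Real.norm_eq_abs, Real.norm_eq_abs]
    have e1 : |K N x t η σ| ≤ C * (t - σ) ^ (b - 1) * B₁ := by
      refine ((hK N).bound x t η σ hσ.2).trans (mul_le_mul_of_nonneg_left ?_ (by positivity))
      refine (hN₁ x η).trans (mul_le_of_le_one_right hB₁ (Real.exp_le_one_iff.mpr ?_))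
      have : 0 ≤ a₁ * ‖x - η‖ ^ 2 := by positivity
      linarith
    have e2 : |f N η σ| ≤ F * (σ - τ) ^ (β - 1) * (B₂ * Real.exp (-a₂ * ‖η - ξ‖ ^ 2)) :=
      ((hf N).bound η σ hσ.1).trans (mul_le_mul_of_nonneg_left (hN₂ η ξ) (by positivity))
    calc _ ≤ C * (t - σ) ^ (b - 1) * B₁ * (F * (σ - τ) ^ (β - 1)
          * (B₂ * Real.exp (-a₂ * ‖η - ξ‖ ^ 2))) :=
          mul_le_mul e1 e2 (abs_nonneg _) (by positivity)
      _ = _ := by ring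
  · exact ((integrable_exp_norm_sq ha₂).comp_sub_right ξ).const_mul _
  · exact Filter.Eventually.of_forall fun η => (hK₀ x t η σ hσ.2).mul (hf₀ η σ hσ.1)

lemma tendsto_volterra (hn : 1 ≤ n) (hc : 0 < c) (hl₀ : 0 ≤ lam₀) (hl : lam₀ ≤ lam) (hC : 0 ≤ C)
    (hF : 0 ≤ F) (hb : 0 < b) (hb1 : b ≤ 1) (hβ : 0 < β) (hβ1 : β ≤ 1)
    (hρ : ∀ N, IsClock (ρ N))
    (hlim : ∀ σ, Filter.Tendsto (fun N => ρ N σ) Filter.atTop (nhds σ))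
    (hK : ∀ N, KernelBound c lam₀ C b (ρ N) (K N))
    (hK₀ : ∀ x t η σ, σ < t → Filter.Tendsto (fun N => K N x t η σ) Filter.atTop
      (nhds (K₀ x t η σ)))
    (hf : ∀ N, PoleBound c lam F β (ρ N) ξ τ (f N))
    (hf₀ : ∀ η σ, τ < σ → Filter.Tendsto (fun N => f N η σ) Filter.atTop (nhds (f₀ η σ)))
    (x : Space n) {t : ℝ} (hτ : τ < t) :
    Filter.Tendsto (fun N => volterra (K N) τ (f N) x t) Filter.atTop
      (nhds (volterra K₀ τ f₀ x t)) := by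
  simp_rw [volterra_eq x hτ.le]
  obtain ⟨B, a, hB, ha, hM⟩ := exists_majorant_le (n := n) hc (hl₀.trans hl) hlim hτ
  refine tendsto_integral_filter_of_dominated_convergence
    (fun σ => C * F * B * timeWeight b β ((lam - lam₀) / 2) τ t σ) ?_ ?_ ?_ ?_
  · refine Filter.Eventually.of_forall fun N => ?_
    have h : Measurable fun p : ℝ × Space n => K N x t p.2 p.1 * f N p.2 p.1 :=
      ((hK N).measurable_mul (hf N).meas).comp (f := fun p : ℝ × Space n => (((x, t), p.1), p.2))
        (by fun_prop)
    exact (h.stronglyMeasurable.integral_prod_right').aestronglyMeasurable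
  · filter_upwards [hM] with N hN
    filter_upwards [ae_restrict_mem measurableSet_Ioo] with σ hσ
    refine (norm_integral_le_integral_norm _).trans
      ((inner_bound hn hc (hρ N) hl hC hF (hK N) (hf N) x hσ).2.trans ?_)
    refine mul_le_mul_of_nonneg_right ?_ (timeWeight_nonneg hσ)
    refine mul_le_mul_of_nonneg_left ((hN x ξ).trans (mul_le_of_le_one_right hB
      (Real.exp_le_one_iff.mpr ?_))) (by positivity)
    have : 0 ≤ a * ‖x - ξ‖ ^ 2 := by positivity
    linarith
  · exact (integrableOn_timeWeight hb hβ hb1 hβ1 (by linarith) hτ).const_mul _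
  · filter_upwards [ae_restrict_mem measurableSet_Ioo] with σ hσ
    exact tendsto_volterra_inner hc hl₀ (hl₀.trans hl) hC hF hlim hK hK₀ hf hf₀ x hσ

lemma tendsto_iterated (hn : 1 ≤ n) (hc : 0 < c) (hl₀ : 0 ≤ lam₀) (hl : lam₀ ≤ lam) (hC : 0 ≤ C)
    (hβ : 0 < β) (hβ1 : β ≤ 1) (hρ : ∀ N, IsClock (ρ N))
    (hlim : ∀ σ, Filter.Tendsto (fun N => ρ N σ) Filter.atTop (nhds σ))
    (hK : ∀ N, KernelBound c lam₀ C β (ρ N) (K N))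
    (hK₀ : ∀ x t η σ, σ < t → Filter.Tendsto (fun N => K N x t η σ) Filter.atTop
      (nhds (K₀ x t η σ)))
    (hf : ∀ N l, PoleBound c lam (C * (1 / 2) ^ l) β (ρ N) ξ τ (iterated (K N) ξ τ l))
    (l : ℕ) (x : Space n) {t : ℝ} (hτ : τ < t) :
    Filter.Tendsto (fun N => iterated (K N) ξ τ l x t) Filter.atTop
      (nhds (iterated K₀ ξ τ l x t)) := by
  induction l generalizing x t with
  | zero => simpa only [iterated, if_pos hτ] using hK₀ x t ξ τ hτ
  | succ l ih =>
    exact tendsto_volterra hn hc hl₀ hl hC (by positivity) hβ hβ1 hβ hβ1 hρ hlim hK hK₀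
      (fun N => hf N l) (fun η σ hσ => ih η hσ) x hτ

lemma tendsto_resolvent (hn : 1 ≤ n) (hc : 0 < c) (hl₀ : 0 ≤ lam₀) (hl : lam₀ ≤ lam) (hC : 0 ≤ C)
    (hβ : 0 < β) (hβ1 : β ≤ 1) (hρ : ∀ N, IsClock (ρ N))
    (hlim : ∀ σ, Filter.Tendsto (fun N => ρ N σ) Filter.atTop (nhds σ))
    (hK : ∀ N, KernelBound c lam₀ C β (ρ N) (K N))
    (hK₀ : ∀ x t η σ, σ < t → Filter.Tendsto (fun N => K N x t η σ) Filter.atTop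
      (nhds (K₀ x t η σ)))
    (hf : ∀ N l, PoleBound c lam (C * (1 / 2) ^ l) β (ρ N) ξ τ (iterated (K N) ξ τ l))
    (x : Space n) {t : ℝ} (hτ : τ < t) :
    Filter.Tendsto (fun N => resolvent (K N) ξ τ x t) Filter.atTop
      (nhds (resolvent K₀ ξ τ x t)) := by
  obtain ⟨B, a, hB, ha, hM⟩ := exists_majorant_le (n := n) hc (hl₀.trans hl) hlim hτ
  have h1 : 0 < t - τ := sub_pos.mpr hτ
  refine tendsto_tsum_of_dominated_convergence
    (bound := fun l : ℕ => C * (t - τ) ^ (β - 1) * B * (1 / 2) ^ l)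
    (summable_geometric_two.mul_left _)
    (fun l => tendsto_iterated hn hc hl₀ hl hC hβ hβ1 hρ hlim hK hK₀ hf l x hτ) ?_
  filter_upwards [hM] with N hN l
  rw [Real.norm_eq_abs]
  have h2 : majorant c lam (ρ N) x t ξ τ ≤ B := (hN x ξ).trans (mul_le_of_le_one_right hB
      (Real.exp_le_one_iff.mpr (by nlinarith [sq_nonneg ‖x - ξ‖])))
  calc _ ≤ C * (1 / 2) ^ l * (t - τ) ^ (β - 1) * majorant c lam (ρ N) x t ξ τ :=
        (hf N l).bound x t hτ
    _ ≤ C * (1 / 2) ^ l * (t - τ) ^ (β - 1) * B := by gcongr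
    _ = _ := by ring

/-- The Levi construction is continuous in its two kernels. -/
lemma tendsto_leviSolution (hn : 1 ≤ n) (hc : 0 < c) (hl₀ : 0 ≤ lam₀) (hl : lam₀ ≤ lam)
    (hC : 0 ≤ C) (hβ : 0 < β) (hβ1 : β ≤ 1) (hρ : ∀ N, IsClock (ρ N))
    (hlim : ∀ σ, Filter.Tendsto (fun N => ρ N σ) Filter.atTop (nhds σ))
    (hK : ∀ N, KernelBound c lam₀ C β (ρ N) (K N))
    (hK₀ : ∀ x t η σ, σ < t → Filter.Tendsto (fun N => K N x t η σ) Filter.atTop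
      (nhds (K₀ x t η σ)))
    (hf : ∀ N l, PoleBound c lam (C * (1 / 2) ^ l) β (ρ N) ξ τ (iterated (K N) ξ τ l))
    {Z : ℕ → Space n → ℝ → Space n → ℝ → ℝ} {Z₀ : Space n → ℝ → Space n → ℝ → ℝ} {D : ℝ}
    (hD : 0 ≤ D) (hZ : ∀ N, KernelBound c lam₀ D 1 (ρ N) (Z N))
    (hZ₀ : ∀ x t η σ, σ < t → Filter.Tendsto (fun N => Z N x t η σ) Filter.atTop
      (nhds (Z₀ x t η σ)))
    (x : Space n) {t : ℝ} (hτ : τ < t) :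
    Filter.Tendsto (fun N => leviSolution (Z N) (K N) ξ τ x t) Filter.atTop
      (nhds (leviSolution Z₀ K₀ ξ τ x t)) :=
  (hZ₀ x t ξ τ hτ).add (tendsto_volterra hn hc hl₀ hl hD (by positivity : 0 ≤ 2 * C) one_pos le_rfl
    hβ hβ1 hρ hlim hZ hZ₀ (fun N => resolvent_bound (hf N))
    (fun η σ hσ => tendsto_resolvent hn hc hl₀ hl hC hβ hβ1 hρ hlim hK hK₀ hf η hσ) x hτ)

end Limit

/-! ### The grid clock -/

/-- Rounding up to the grid `τ₀ + hℤ`. -/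
def gridClock (τ₀ h σ : ℝ) : ℝ := τ₀ + h * ⌈(σ - τ₀) / h⌉

lemma le_gridClock {h : ℝ} (hh : 0 < h) (τ₀ σ : ℝ) : σ ≤ gridClock τ₀ h σ := by
  have := mul_le_mul_of_nonneg_left (Int.le_ceil ((σ - τ₀) / h)) hh.le
  rw [mul_div_cancel₀ _ hh.ne'] at this
  unfold gridClock; linarith

lemma gridClock_lt {h : ℝ} (hh : 0 < h) (τ₀ σ : ℝ) : gridClock τ₀ h σ < σ + h := by
  have := mul_lt_mul_of_pos_left (Int.ceil_lt_add_one ((σ - τ₀) / h)) hh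
  rw [mul_add, mul_div_cancel₀ _ hh.ne'] at this
  unfold gridClock; linarith

lemma gridClock_gap {h : ℝ} (hh : 0 < h) {τ₀ σ t : ℝ} (hlt : gridClock τ₀ h σ < gridClock τ₀ h t) :
    h ≤ gridClock τ₀ h t - gridClock τ₀ h σ := by
  unfold gridClock at *
  have h1 : (⌈(σ - τ₀) / h⌉ : ℝ) < ⌈(t - τ₀) / h⌉ := by
    have : h * (⌈(σ - τ₀) / h⌉ : ℝ) < h * ⌈(t - τ₀) / h⌉ := by linarith
    exact lt_of_mul_lt_mul_left this hh.le
  have h2 : (⌈(σ - τ₀) / h⌉ : ℝ) + 1 ≤ ⌈(t - τ₀) / h⌉ := by exact_mod_cast h1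
  nlinarith

lemma isClock_gridClock {h : ℝ} (hh : 0 < h) (τ₀ : ℝ) : IsClock (gridClock τ₀ h) where
  mono σ t hst := by
    unfold gridClock
    gcongr
  gap σ t hlt := by
    have h1 := gridClock_gap hh hlt
    have h2 := le_gridClock hh τ₀ t
    have h3 := gridClock_lt hh τ₀ σ
    linarith

lemma tendsto_gridClock {h : ℕ → ℝ} (hh : ∀ N, 0 < h N)
    (hlim : Filter.Tendsto h Filter.atTop (nhds 0)) (τ₀ σ : ℝ) :
    Filter.Tendsto (fun N => gridClock τ₀ (h N) σ) Filter.atTop (nhds σ) := by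
  refine tendsto_of_tendsto_of_tendsto_of_le_of_le tendsto_const_nhds
    (by simpa using hlim.const_add σ) (fun N => le_gridClock (hh N) τ₀ σ)
    (fun N => (gridClock_lt (hh N) τ₀ σ).le)

lemma gridClock_natCast {h : ℝ} (hh : 0 < h) (τ₀ : ℝ) (k : ℕ) :
    gridClock τ₀ h (τ₀ + k * h) = τ₀ + k * h := by
  have : (τ₀ + k * h - τ₀) / h = k := by field_simp; ring
  rw [gridClock, this, Int.ceil_natCast]
  push_cast; ring

/-! ### The segment joining the frozen Gaussian to the Euler step -/

/-- `θ ↦ e^{θ q} gauss (T A' + θ (A - A')) (y + θ b)`. At `θ = 0` this is the parametrix after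
time `T`; at `θ = h` its last time step of length `h` is replaced by an Euler step. -/
def segment (q T : ℝ) (A A' : Matrix (Fin n) (Fin n) ℝ) (b y : Space n) (θ : ℝ) : ℝ :=
  Real.exp (θ * q) * gauss (T • A' + θ • (A - A')) (y + θ • b)

lemma Elliptic.segment {k m T θ : ℝ} {A A' : Matrix (Fin n) (Fin n) ℝ} (hA : Elliptic k m A)
    (hA' : Elliptic k m A') (hθ0 : 0 ≤ θ) (hθ : θ ≤ T) :
    Elliptic (T * k) (T * m) (T • A' + θ • (A - A')) := by
  have h := hA.mix hA' hθ0 (sub_nonneg.mpr hθ)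
  rw [add_sub_cancel] at h
  convert h using 1
  rw [smul_sub, sub_smul]; abel

/-- By the mean value theorem the one step error is a derivative along the segment, at a parameter
`θ` at most the step `h`. -/
lemma exists_segment_slope {k m T h : ℝ} {A A' : Matrix (Fin n) (Fin n) ℝ} (hk : 0 < k)
    (hA : Elliptic k m A) (hA' : Elliptic k m A') (hh : 0 < h) (hT : h ≤ T) (q : ℝ)
    (b y : Space n) : ∃ θ, 0 ≤ θ ∧ θ ≤ h ∧
      h⁻¹ * (segment q T A A' b y h - segment q T A A' b y 0)
        = segmentDeriv q θ (T • A' + θ • (A - A')) (A - A') b y := by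
  have hd : ∀ θ ∈ Icc 0 h, HasDerivAt (segment q T A A' b y)
      (segmentDeriv q θ (T • A' + θ • (A - A')) (A - A') b y) θ := by
    intro θ hθ
    have h1 := hasDerivAt_gauss (y := y) (b := b)
      (mul_pos (hh.trans_le hT) hk) (hA.segment hA' hθ.1 (hθ.2.trans hT))
    have h2 : HasDerivAt (fun r : ℝ => Real.exp (r * q)) (Real.exp (θ * q) * (1 * q)) θ :=
      ((hasDerivAt_id θ).mul_const q).exp
    refine (h2.mul h1).congr_deriv ?_
    unfold segmentDeriv; ring
  obtain ⟨θ, hθ, e⟩ := exists_hasDerivAt_eq_slope _ _ hh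
    (fun θ hθ => (hd θ hθ).continuousAt.continuousWithinAt) fun θ hθ => hd θ (Ioo_subset_Icc_self hθ)
  refine ⟨θ, hθ.1.le, hθ.2.le, ?_⟩
  rw [e, sub_zero, div_eq_inv_mul]

/-! ### The kernels of the parametrix method and of its time discretization -/

namespace Operator

/-- The frozen Gaussian (the parametrix) read on the clock `ρ`. -/
def frozenKernel (L : Operator n) (ρ : ℝ → ℝ) (x : Space n) (t : ℝ) (ξ : Space n) (τ : ℝ) : ℝ :=
  if ρ τ < ρ t then gauss ((ρ t - ρ τ) • L.a (ξ, ρ τ)) (x - ξ) else 0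

/-- Levi's kernel `L Z` in closed form, extended by zero to `t ≤ τ`. -/
def leviKernel (L : Operator n) (x : Space n) (t : ℝ) (ξ : Space n) (τ : ℝ) : ℝ :=
  if τ < t then segmentDeriv (L.q (x, t)) 0 ((t - τ) • L.a (ξ, τ)) (L.a (x, t) - L.a (ξ, τ))
    (L.drift (x, t)) (x - ξ) else 0

/-- The one step error of the Euler scheme, divided by the step `h`: the discrete analogue of
`L Z`. -/
def defectKernel (L : Operator n) (h : ℝ) (ρ : ℝ → ℝ) (x : Space n) (t : ℝ) (ξ : Space n)
    (τ : ℝ) : ℝ :=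
  if ρ τ < ρ t then h⁻¹ *
    (segment (L.q (x, ρ t)) (ρ t - ρ τ) (L.a (x, ρ t)) (L.a (ξ, ρ τ)) (L.drift (x, ρ t)) (x - ξ) h
    - segment (L.q (x, ρ t)) (ρ t - ρ τ) (L.a (x, ρ t)) (L.a (ξ, ρ τ)) (L.drift (x, ρ t)) (x - ξ) 0)
  else 0

namespace Admissible

variable {L : Operator n} {α N₁ N₂ M κ : ℝ}

lemma continuous_a (h : L.Admissible α N₁ N₂ M κ) : Continuous L.a :=
  continuous_matrix fun i j => (h.holder_a i j).1.1

lemma continuous_drift (h : L.Admissible α N₁ N₂ M κ) : Continuous L.drift :=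
  (PiLp.continuous_toLp 2 _).comp (continuous_pi fun i => (h.bounded_b i).1)

lemma continuous_q (h : L.Admissible α N₁ N₂ M κ) : Continuous L.q := h.bounded_q.1

lemma kernelBound_frozenKernel (h : L.Admissible α N₁ N₂ M κ) (hM : 0 < M) (hκ : 0 < κ)
    {ρ : ℝ → ℝ} (hρ : IsClock ρ) {lam : ℝ} (hl : 0 ≤ lam) :
    KernelBound (1 / (8 * M)) lam ((2 * M / κ) ^ ((n : ℝ) / 2)) 1 ρ (L.frozenKernel ρ) := by
  have hρm := hρ.mono.measurable
  refine ⟨?_, fun x t η σ hσ => ?_⟩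
  · refine Measurable.ite (measurableSet_lt (by fun_prop) (by fun_prop)) ?_ measurable_const
    refine measurable_gauss (fun i j => ?_) (by fun_prop)
    simp only [Matrix.smul_apply, smul_eq_mul]
    exact (by fun_prop : Measurable fun p : SpaceTime n × SpaceTime n => ρ p.1.2 - ρ p.2.2).mul
      ((h.holder_a i j).1.1.measurable.comp (f := fun p : SpaceTime n × SpaceTime n =>
        ((p.2.1, ρ p.2.2) : SpaceTime n)) (by fun_prop))
  · have hm := majorant_nonneg (c := 1 / (8 * M)) (lam := lam) (by positivity) hρ x η hσ.le
    simp only [frozenKernel, sub_self, Real.rpow_zero, mul_one]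
    split_ifs with hlt
    · set T := ρ t - ρ σ with hT
      have hT0 : 0 < T := sub_pos.mpr hlt
      rw [abs_of_nonneg (gauss_nonneg _ _)]
      refine (gauss_le (by positivity) (by positivity)
        ((h.elliptic_a (η, ρ σ)).smul hT0.le) (x - η)).trans ?_
      rw [majorant, heat, ← hT]
      have e1 : (4 * Real.pi * (T * κ)) ^ (-((n : ℝ) / 2)) = (2 * M / κ) ^ ((n : ℝ) / 2)
          * (Real.pi * T / (1 / (8 * M))) ^ (-((n : ℝ) / 2)) := by
        rw [show 2 * M / κ = (κ / (2 * M))⁻¹ by rw [inv_div], Real.inv_rpow (by positivity),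
          ← Real.rpow_neg (by positivity), ← Real.mul_rpow (by positivity) (by positivity)]
        congr 1; field_simp; ring
      rw [e1, mul_assoc]
      have e2 : Real.exp (-(‖x - η‖ ^ 2 / (T * M) / 4))
          ≤ Real.exp (-(1 / (8 * M)) * (‖x - η‖ ^ 2 / T)) := by
        refine Real.exp_le_exp.mpr ?_
        have : ‖x - η‖ ^ 2 / (T * M) / 4 = 2 * (1 / (8 * M) * (‖x - η‖ ^ 2 / T)) := by
          field_simp; ring
        have h0 : 0 ≤ 1 / (8 * M) * (‖x - η‖ ^ 2 / T) := by positivity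
        linarith
      have e3 : 1 ≤ Real.exp (lam * T) := Real.one_le_exp (by positivity)
      refine mul_le_mul_of_nonneg_left ?_ (by positivity)
      calc _ ≤ (Real.pi * T / (1 / (8 * M))) ^ (-((n : ℝ) / 2))
            * Real.exp (-(1 / (8 * M)) * (‖x - η‖ ^ 2 / T)) := by gcongr
        _ ≤ _ := le_mul_of_one_le_left (by positivity) e3
    · rw [abs_zero]; positivity

lemma sum_abs_sub_le (h : L.Admissible α N₁ N₂ M κ) (hα : 0 < α) (hN₁ : 0 < N₁) (x ξ : Space n)
    {t τ : ℝ} (hτ : τ < t) : ∑ i, ∑ j, |(L.a (x, t) - L.a (ξ, τ)) i j|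
      ≤ N₁ * (‖x - ξ‖ ^ 2 + (t - τ)) ^ (α / 2) := by
  have := h.abs_sub_le hN₁ hα (x, t) (ξ, τ)
  simpa [abs_of_pos (sub_pos.mpr hτ)] using this

lemma kernelBound_defectKernel (h : L.Admissible α N₁ N₂ M κ) (hα : 0 < α) (hα1 : α ≤ 1)
    (hN₁ : 0 < N₁) (hN₂ : 0 < N₂) (hM : 0 < M) (hκ : 0 < κ) {s : ℝ} (hs : 0 < s) (τ₀ : ℝ) :
    KernelBound (1 / (8 * M)) (segmentRate N₂ M) (2 * segmentConst n N₁ N₂ M κ) (α / 2)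
      (gridClock τ₀ s) (L.defectKernel s (gridClock τ₀ s)) := by
  have hρ := isClock_gridClock hs τ₀
  have hρm := hρ.mono.measurable
  set ρ := gridClock τ₀ s with hρdef
  have hsc := segmentConst_nonneg (n := n) hN₁ hN₂ hM hκ
  refine ⟨?_, fun x t η σ hσ => ?_⟩
  · have hx : Measurable fun p : SpaceTime n × SpaceTime n =>
        ((p.1.1, ρ p.1.2) : SpaceTime n) := by fun_prop
    have hξ : Measurable fun p : SpaceTime n × SpaceTime n =>
        ((p.2.1, ρ p.2.2) : SpaceTime n) := by fun_prop
    have hseg : ∀ θ : ℝ, Measurable fun p : SpaceTime n × SpaceTime n =>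
        segment (L.q (p.1.1, ρ p.1.2)) (ρ p.1.2 - ρ p.2.2) (L.a (p.1.1, ρ p.1.2))
          (L.a (p.2.1, ρ p.2.2)) (L.drift (p.1.1, ρ p.1.2)) (p.1.1 - p.2.1) θ := by
      intro θ
      have hq := h.continuous_q.measurable.comp hx
      have hb := h.continuous_drift.measurable.comp hx
      unfold segment
      refine ((hq.const_mul θ).exp).mul (measurable_gauss (fun i j => ?_) ?_)
      · have h1 := (h.holder_a i j).1.1.measurable.comp hx
        have h2 := (h.holder_a i j).1.1.measurable.comp hξ
        exact ((by fun_prop : Measurable fun p : SpaceTime n × SpaceTime n =>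
          ρ p.1.2 - ρ p.2.2).mul h2).add ((h1.sub h2).const_mul θ)
      · exact (by fun_prop : Measurable fun p : SpaceTime n × SpaceTime n => p.1.1 - p.2.1).add
          (hb.const_smul θ)
    exact Measurable.ite (measurableSet_lt (by fun_prop) (by fun_prop))
      (((hseg s).sub (hseg 0)).const_mul _) measurable_const
  · have hm := majorant_nonneg (c := 1 / (8 * M)) (lam := segmentRate N₂ M) (by positivity)
      hρ x η hσ.le
    have hσ' : 0 < t - σ := sub_pos.mpr hσ
    unfold defectKernel
    split_ifs with hlt
    · have hT0 : 0 < ρ t - ρ σ := sub_pos.mpr hlt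
      have hsT : s ≤ ρ t - ρ σ := gridClock_gap hs hlt
      have hgap := hρ.gap σ t hlt
      obtain ⟨θ, hθ0, hθ, e⟩ := exists_segment_slope hκ (h.elliptic_a (x, ρ t))
        (h.elliptic_a (η, ρ σ)) hs hsT (L.q (x, ρ t)) (L.drift (x, ρ t)) (x - η)
      rw [e]
      have hb := h.lower_order_le hN₂ (x, ρ t)
      refine (abs_segmentDeriv_le hα hα1 hN₁ hN₂ hM hκ hT0 hθ0 (hθ.trans hsT)
        ((h.elliptic_a _).segment (h.elliptic_a _) hθ0 (hθ.trans hsT)) hb.2 hb.1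
        (h.sum_abs_sub_le hα hN₁ x η hlt)).trans ?_
      have h2 : (ρ t - ρ σ) ^ (α / 2 - 1) ≤ 2 * (t - σ) ^ (α / 2 - 1) := by
        calc (ρ t - ρ σ) ^ (α / 2 - 1) ≤ ((t - σ) / 2) ^ (α / 2 - 1) :=
              Real.rpow_le_rpow_of_nonpos (by positivity) (by linarith) (by linarith)
          _ ≤ 2 * (t - σ) ^ (α / 2 - 1) := by
              rw [Real.div_rpow hσ'.le (by norm_num), div_eq_mul_inv,
                ← Real.rpow_neg (by norm_num), mul_comm]
              gcongr
              calc (2 : ℝ) ^ (-(α / 2 - 1)) ≤ 2 ^ (1 : ℝ) :=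
                    Real.rpow_le_rpow_of_exponent_le (by norm_num) (by linarith)
                _ = 2 := Real.rpow_one 2
      rw [mul_assoc, mul_assoc]
      calc _ ≤ segmentConst n N₁ N₂ M κ * (2 * (t - σ) ^ (α / 2 - 1)
            * majorant (1 / (8 * M)) (segmentRate N₂ M) ρ x t η σ) := by
            refine mul_le_mul_of_nonneg_left ?_ hsc
            exact mul_le_mul_of_nonneg_right h2 hm
        _ = _ := by ring
    · rw [abs_zero]; positivity

lemma tendsto_segmentDeriv (h : L.Admissible α N₁ N₂ M κ) (hκ : 0 < κ) {ρ : ℕ → ℝ → ℝ}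
    (hlim : ∀ σ, Filter.Tendsto (fun N => ρ N σ) Filter.atTop (nhds σ)) {θ : ℕ → ℝ}
    (hθ : Filter.Tendsto θ Filter.atTop (nhds 0)) (x η : Space n) {t σ : ℝ} (hσ : σ < t) :
    Filter.Tendsto (fun N => segmentDeriv (L.q (x, ρ N t)) (θ N)
      ((ρ N t - ρ N σ) • L.a (η, ρ N σ) + θ N • (L.a (x, ρ N t) - L.a (η, ρ N σ)))
      (L.a (x, ρ N t) - L.a (η, ρ N σ)) (L.drift (x, ρ N t)) (x - η)) Filter.atTop
      (nhds (L.leviKernel x t η σ)) := by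
  have hx : Filter.Tendsto (fun N => ((x, ρ N t) : SpaceTime n)) Filter.atTop (nhds (x, t)) :=
    tendsto_const_nhds.prodMk_nhds (hlim t)
  have hη : Filter.Tendsto (fun N => ((η, ρ N σ) : SpaceTime n)) Filter.atTop (nhds (η, σ)) :=
    tendsto_const_nhds.prodMk_nhds (hlim σ)
  have hA := (h.continuous_a.tendsto (x, t)).comp hx
  have hA' := (h.continuous_a.tendsto (η, σ)).comp hη
  have hq := (h.continuous_q.tendsto (x, t)).comp hx
  have hb := (h.continuous_drift.tendsto (x, t)).comp hx
  have hC := (((hlim t).sub (hlim σ)).smul hA').add (hθ.smul (hA.sub hA'))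
  rw [zero_smul, add_zero] at hC
  have hy := (tendsto_const_nhds (x := x - η)).add (hθ.smul hb)
  have hdet : 0 < ((t - σ) • L.a (η, σ)).det :=
    ((h.elliptic_a (η, σ)).smul (sub_pos.mpr hσ).le).det_pos (mul_pos (sub_pos.mpr hσ) hκ)
  have := ((hθ.mul hq).rexp).mul ((tendsto_gauss hC hdet hy).mul
    (hq.add (tendsto_gaussRate hC hdet.ne' (hA.sub hA') hb hy)))
  rw [leviKernel, if_pos hσ]
  exact this

lemma tendsto_defectKernel (h : L.Admissible α N₁ N₂ M κ) (hκ : 0 < κ) {s : ℕ → ℝ}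
    (hs : ∀ N, 0 < s N) (hs0 : Filter.Tendsto s Filter.atTop (nhds 0)) (τ₀ : ℝ) (x η : Space n)
    {t σ : ℝ} (hσ : σ < t) :
    Filter.Tendsto (fun N => L.defectKernel (s N) (gridClock τ₀ (s N)) x t η σ) Filter.atTop
      (nhds (L.leviKernel x t η σ)) := by
  set ρ : ℕ → ℝ → ℝ := fun N => gridClock τ₀ (s N) with hρ
  have hlim : ∀ σ, Filter.Tendsto (fun N => ρ N σ) Filter.atTop (nhds σ) :=
    tendsto_gridClock hs hs0 τ₀
  have hex : ∀ N, ∃ θ, 0 ≤ θ ∧ θ ≤ s N ∧ (ρ N σ < ρ N t → L.defectKernel (s N) (ρ N) x t η σ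
      = segmentDeriv (L.q (x, ρ N t)) θ
      ((ρ N t - ρ N σ) • L.a (η, ρ N σ) + θ • (L.a (x, ρ N t) - L.a (η, ρ N σ)))
      (L.a (x, ρ N t) - L.a (η, ρ N σ)) (L.drift (x, ρ N t)) (x - η)) := by
    intro N
    by_cases hlt : ρ N σ < ρ N t
    · obtain ⟨θ, h0, h1, e⟩ := exists_segment_slope hκ (h.elliptic_a (x, ρ N t))
        (h.elliptic_a (η, ρ N σ)) (hs N) (gridClock_gap (hs N) hlt) (L.q (x, ρ N t))
        (L.drift (x, ρ N t)) (x - η)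
      exact ⟨θ, h0, h1, fun _ => by rw [defectKernel, if_pos hlt, e]⟩
    · exact ⟨0, le_rfl, (hs N).le, fun hc => absurd hc hlt⟩
  choose θ hθ0 hθ1 hθ using hex
  have hθlim : Filter.Tendsto θ Filter.atTop (nhds 0) :=
    tendsto_of_tendsto_of_tendsto_of_le_of_le tendsto_const_nhds hs0 hθ0 hθ1
  refine (h.tendsto_segmentDeriv hκ hlim hθlim x η hσ).congr' ?_
  filter_upwards [(hlim σ).eventually_lt (hlim t) hσ] with N hN
  exact (hθ N hN).symm

lemma tendsto_frozenKernel (h : L.Admissible α N₁ N₂ M κ) (hκ : 0 < κ) {ρ : ℕ → ℝ → ℝ}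
    (hlim : ∀ σ, Filter.Tendsto (fun N => ρ N σ) Filter.atTop (nhds σ)) (x η : Space n) {t σ : ℝ}
    (hσ : σ < t) : Filter.Tendsto (fun N => L.frozenKernel (ρ N) x t η σ) Filter.atTop
      (nhds (L.frozenKernel (fun r => r) x t η σ)) := by
  have hη : Filter.Tendsto (fun N => ((η, ρ N σ) : SpaceTime n)) Filter.atTop (nhds (η, σ)) :=
    tendsto_const_nhds.prodMk_nhds (hlim σ)
  have hC := ((hlim t).sub (hlim σ)).smul ((h.continuous_a.tendsto (η, σ)).comp hη)
  have hdet : 0 < ((t - σ) • L.a (η, σ)).det :=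
    ((h.elliptic_a (η, σ)).smul (sub_pos.mpr hσ).le).det_pos (mul_pos (sub_pos.mpr hσ) hκ)
  rw [frozenKernel, if_pos hσ]
  refine (tendsto_gauss hC hdet tendsto_const_nhds).congr' ?_
  filter_upwards [(hlim σ).eventually_lt (hlim t) hσ] with N hN
  rw [frozenKernel, if_pos hN]
  rfl

lemma kernelBound_leviKernel (h : L.Admissible α N₁ N₂ M κ) (hα : 0 < α) (hα1 : α ≤ 1)
    (hN₁ : 0 < N₁) (hN₂ : 0 < N₂) (hM : 0 < M) (hκ : 0 < κ) :
    KernelBound (1 / (8 * M)) (segmentRate N₂ M) (2 * segmentConst n N₁ N₂ M κ) (α / 2)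
      (fun t => t) L.leviKernel := by
  have hsc := segmentConst_nonneg (n := n) hN₁ hN₂ hM hκ
  refine ⟨?_, fun x t η σ hσ => ?_⟩
  · -- a pointwise limit of the discrete kernels
    have hs : ∀ N : ℕ, (0 : ℝ) < 1 / ((N : ℝ) + 1) := fun N => by positivity
    refine measurable_of_tendsto_metrizable (fun N : ℕ =>
      (h.kernelBound_defectKernel hα hα1 hN₁ hN₂ hM hκ (hs N) 0).meas) (tendsto_pi_nhds.mpr fun p => ?_)
    rcases lt_or_ge p.2.2 p.1.2 with hp | hp
    · exact h.tendsto_defectKernel hκ hs tendsto_one_div_add_atTop_nhds_zero_nat 0 _ _ hp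
    · rw [leviKernel, if_neg (not_lt.mpr hp)]
      refine tendsto_const_nhds.congr fun N => ?_
      rw [defectKernel, if_neg (not_lt.mpr ((isClock_gridClock (hs N) 0).mono hp))]
  · have hm := majorant_nonneg (c := 1 / (8 * M)) (lam := segmentRate N₂ M) (by positivity)
      isClock_id x η hσ.le
    have hσ' : 0 < t - σ := sub_pos.mpr hσ
    have hb := h.lower_order_le hN₂ (x, t)
    rw [leviKernel, if_pos hσ]
    refine (abs_segmentDeriv_le hα hα1 hN₁ hN₂ hM hκ hσ' le_rfl hσ'.le
      ((h.elliptic_a _).smul hσ'.le) hb.2 hb.1 (h.sum_abs_sub_le hα hN₁ x η hσ)).trans ?_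
    rw [mul_assoc]
    change segmentConst n N₁ N₂ M κ * (t - σ) ^ (α / 2 - 1)
      * majorant (1 / (8 * M)) (segmentRate N₂ M) (fun t => t) x t η σ ≤ _
    have : 0 ≤ (t - σ) ^ (α / 2 - 1) := by positivity
    gcongr
    linarith

/-! ### Identification with the given construction -/

lemma parametrix_eq_frozenKernel (h : L.Admissible α N₁ N₂ M κ) (hκ : 0 < κ) {t τ : ℝ}
    (hτ : τ < t) (x ξ : Space n) :
    L.parametrix x t ξ τ = L.frozenKernel (fun r => r) x t ξ τ := by
  rw [h.parametrix_eq hκ hτ, frozenKernel, if_pos hτ]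

lemma apply_parametrix_eq_leviKernel (h : L.Admissible α N₁ N₂ M κ) (hκ : 0 < κ) {t τ : ℝ}
    (hτ : τ < t) (x ξ : Space n) :
    L.apply (fun y s => L.parametrix y s ξ τ) x t = L.leviKernel x t ξ τ := by
  rw [h.apply_parametrix hκ hτ, leviKernel, if_pos hτ, segmentDeriv]
  simp

lemma iter_eq_iterated (h : L.Admissible α N₁ N₂ M κ) (hκ : 0 < κ) (l : ℕ) {t τ : ℝ}
    (hτ : τ < t) (x ξ : Space n) : L.iter l x t ξ τ = iterated L.leviKernel ξ τ l x t := by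
  induction l generalizing x t with
  | zero =>
    simp only [Operator.iter, iterated, if_pos hτ]
    rw [h.apply_parametrix_eq_leviKernel hκ hτ]
  | succ l ih =>
    simp only [iterated, Operator.iter]
    rw [volterra_eq x hτ.le, intervalIntegral.integral_of_le hτ.le,
      integral_Ioc_eq_integral_Ioo]
    refine setIntegral_congr_fun measurableSet_Ioo fun σ hσ => ?_
    refine integral_congr_ae (Filter.Eventually.of_forall fun η => ?_)
    simp only
    rw [h.apply_parametrix_eq_leviKernel hκ hσ.2, ih hσ.1]

lemma levi_eq_resolvent (h : L.Admissible α N₁ N₂ M κ) (hκ : 0 < κ) {t τ : ℝ}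
    (hτ : τ < t) (x ξ : Space n) : L.levi x t ξ τ = resolvent L.leviKernel ξ τ x t :=
  tsum_congr fun l => h.iter_eq_iterated hκ l hτ x ξ

lemma fundSol_eq_leviSolution (h : L.Admissible α N₁ N₂ M κ) (hκ : 0 < κ) {t τ : ℝ}
    (hτ : τ < t) (x ξ : Space n) : L.fundSol x t ξ τ
      = leviSolution (L.frozenKernel fun r => r) L.leviKernel ξ τ x t := by
  rw [Operator.fundSol, leviSolution, volterra_eq x hτ.le, h.parametrix_eq_frozenKernel hκ hτ,
    intervalIntegral.integral_of_le hτ.le, integral_Ioc_eq_integral_Ioo]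
  congr 1
  refine setIntegral_congr_fun measurableSet_Ioo fun σ hσ => ?_
  refine integral_congr_ae (Filter.Eventually.of_forall fun η => ?_)
  simp only
  rw [h.parametrix_eq_frozenKernel hκ hσ.2, h.levi_eq_resolvent hκ hσ.1]

end Admissible

end Operator

/-! ### The resolvent equation -/

section Resolvent

variable {c lam₀ lam C D F b β : ℝ} {ρ : ℝ → ℝ} {K Z : Space n → ℝ → Space n → ℝ → ℝ}
  {ξ : Space n} {τ : ℝ} {f : Space n → ℝ → ℝ}

lemma volterra_eq_setIntegral_prod (hn : 1 ≤ n) (hc : 0 < c) (hρ : IsClock ρ) (hl : lam₀ ≤ lam)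
    (hC : 0 ≤ C) (hF : 0 ≤ F) (hb : 0 < b) (hb1 : b ≤ 1) (hβ : 0 < β) (hβ1 : β ≤ 1)
    (hK : KernelBound c lam₀ C b ρ K) (hf : PoleBound c lam F β ρ ξ τ f) (x : Space n)
    {t : ℝ} (hτ : τ < t) :
    volterra K τ f x t = ∫ p in Ioo τ t ×ˢ univ, K x t p.2 p.1 * f p.2 p.1
      ∂(volume : Measure (ℝ × Space n)) := by
  have h := integrableOn_product hn hc hρ hl hC hF hb hb1 hβ hβ1 hK hf x hτ
  rw [Measure.volume_eq_prod] at h ⊢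
  rw [setIntegral_prod _ h, volterra_eq x hτ.le]
  simp

lemma integral_norm_product_le (hn : 1 ≤ n) (hc : 0 < c) (hρ : IsClock ρ) (hl : lam₀ ≤ lam)
    (hC : 0 ≤ C) (hF : 0 ≤ F) (hb : 0 < b) (hb1 : b ≤ 1) (hβ : 0 < β) (hβ1 : β ≤ 1)
    (hK : KernelBound c lam₀ C b ρ K) (hf : PoleBound c lam F β ρ ξ τ f) (x : Space n)
    {t : ℝ} (hτ : τ < t) :
    ∫ p in Ioo τ t ×ˢ univ, ‖K x t p.2 p.1 * f p.2 p.1‖ ∂(volume : Measure (ℝ × Space n))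
      ≤ F * (C * majorant c lam ρ x t ξ τ
        * ∫ σ in Ioo τ t, timeWeight b β ((lam - lam₀) / 2) τ t σ) := by
  have h := (integrableOn_product hn hc hρ hl hC hF hb hb1 hβ hβ1 hK hf x hτ).norm
  rw [Measure.volume_eq_prod, ← IntegrableOn] at *
  rw [setIntegral_prod _ h, ← integral_const_mul, ← integral_const_mul]
  simp only [Measure.restrict_univ]
  refine setIntegral_mono_on ?_ ?_ measurableSet_Ioo fun σ hσ => ?_
  · have h' := h
    rw [IntegrableOn, ← Measure.prod_restrict, Measure.restrict_univ] at h'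
    exact h'.integral_prod_left
  · exact ((integrableOn_timeWeight hb hβ hb1 hβ1 (by linarith) hτ).const_mul _).const_mul _
  · refine (inner_bound hn hc hρ hl hC hF hK hf x hσ).2.trans (le_of_eq (by ring))

lemma resolvent_eq (hn : 1 ≤ n) (hc : 0 < c) (hρ : IsClock ρ) (hl : lam₀ ≤ lam) (hC : 0 ≤ C)
    (hβ : 0 < β) (hβ1 : β ≤ 1) (hK : KernelBound c lam₀ C β ρ K)
    (hf : ∀ l, PoleBound c lam (C * (1 / 2) ^ l) β ρ ξ τ (iterated K ξ τ l)) (x : Space n) {t : ℝ}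
    (hτ : τ < t) :
    resolvent K ξ τ x t = K x t ξ τ + volterra K τ (resolvent K ξ τ) x t := by
  have hs := (summable_iterated hf x t).of_abs
  have h0 : iterated K ξ τ 0 x t = K x t ξ τ := by simp [iterated, hτ]
  rw [resolvent, hs.tsum_eq_zero_add, h0, volterra_eq_setIntegral_prod hn hc hρ hl hC
    (by positivity) hβ hβ1 hβ hβ1 hK (resolvent_bound hf) x hτ]
  congr 1
  have h := hasSum_integral_of_summable_integral_norm
    (μ := (volume : Measure (ℝ × Space n)).restrict (Ioo τ t ×ˢ univ))
    (F := fun l p => K x t p.2 p.1 * iterated K ξ τ l p.2 p.1)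
    (fun l => integrableOn_product hn hc hρ hl hC (by positivity) hβ hβ1 hβ hβ1 hK (hf l) x hτ)
    (by
      refine Summable.of_nonneg_of_le (fun l => integral_nonneg fun _ => norm_nonneg _)
        (fun l => integral_norm_product_le hn hc hρ hl hC (by positivity) hβ hβ1 hβ hβ1 hK (hf l)
          x hτ) ?_
      exact (summable_geometric_two.mul_left C).mul_right _)
  rw [← integral_congr_ae (Filter.Eventually.of_forall fun p => ?_), ← h.tsum_eq]
  · refine tsum_congr fun l => ?_
    exact volterra_eq_setIntegral_prod hn hc hρ hl hC (by positivity) hβ hβ1 hβ hβ1 hK (hf l) x hτ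
  · exact tsum_mul_left

/-- The correction term of Levi's formula is of lower order for short times. -/
lemma abs_volterra_resolvent_le (hn : 1 ≤ n) (hc : 0 < c) (hρ : IsClock ρ) (hl : lam₀ ≤ lam)
    (hC : 0 ≤ C) (hD : 0 ≤ D) (hβ : 0 < β) (hβ1 : β ≤ 1)
    (hf : ∀ l, PoleBound c lam (C * (1 / 2) ^ l) β ρ ξ τ (iterated K ξ τ l))
    (hZ : KernelBound c lam₀ D 1 ρ Z) (x : Space n) {t : ℝ} (hτ : τ < t) :
    |volterra Z τ (resolvent K ξ τ) x t|
      ≤ 2 * C * D / β * (t - τ) ^ β * majorant c lam ρ x t ξ τ := by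
  have h := abs_volterra_le hn hc hρ hl hD (by positivity) one_pos le_rfl hβ hβ1 hZ
    (resolvent_bound hf) x hτ
  have hm := majorant_nonneg (lam := lam) hc hρ x ξ hτ.le
  calc _ ≤ _ := h
    _ ≤ D * (2 * C) * majorant c lam ρ x t ξ τ * ((t - τ) ^ β / β) :=
        mul_le_mul_of_nonneg_left
          (integral_timeWeight_one_le hβ hβ1 (by linarith) hτ) (by positivity)
    _ = _ := by ring

lemma majorant_le_const {c lam : ℝ} (hc : 0 < c) {t τ : ℝ} (h : ρ τ < ρ t) (x ξ : Space n) :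
    majorant c lam ρ x t ξ τ
      ≤ Real.exp (lam * (ρ t - ρ τ)) * (Real.pi * (ρ t - ρ τ) / c) ^ (-((n : ℝ) / 2)) := by
  have hT : 0 < ρ t - ρ τ := sub_pos.mpr h
  refine mul_le_mul_of_nonneg_left (mul_le_of_le_one_right (by positivity)
    (Real.exp_le_one_iff.mpr ?_)) (by positivity)
  have : 0 ≤ c * (‖x - ξ‖ ^ 2 / (ρ t - ρ τ)) := by positivity
  linarith

lemma KernelBound.exists_le (hc : 0 < c) (hC : 0 ≤ C) (hK : KernelBound c lam C b ρ K) {t σ : ℝ}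
    (hσ : σ < t) (h : ρ σ < ρ t) : ∃ B, ∀ x η, |K x t η σ| ≤ B :=
  ⟨_, fun x η => (hK.bound x t η σ hσ).trans (mul_le_mul_of_nonneg_left
    (majorant_le_const hc h x η)
    (mul_nonneg hC (Real.rpow_nonneg (sub_nonneg.mpr hσ.le) _)))⟩

lemma integrable_majorant (hc : 0 < c) {t τ : ℝ} (h : ρ τ < ρ t) (ξ : Space n) :
    Integrable fun x => majorant c lam ρ x t ξ τ := by
  have hT : 0 < ρ t - ρ τ := sub_pos.mpr h
  have := ((integrable_exp_norm_sq (n := n) (b := c / (ρ t - ρ τ))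
    (by positivity)).comp_sub_right ξ).const_mul (Real.exp (lam * (ρ t - ρ τ))
      * (Real.pi * (ρ t - ρ τ) / c) ^ (-((n : ℝ) / 2)))
  refine this.congr (Filter.Eventually.of_forall fun x => ?_)
  simp only [majorant, heat]
  rw [mul_assoc]
  congr 3
  ring

lemma PoleBound.integrable (hc : 0 < c) (hf : PoleBound c lam F β ρ ξ τ f) {t : ℝ}
    (hτ : τ < t) (h : ρ τ < ρ t) : Integrable fun x => f x t := by
  refine Integrable.mono' ((integrable_majorant (lam := lam) hc h ξ).const_mul
    (F * (t - τ) ^ (β - 1))) ?_ (Filter.Eventually.of_forall fun x => hf.bound x t hτ)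
  exact (hf.meas.comp (f := fun x : Space n => (x, t)) (by fun_prop)).aestronglyMeasurable

end Resolvent

lemma integral_mul_integral_comm {p φ : Space n → ℝ} {B : Space n → Space n → ℝ}
    (hp : Integrable p) (hφ : Integrable φ) (hB : Measurable fun q : Space n × Space n => B q.1 q.2)
    (hBb : ∃ M, ∀ x y, |B x y| ≤ M) :
    Integrable (fun x => p x * ∫ y, B x y * φ y) ∧
    ∫ x, p x * ∫ y, B x y * φ y = ∫ y, (∫ x, p x * B x y) * φ y := by
  obtain ⟨M, hM⟩ := hBb
  have h1 : Integrable (fun q : Space n × Space n => B q.1 q.2 * (p q.1 * φ q.2))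
      (volume.prod volume) :=
    (hp.mul_prod hφ).bdd_mul hB.aestronglyMeasurable (c := M)
      (Filter.Eventually.of_forall fun q => hM q.1 q.2)
  have h2 : Integrable (Function.uncurry fun x y => p x * (B x y * φ y)) (volume.prod volume) :=
    h1.congr (Filter.Eventually.of_forall fun q => by simp only [Function.uncurry]; ring)
  have e : ∀ x, p x * ∫ y, B x y * φ y = ∫ y, p x * (B x y * φ y) :=
    fun x => (integral_const_mul _ _).symm
  simp_rw [e]
  refine ⟨h2.integral_prod_left, ?_⟩
  rw [integral_integral_swap h2]
  refine integral_congr_ae (Filter.Eventually.of_forall fun y => ?_)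
  simp only
  rw [← integral_mul_const]
  exact integral_congr_ae (Filter.Eventually.of_forall fun x => by simp only; ring)

/-! ### Volterra operators on a grid -/

lemma gridClock_of_mem {h : ℝ} (hh : 0 < h) (τ₀ : ℝ) (k : ℕ) {σ : ℝ}
    (hσ : σ ∈ Ioc (τ₀ + k * h) (τ₀ + (k + 1 : ℕ) * h)) :
    gridClock τ₀ h σ = τ₀ + (k + 1 : ℕ) * h := by
  have h1 : ⌈(σ - τ₀) / h⌉ = ((k + 1 : ℕ) : ℤ) := by
    rw [Int.ceil_eq_iff]
    constructor
    · rw [lt_div_iff₀ hh]; push_cast; linarith [hσ.1]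
    · rw [div_le_iff₀ hh]; push_cast at hσ ⊢; linarith [hσ.2]
  rw [gridClock, h1]; push_cast; ring

lemma gridClock_self {h : ℝ} (τ₀ : ℝ) : gridClock τ₀ h τ₀ = τ₀ := by
  simp [gridClock]

lemma gridClock_idem {h : ℝ} (hh : 0 < h) (τ₀ σ : ℝ) :
    gridClock τ₀ h (gridClock τ₀ h σ) = gridClock τ₀ h σ := by
  have : (gridClock τ₀ h σ - τ₀) / h = (⌈(σ - τ₀) / h⌉ : ℝ) := by
    rw [gridClock]; field_simp; ring
  rw [gridClock, this, Int.ceil_intCast, ← gridClock]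

/-- On a grid the Volterra operator is a Riemann sum. -/
lemma volterra_grid {h : ℝ} (hh : 0 < h) {τ : ℝ} {K : Space n → ℝ → Space n → ℝ → ℝ}
    {f : Space n → ℝ → ℝ} (hK : ∀ x t η σ, K x t η (gridClock τ h σ) = K x t η σ)
    (hf : ∀ η σ, τ < σ → f η (gridClock τ h σ) = f η σ) (x : Space n) (t : ℝ) (i : ℕ) :
    ∫ σ in τ..τ + i * h, ∫ η, K x t η σ * f η σ
      = ∑ k ∈ Finset.range i, h * ∫ η, K x t η (τ + (k + 1 : ℕ) * h) * f η (τ + (k + 1 : ℕ) * h) := by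
  set g : ℝ → ℝ := fun σ => ∫ η, K x t η σ * f η σ with hg
  set a : ℕ → ℝ := fun k => τ + k * h with ha
  have hle : ∀ k : ℕ, a k ≤ a (k + 1) := fun k => by
    simp only [ha]; push_cast; nlinarith
  have hconst : ∀ k : ℕ, ∀ σ ∈ Ioc (a k) (a (k + 1)), g σ = g (a (k + 1)) := by
    intro k σ hσ
    have hk0 : (0 : ℝ) ≤ k * h := by positivity
    have hτσ : τ < σ := lt_of_le_of_lt (by simp only [ha]; linarith) hσ.1
    have e := gridClock_of_mem hh τ k hσ
    simp only [hg]
    refine integral_congr_ae (Filter.Eventually.of_forall fun η => ?_)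
    simp only
    rw [← hK x t η σ, ← hf η σ hτσ, e]
  have hii : ∀ k < i, IntervalIntegrable g volume (a k) (a (k + 1)) := by
    intro k _
    refine (intervalIntegrable_const (c := g (a (k + 1)))).congr fun σ hσ => ?_
    rw [uIoc_of_le (hle k)] at hσ
    exact (hconst k σ hσ).symm
  have h1 := intervalIntegral.sum_integral_adjacent_intervals hii
  have h0 : a 0 = τ := by simp [ha]
  rw [h0] at h1
  change ∫ σ in τ..a i, g σ = _
  rw [← h1]
  refine Finset.sum_congr rfl fun k _ => ?_
  rw [intervalIntegral.integral_of_le (hle k), setIntegral_congr_fun measurableSet_Ioc (hconst k)]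
  have : a (k + 1) - a k = h := by simp only [ha]; push_cast; ring
  rw [setIntegral_const, measureReal_def, Real.volume_Ioc, ENNReal.toReal_ofReal (by linarith),
    this]
  rfl

/-! ### The discrete fundamental solution -/

/-- The parameters of the theorem, together with an exponential rate `lam` for which the Volterra
operator of Levi's kernel is a contraction by `1/2`. -/
structure Setting (n : ℕ) (α N₁ N₂ M κ lam : ℝ) : Prop where
  hn : 1 ≤ n
  hα : 0 < α
  hα1 : α ≤ 1
  hN₁ : 0 < N₁
  hN₂ : 0 < N₂
  hM : 0 < M
  hκ : 0 < κ
  rate_le : segmentRate N₂ M ≤ lam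
  contraction : ∀ τ t : ℝ, τ < t → 2 * segmentConst n N₁ N₂ M κ
    * ∫ σ in Ioo τ t, timeWeight (α / 2) (α / 2) ((lam - segmentRate N₂ M) / 2) τ t σ
      ≤ 1 / 2 * (t - τ) ^ (α / 2 - 1)

lemma exists_setting (hn : 1 ≤ n) {α N₁ N₂ M κ : ℝ} (hα : 0 < α) (hα1 : α ≤ 1) (hN₁ : 0 < N₁)
    (hN₂ : 0 < N₂) (hM : 0 < M) (hκ : 0 < κ) : ∃ lam, Setting n α N₁ N₂ M κ lam := by
  have hC := segmentConst_nonneg (n := n) hN₁ hN₂ hM hκ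
  set C := 2 * segmentConst n N₁ N₂ M κ with hCdef
  have hC0 : 0 ≤ C := by positivity
  obtain ⟨μ, hμ, h⟩ := exists_integral_timeWeight_le (β := α / 2) (by linarith) (by linarith)
    (ε := 1 / (2 * (C + 1))) (by positivity)
  refine ⟨segmentRate N₂ M + 2 * μ, hn, hα, hα1, hN₁, hN₂, hM, hκ, by linarith, fun τ t hτ => ?_⟩
  rw [add_sub_cancel_left, mul_div_cancel_left₀ _ (two_ne_zero)]
  have hp : 0 < (t - τ) ^ (α / 2 - 1) := Real.rpow_pos_of_pos (sub_pos.mpr hτ) _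
  calc C * _ ≤ C * (1 / (2 * (C + 1)) * (t - τ) ^ (α / 2 - 1)) :=
        mul_le_mul_of_nonneg_left (h τ t hτ) hC0
    _ = C / (C + 1) * (1 / 2 * (t - τ) ^ (α / 2 - 1)) := by field_simp
    _ ≤ 1 * (1 / 2 * (t - τ) ^ (α / 2 - 1)) := by
        gcongr
        rw [div_le_one (by positivity)]; linarith
    _ = _ := one_mul _

namespace Operator

/-- One step of the Euler scheme: a positive Gaussian kernel with the coefficients frozen at the
evaluation point `(x, t)`. -/
def eulerStep (L : Operator n) (s : ℝ) (x : Space n) (t : ℝ) (η : Space n) : ℝ :=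
  Real.exp (s * L.q (x, t)) * gauss (s • L.a (x, t)) (x + s • L.drift (x, t) - η)

/-- The resolvent kernel of the discretization with step `s`, on the grid anchored at `τ`. -/
def discreteResolvent (L : Operator n) (s : ℝ) (ξ : Space n) (τ : ℝ) : Space n → ℝ → ℝ :=
  resolvent (L.defectKernel s (gridClock τ s)) ξ τ

/-- The parametrix expansion of the Euler scheme. Compared with Levi's formula it has an extra term
of order `s`, because the discrete sums start at the first time step. -/
def discreteSolution (L : Operator n) (s : ℝ) (ξ : Space n) (τ : ℝ) (x : Space n) (t : ℝ) : ℝ :=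
  leviSolution (L.frozenKernel (gridClock τ s)) (L.defectKernel s (gridClock τ s)) ξ τ x t
    + s * L.discreteResolvent s ξ τ x t

end Operator

lemma integrable_gauss {C : Matrix (Fin n) (Fin n) ℝ} (hC : C.PosDef) (v : Space n) :
    Integrable fun η => gauss C (v - η) := by
  have h := ((integral_exp_quadForm hC.inv).1.comp_sub_left v).const_mul
    ((4 * Real.pi) ^ (-((n : ℝ) / 2)) * (Real.sqrt C.det)⁻¹)
  exact h

section Discrete

variable {L : Operator n} {α N₁ N₂ M κ lam s τ : ℝ}

/-- A kernel that only sees rounded times and vanishes below the first time step. -/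
structure IsGridKernel (ρ : ℝ → ℝ) (K : Space n → ℝ → Space n → ℝ → ℝ) : Prop where
  left : ∀ x t η σ, K x (ρ t) η σ = K x t η σ
  right : ∀ x t η σ, K x t η (ρ σ) = K x t η σ
  zero : ∀ x t η σ, ρ t ≤ ρ σ → K x t η σ = 0

lemma isGridKernel_frozen (L : Operator n) (hs : 0 < s) (τ : ℝ) :
    IsGridKernel (gridClock τ s) (L.frozenKernel (gridClock τ s)) where
  left x t η σ := by simp only [Operator.frozenKernel, gridClock_idem hs]
  right x t η σ := by simp only [Operator.frozenKernel, gridClock_idem hs]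
  zero x t η σ h := by rw [Operator.frozenKernel, if_neg (not_lt.mpr h)]

lemma isGridKernel_defect (L : Operator n) (hs : 0 < s) (τ : ℝ) :
    IsGridKernel (gridClock τ s) (L.defectKernel s (gridClock τ s)) where
  left x t η σ := by simp only [Operator.defectKernel, gridClock_idem hs]
  right x t η σ := by simp only [Operator.defectKernel, gridClock_idem hs]
  zero x t η σ h := by rw [Operator.defectKernel, if_neg (not_lt.mpr h)]

lemma IsGridKernel.volterra_round {K : Space n → ℝ → Space n → ℝ → ℝ} (hs : 0 < s)
    (hK : IsGridKernel (gridClock τ s) K) (f : Space n → ℝ → ℝ) (x : Space n) {t : ℝ} (ht : τ < t) :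
    volterra K τ f x (gridClock τ s t) = volterra K τ f x t := by
  have h1 := le_gridClock hs τ t
  rw [volterra, volterra, intervalIntegral.integral_of_le ht.le,
    intervalIntegral.integral_of_le (ht.le.trans h1)]
  simp only [hK.left]
  refine setIntegral_eq_of_subset_of_forall_sdiff_eq_zero measurableSet_Ioc
    (Ioc_subset_Ioc_right h1) fun σ hσ => ?_
  have h2 : t < σ := by
    by_contra hc
    exact hσ.2 ⟨hσ.1.1, not_lt.mp hc⟩
  have h3 := (isClock_gridClock hs τ).mono h2.le
  simp [hK.zero x t _ σ h3]

lemma IsGridKernel.iterated_round {K : Space n → ℝ → Space n → ℝ → ℝ} (hs : 0 < s)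
    (hK : IsGridKernel (gridClock τ s) K) (ξ : Space n) (l : ℕ) (x : Space n) {t : ℝ}
    (ht : τ < t) : iterated K ξ τ l x (gridClock τ s t) = iterated K ξ τ l x t := by
  cases l with
  | zero =>
    have h1 := le_gridClock hs τ t
    simp only [iterated, if_pos ht, if_pos (ht.trans_le h1), hK.left]
  | succ l => exact hK.volterra_round hs _ x ht

lemma IsGridKernel.resolvent_round {K : Space n → ℝ → Space n → ℝ → ℝ} (hs : 0 < s)
    (hK : IsGridKernel (gridClock τ s) K) (ξ : Space n) (x : Space n) {t : ℝ} (ht : τ < t) :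
    resolvent K ξ τ x (gridClock τ s t) = resolvent K ξ τ x t :=
  tsum_congr fun l => hK.iterated_round hs ξ l x ht

lemma grid_lt (hs : 0 < s) {k i : ℕ} (h : k < i) : τ + k * s < τ + i * s := by
  have : (k : ℝ) < i := by exact_mod_cast h
  nlinarith

lemma lt_grid (hs : 0 < s) {i : ℕ} (h : 1 ≤ i) : τ < τ + i * s := by
  have : (0 : ℝ) < i := by exact_mod_cast h
  nlinarith

namespace Setting

lemma frozen (S : Setting n α N₁ N₂ M κ lam) (h : L.Admissible α N₁ N₂ M κ)
    (hs : 0 < s) (τ : ℝ) : KernelBound (1 / (8 * M)) (segmentRate N₂ M)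
    ((2 * M / κ) ^ ((n : ℝ) / 2)) 1 (gridClock τ s) (L.frozenKernel (gridClock τ s)) :=
  h.kernelBound_frozenKernel S.hM S.hκ (isClock_gridClock hs τ) (segmentRate_nonneg S.hN₂ S.hM)

lemma defect (S : Setting n α N₁ N₂ M κ lam) (h : L.Admissible α N₁ N₂ M κ)
    (hs : 0 < s) (τ : ℝ) : KernelBound (1 / (8 * M)) (segmentRate N₂ M)
    (2 * segmentConst n N₁ N₂ M κ) (α / 2) (gridClock τ s)
    (L.defectKernel s (gridClock τ s)) :=
  h.kernelBound_defectKernel S.hα S.hα1 S.hN₁ S.hN₂ S.hM S.hκ hs τ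

lemma iterated_defect (S : Setting n α N₁ N₂ M κ lam) (h : L.Admissible α N₁ N₂ M κ)
    (hs : 0 < s) (τ₀ : ℝ) (ξ : Space n) (τ : ℝ) (l : ℕ) :
    PoleBound (1 / (8 * M)) lam (2 * segmentConst n N₁ N₂ M κ * (1 / 2) ^ l) (α / 2)
      (gridClock τ₀ s) ξ τ (iterated (L.defectKernel s (gridClock τ₀ s)) ξ τ l) := by
  have hM := S.hM
  have hsc := segmentConst_nonneg (n := n) S.hN₁ S.hN₂ S.hM S.hκ
  exact iterated_bound S.hn (by positivity) (isClock_gridClock hs τ₀) S.rate_le (by positivity)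
    (by linarith [S.hα]) (by linarith [S.hα1]) (S.defect h hs τ₀) S.contraction ξ τ l

lemma resolventBound (S : Setting n α N₁ N₂ M κ lam) (h : L.Admissible α N₁ N₂ M κ)
    (hs : 0 < s) (ξ : Space n) (τ : ℝ) :
    PoleBound (1 / (8 * M)) lam (2 * (2 * segmentConst n N₁ N₂ M κ)) (α / 2)
      (gridClock τ s) ξ τ (L.discreteResolvent s ξ τ) :=
  resolvent_bound (S.iterated_defect h hs τ ξ τ)

lemma discreteResolvent_grid (S : Setting n α N₁ N₂ M κ lam) (h : L.Admissible α N₁ N₂ M κ)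
    (hs : 0 < s) (ξ : Space n) (τ : ℝ) (x : Space n) {i : ℕ}
    (hi : 1 ≤ i) : L.discreteResolvent s ξ τ x (τ + i * s)
      = L.defectKernel s (gridClock τ s) x (τ + i * s) ξ τ
        + ∑ k ∈ Finset.range i, s * ∫ η, L.defectKernel s (gridClock τ s) x (τ + i * s) η
          (τ + (k + 1 : ℕ) * s) * L.discreteResolvent s ξ τ η (τ + (k + 1 : ℕ) * s) := by
  have hM := S.hM
  have hsc := segmentConst_nonneg (n := n) S.hN₁ S.hN₂ S.hM S.hκ
  have hg := isGridKernel_defect L hs τ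
  rw [← volterra_grid (f := L.discreteResolvent s ξ τ) hs hg.right (fun η σ hσ => hg.resolvent_round hs ξ η hσ)]
  exact resolvent_eq S.hn (by positivity) (isClock_gridClock hs τ) S.rate_le (by positivity)
    (by linarith [S.hα]) (by linarith [S.hα1]) (S.defect h hs τ) (S.iterated_defect h hs τ ξ τ) x
    (lt_grid hs hi)

lemma discreteSolution_grid (L : Operator n) (hs : 0 < s) (ξ : Space n) (τ : ℝ) (x : Space n)
    (i : ℕ) : L.discreteSolution s ξ τ x (τ + i * s)
      = L.frozenKernel (gridClock τ s) x (τ + i * s) ξ τ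
        + ∑ k ∈ Finset.range i, s * (∫ η, L.frozenKernel (gridClock τ s) x (τ + i * s) η
          (τ + (k + 1 : ℕ) * s) * L.discreteResolvent s ξ τ η (τ + (k + 1 : ℕ) * s))
        + s * L.discreteResolvent s ξ τ x (τ + i * s) := by
  have hg := isGridKernel_frozen L hs τ
  have hg' := isGridKernel_defect L hs τ
  rw [← volterra_grid (f := L.discreteResolvent s ξ τ) hs hg.right (fun η σ hσ => hg'.resolvent_round hs ξ η hσ)]
  rfl

/-- The frozen Gaussian and the one step error add up to the end of the segment. -/
lemma frozen_add_defect (L : Operator n) (hs : 0 < s) (τ : ℝ) (x ζ : Space n) {k i : ℕ} (hk : k ≤ i) :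
    L.frozenKernel (gridClock τ s) x (τ + (i + 1 : ℕ) * s) ζ (τ + k * s)
      + s * L.defectKernel s (gridClock τ s) x (τ + (i + 1 : ℕ) * s) ζ (τ + k * s)
    = Real.exp (s * L.q (x, τ + (i + 1 : ℕ) * s))
      * gauss (s • L.a (x, τ + (i + 1 : ℕ) * s) + ((i - k) * s) • L.a (ζ, τ + k * s))
        (x + s • L.drift (x, τ + (i + 1 : ℕ) * s) - ζ) := by
  have hlt : τ + k * s < τ + (i + 1 : ℕ) * s := grid_lt hs (by omega)
  simp only [Operator.frozenKernel, Operator.defectKernel, gridClock_natCast hs, if_pos hlt]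
  have hd : (i : ℝ) - k = (i - k : ℕ) := by push_cast [hk]; ring
  have hT : τ + (i + 1 : ℕ) * s - (τ + k * s) = (i - k) * s + s := by push_cast; ring
  rw [mul_inv_cancel_left₀ hs.ne', segment, segment, hT]
  simp only [zero_mul, Real.exp_zero, one_mul, zero_smul, add_zero]
  rw [add_sub_cancel]
  congr 2
  · rw [add_smul, smul_sub]; abel
  · abel

/-- Composing an Euler step with the frozen Gaussian. -/
lemma integral_eulerStep_mul_frozen (S : Setting n α N₁ N₂ M κ lam) (h : L.Admissible α N₁ N₂ M κ)
    (hs : 0 < s) (τ : ℝ) (x ζ : Space n) {k i : ℕ} (hk : k < i) :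
    Integrable (fun η => L.eulerStep s x (τ + (i + 1 : ℕ) * s) η
      * L.frozenKernel (gridClock τ s) η (τ + i * s) ζ (τ + k * s)) ∧
    ∫ η, L.eulerStep s x (τ + (i + 1 : ℕ) * s) η
      * L.frozenKernel (gridClock τ s) η (τ + i * s) ζ (τ + k * s)
    = L.frozenKernel (gridClock τ s) x (τ + (i + 1 : ℕ) * s) ζ (τ + k * s)
      + s * L.defectKernel s (gridClock τ s) x (τ + (i + 1 : ℕ) * s) ζ (τ + k * s) := by
  rw [frozen_add_defect L hs τ x ζ hk.le]
  have hlt : τ + k * s < τ + i * s := grid_lt hs hk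
  have hT : τ + i * s - (τ + k * s) = (i - k) * s := by ring
  have hT0 : 0 < ((i : ℝ) - k) * s := by linarith
  have hA := (h.elliptic_a (x, τ + (i + 1 : ℕ) * s)).smul hs.le
  have hA' := (h.elliptic_a (ζ, τ + k * s)).smul hT0.le
  have hκ := S.hκ
  have hg := gauss_conv (by positivity) (by positivity) hA hA'
    (x + s • L.drift (x, τ + (i + 1 : ℕ) * s)) ζ
  have e : ∀ η, L.eulerStep s x (τ + (i + 1 : ℕ) * s) η
      * L.frozenKernel (gridClock τ s) η (τ + i * s) ζ (τ + k * s)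
      = Real.exp (s * L.q (x, τ + (i + 1 : ℕ) * s))
        * (gauss (s • L.a (x, τ + (i + 1 : ℕ) * s))
          (x + s • L.drift (x, τ + (i + 1 : ℕ) * s) - η)
        * gauss (((i - k) * s) • L.a (ζ, τ + k * s)) (η - ζ)) := by
    intro η
    rw [Operator.frozenKernel, gridClock_natCast hs, gridClock_natCast hs, if_pos hlt, hT,
      Operator.eulerStep, mul_assoc]
  simp_rw [e]
  exact ⟨hg.1.const_mul _, by rw [integral_const_mul, hg.2]⟩

lemma eulerStep_eq (L : Operator n) (hs : 0 < s) (τ : ℝ) (x η : Space n) (i : ℕ) :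
    L.eulerStep s x (τ + (i + 1 : ℕ) * s) η
      = L.frozenKernel (gridClock τ s) x (τ + (i + 1 : ℕ) * s) η (τ + i * s)
      + s * L.defectKernel s (gridClock τ s) x (τ + (i + 1 : ℕ) * s) η (τ + i * s) := by
  rw [frozen_add_defect L hs τ x η le_rfl, Operator.eulerStep]
  simp

lemma integrable_eulerStep (S : Setting n α N₁ N₂ M κ lam) (h : L.Admissible α N₁ N₂ M κ)
    (hs : 0 < s) (x : Space n) (t : ℝ) :
    Integrable (L.eulerStep s x t) :=
  (integrable_gauss (((h.elliptic_a (x, t)).smul hs.le).posDef (mul_pos hs S.hκ)) _).const_mul _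

lemma eulerStep_nonneg (L : Operator n) (s : ℝ) (x : Space n) (t : ℝ) (η : Space n) :
    0 ≤ L.eulerStep s x t η :=
  mul_nonneg (Real.exp_nonneg _) (gauss_nonneg _ _)

lemma measurable_eulerStep (h : L.Admissible α N₁ N₂ M κ) (s t : ℝ) :
    Measurable fun q : Space n × Space n => L.eulerStep s q.1 t q.2 := by
  have hx : Measurable fun q : Space n × Space n => ((q.1, t) : SpaceTime n) := by fun_prop
  have hq := h.continuous_q.measurable.comp hx
  have hb := h.continuous_drift.measurable.comp hx
  unfold Operator.eulerStep
  refine ((hq.const_mul s).exp).mul (measurable_gauss (fun i j => ?_) ?_)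
  · exact ((h.holder_a i j).1.1.measurable.comp hx).const_mul s
  · exact (measurable_fst.add (hb.const_smul s)).sub measurable_snd

end Setting

end Discrete

/-! ### Positivity and the semigroup property of the discrete fundamental solution -/

/-- The constant in the short time comparison of the solution with the parametrix. -/
def correctionConst (n : ℕ) (α N₁ N₂ M κ : ℝ) : ℝ :=
  2 * (2 * segmentConst n N₁ N₂ M κ) * ((2 * M / κ) ^ ((n : ℝ) / 2) / (α / 2) + 1)

namespace Setting

variable {L : Operator n} {α N₁ N₂ M κ lam s τ : ℝ}

lemma correctionConst_nonneg (S : Setting n α N₁ N₂ M κ lam) :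
    0 ≤ correctionConst n α N₁ N₂ M κ := by
  have hM := S.hM
  have hκ := S.hκ
  have hα := S.hα
  have hsc := segmentConst_nonneg (n := n) S.hN₁ S.hN₂ S.hM S.hκ
  unfold correctionConst
  positivity

/-- The correction to the parametrix carries a factor `(t - τ)^(α/2)`, uniformly in the step. -/
lemma abs_discreteSolution_sub_le (S : Setting n α N₁ N₂ M κ lam)
    (h : L.Admissible α N₁ N₂ M κ) (hs : 0 < s) (ξ : Space n) (τ : ℝ) (x : Space n) {t : ℝ}
    (hst : τ + s ≤ t) :
    |L.discreteSolution s ξ τ x t - L.frozenKernel (gridClock τ s) x t ξ τ|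
      ≤ correctionConst n α N₁ N₂ M κ * (t - τ) ^ (α / 2)
        * majorant (1 / (8 * M)) lam (gridClock τ s) x t ξ τ := by
  have hM := S.hM
  have hκ := S.hκ
  have hα := S.hα
  have hτ : τ < t := by linarith
  have ht0 : 0 < t - τ := by linarith
  have hsc := segmentConst_nonneg (n := n) S.hN₁ S.hN₂ S.hM S.hκ
  have hm := majorant_nonneg (c := 1 / (8 * M)) (lam := lam) (by positivity)
    (isClock_gridClock hs τ) x ξ hτ.le
  have h1 := abs_volterra_resolvent_le (D := (2 * M / κ) ^ ((n : ℝ) / 2)) S.hn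
    (by positivity : 0 < 1 / (8 * M)) (isClock_gridClock hs τ) S.rate_le (by positivity)
    (by positivity) (by linarith) (by linarith [S.hα1]) (S.iterated_defect h hs τ ξ τ)
    (S.frozen h hs τ) x hτ
  have h2 := (S.resolventBound h hs ξ τ).bound x t hτ
  have e : L.discreteSolution s ξ τ x t - L.frozenKernel (gridClock τ s) x t ξ τ
      = volterra (L.frozenKernel (gridClock τ s)) τ
          (resolvent (L.defectKernel s (gridClock τ s)) ξ τ) x t
        + s * L.discreteResolvent s ξ τ x t := by
    rw [Operator.discreteSolution, leviSolution]; ring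
  rw [e]
  refine (abs_add_le _ _).trans ?_
  rw [abs_mul, abs_of_pos hs]
  have h3 : (t - τ) * (t - τ) ^ (α / 2 - 1) = (t - τ) ^ (α / 2) := by
    rw [Real.rpow_sub_one ht0.ne']; field_simp
  have h4 : s * |L.discreteResolvent s ξ τ x t|
      ≤ 2 * (2 * segmentConst n N₁ N₂ M κ) * (t - τ) ^ (α / 2)
        * majorant (1 / (8 * M)) lam (gridClock τ s) x t ξ τ := by
    calc _ ≤ (t - τ) * (2 * (2 * segmentConst n N₁ N₂ M κ) * (t - τ) ^ (α / 2 - 1)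
          * majorant (1 / (8 * M)) lam (gridClock τ s) x t ξ τ) :=
          mul_le_mul (by linarith) h2 (abs_nonneg _) ht0.le
      _ = 2 * (2 * segmentConst n N₁ N₂ M κ) * ((t - τ) * (t - τ) ^ (α / 2 - 1))
          * majorant (1 / (8 * M)) lam (gridClock τ s) x t ξ τ := by ring
      _ = _ := by rw [h3]
  calc _ ≤ _ := add_le_add h1 h4
    _ = _ := by unfold correctionConst; ring

lemma abs_discreteSolution_le (S : Setting n α N₁ N₂ M κ lam)
    (h : L.Admissible α N₁ N₂ M κ) (hs : 0 < s) (ξ : Space n) (τ : ℝ) (x : Space n) {t : ℝ}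
    (hst : τ + s ≤ t) :
    |L.discreteSolution s ξ τ x t| ≤ ((2 * M / κ) ^ ((n : ℝ) / 2)
        + correctionConst n α N₁ N₂ M κ * (t - τ) ^ (α / 2))
        * majorant (1 / (8 * M)) lam (gridClock τ s) x t ξ τ := by
  have hM := S.hM
  have hκ := S.hκ
  have hτ : τ < t := by linarith
  have h1 := S.abs_discreteSolution_sub_le h hs ξ τ x hst
  have h2 := (S.frozen h hs τ).bound x t ξ τ hτ
  have h3 := majorant_mono (c := 1 / (8 * M)) (by positivity) (isClock_gridClock hs τ) S.rate_le x ξ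
    hτ.le
  rw [sub_self, Real.rpow_zero, mul_one] at h2
  have h4 : |L.frozenKernel (gridClock τ s) x t ξ τ| ≤ (2 * M / κ) ^ ((n : ℝ) / 2)
      * majorant (1 / (8 * M)) lam (gridClock τ s) x t ξ τ :=
    h2.trans (mul_le_mul_of_nonneg_left h3 (by positivity))
  have h5 := abs_sub_abs_le_abs_sub (L.discreteSolution s ξ τ x t)
    (L.frozenKernel (gridClock τ s) x t ξ τ)
  rw [add_mul]
  linarith

lemma discreteSolution_one (S : Setting n α N₁ N₂ M κ lam) (h : L.Admissible α N₁ N₂ M κ)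
    (hs : 0 < s) (ξ : Space n) (τ : ℝ) (x : Space n) :
    L.discreteSolution s ξ τ x (τ + (1 : ℕ) * s) = L.eulerStep s x (τ + (1 : ℕ) * s) ξ := by
  have e := eulerStep_eq L hs τ x ξ 0
  rw [discreteSolution_grid L hs, S.discreteResolvent_grid h hs ξ τ x le_rfl]
  simp only [Nat.cast_zero, zero_mul, add_zero, zero_add] at e
  have hz : ∀ η, L.frozenKernel (gridClock τ s) x (τ + (1 : ℕ) * s) η (τ + (1 : ℕ) * s) = 0 :=
    fun η => (isGridKernel_frozen L hs τ).zero _ _ _ _ le_rfl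
  have hz' : ∀ η, L.defectKernel s (gridClock τ s) x (τ + (1 : ℕ) * s) η (τ + (1 : ℕ) * s) = 0 :=
    fun η => (isGridKernel_defect L hs τ).zero _ _ _ _ le_rfl
  rw [Finset.sum_range_one, Finset.sum_range_one]
  simp only [zero_add, hz, hz', zero_mul, integral_zero, mul_zero, add_zero]
  exact e.symm

lemma gridClock_lt_gridClock (hs : 0 < s) (τ : ℝ) {k i : ℕ} (hk : k < i) :
    gridClock τ s (τ + k * s) < gridClock τ s (τ + i * s) := by
  rw [gridClock_natCast hs, gridClock_natCast hs]; exact grid_lt hs hk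

lemma gridClock_anchor_lt (hs : 0 < s) (τ : ℝ) {i : ℕ} (hi : 1 ≤ i) :
    gridClock τ s τ < gridClock τ s (τ + i * s) := by
  rw [gridClock_self, gridClock_natCast hs]; exact lt_grid hs hi

/-- The discrete solution evolves by Euler steps: composing an Euler step with each term of the
expansion adds the defect kernel, and the defects sum to the resolvent at the new time. -/
lemma discreteSolution_succ (S : Setting n α N₁ N₂ M κ lam) (h : L.Admissible α N₁ N₂ M κ)
    (hs : 0 < s) (ξ : Space n) (τ : ℝ) (x : Space n) {i : ℕ} (hi : 1 ≤ i) :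
    L.discreteSolution s ξ τ x (τ + (i + 1 : ℕ) * s)
      = ∫ η, L.eulerStep s x (τ + (i + 1 : ℕ) * s) η * L.discreteSolution s ξ τ η (τ + i * s) := by
  obtain ⟨m, rfl⟩ : ∃ m, i = m + 1 := ⟨i - 1, by omega⟩
  have hM := S.hM
  have hκ := S.hκ
  have hc : 0 < 1 / (8 * M) := by positivity
  have hsc := segmentConst_nonneg (n := n) S.hN₁ S.hN₂ S.hM S.hκ
  have hC : 0 ≤ 2 * segmentConst n N₁ N₂ M κ := by positivity
  have hD : 0 ≤ (2 * M / κ) ^ ((n : ℝ) / 2) := by positivity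
  set ρ := gridClock τ s with hρ
  set Z := L.frozenKernel ρ with hZ
  set K := L.defectKernel s ρ with hK
  set g : ℕ → ℝ := fun k => τ + k * s with hg
  set Φ : ℕ → Space n → ℝ := fun k η => L.discreteResolvent s ξ τ η (g k) with hΦ
  set P := L.eulerStep s x (g (m + 1 + 1)) with hP
  have hZb := S.frozen h hs τ
  have hKb := S.defect h hs τ
  have hΦi : ∀ k, 1 ≤ k → Integrable (Φ k) := fun k hk =>
    (S.resolventBound h hs ξ τ).integrable hc (lt_grid hs hk) (gridClock_anchor_lt hs τ hk)
  have hPi : Integrable P := S.integrable_eulerStep h hs x _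
  have hZm : ∀ k i : ℕ, Measurable fun q : Space n × Space n => Z q.1 (g i) q.2 (g k) := fun k i =>
    hZb.meas.comp (f := fun q : Space n × Space n => ((q.1, g i), (q.2, g k))) (by fun_prop)
  have hKm : ∀ k i : ℕ, Measurable fun q : Space n × Space n => K q.1 (g i) q.2 (g k) := fun k i =>
    hKb.meas.comp (f := fun q : Space n × Space n => ((q.1, g i), (q.2, g k))) (by fun_prop)
  have hZbd : ∀ k i : ℕ, k < i → ∃ B, ∀ y η, |Z y (g i) η (g k)| ≤ B := fun k i hk =>
    hZb.exists_le hc hD (grid_lt hs hk) (gridClock_lt_gridClock hs τ hk)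
  have hKbd : ∀ k i : ℕ, k < i → ∃ B, ∀ y η, |K y (g i) η (g k)| ≤ B := fun k i hk =>
    hKb.exists_le hc hC (grid_lt hs hk) (gridClock_lt_gridClock hs τ hk)
  have hZ0 : ∀ k η y, Z y (g k) η (g k) = 0 := fun k η y =>
    (isGridKernel_frozen L hs τ).zero _ _ _ _ le_rfl
  have hK0 : ∀ k η y, K y (g k) η (g k) = 0 := fun k η y =>
    (isGridKernel_defect L hs τ).zero _ _ _ _ le_rfl
  -- integrability of the kernels against the resolvent
  have hZΦ : ∀ k, 1 ≤ k → k < m + 1 + 1 →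
      Integrable fun η => Z x (g (m + 1 + 1)) η (g k) * Φ k η := by
    intro k hk hk'
    obtain ⟨B, hB⟩ := hZbd k _ hk'
    exact (hΦi k hk).bdd_mul (c := B) ((hZm k _).comp (f := fun η => (x, η))
      (by fun_prop)).aestronglyMeasurable (Filter.Eventually.of_forall fun η => hB x η)
  have hKΦ : ∀ k, 1 ≤ k → k < m + 1 + 1 →
      Integrable fun η => K x (g (m + 1 + 1)) η (g k) * Φ k η := by
    intro k hk hk'
    obtain ⟨B, hB⟩ := hKbd k _ hk'
    exact (hΦi k hk).bdd_mul (c := B) ((hKm k _).comp (f := fun η => (x, η))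
      (by fun_prop)).aestronglyMeasurable (Filter.Eventually.of_forall fun η => hB x η)
  have hsplit : ∀ k, 1 ≤ k → k < m + 1 + 1 →
      ∫ η, (Z x (g (m + 1 + 1)) η (g k) + s * K x (g (m + 1 + 1)) η (g k)) * Φ k η
        = (∫ η, Z x (g (m + 1 + 1)) η (g k) * Φ k η)
          + s * ∫ η, K x (g (m + 1 + 1)) η (g k) * Φ k η := by
    intro k hk hk'
    rw [← integral_const_mul, ← integral_add (hZΦ k hk hk') ((hKΦ k hk hk').const_mul s)]
    exact integral_congr_ae (Filter.Eventually.of_forall fun η => by simp only; ring)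
  -- the three parts of the discrete solution at the previous time
  obtain ⟨h1i, h1⟩ := S.integral_eulerStep_mul_frozen h hs τ x ξ (Nat.succ_pos m)
  have h2 : ∀ k, 1 ≤ k → k < m + 1 →
      Integrable (fun η => P η * ∫ ζ, Z η (g (m + 1)) ζ (g k) * Φ k ζ) ∧
      ∫ η, P η * ∫ ζ, Z η (g (m + 1)) ζ (g k) * Φ k ζ
        = ∫ η, (Z x (g (m + 1 + 1)) η (g k) + s * K x (g (m + 1 + 1)) η (g k)) * Φ k η := by
    intro k hk hk'
    obtain ⟨hi, hv⟩ := integral_mul_integral_comm (B := fun η ζ => Z η (g (m + 1)) ζ (g k)) hPi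
      (hΦi k hk) (hZm k (m + 1)) (hZbd k _ hk')
    refine ⟨hi, hv.trans (integral_congr_ae (Filter.Eventually.of_forall fun ζ => ?_))⟩
    simp only
    rw [← (S.integral_eulerStep_mul_frozen h hs τ x ζ hk').2]
  have h3 : ∀ η, P η * Φ (m + 1) η
      = (Z x (g (m + 1 + 1)) η (g (m + 1)) + s * K x (g (m + 1 + 1)) η (g (m + 1))) * Φ (m + 1) η :=
    fun η => by rw [hP, hg, eulerStep_eq L hs τ x η (m + 1)]
  have h3i : Integrable fun η => P η * Φ (m + 1) η := by
    refine (((hZΦ (m + 1) (by omega) (by omega))).add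
      ((hKΦ (m + 1) (by omega) (by omega)).const_mul s)).congr
      (Filter.Eventually.of_forall fun η => ?_)
    simp only [Pi.add_apply, h3]; ring
  have hsol : ∀ η, P η * L.discreteSolution s ξ τ η (τ + (m + 1 : ℕ) * s)
      = P η * Z η (g (m + 1)) ξ (g 0)
        + (∑ k ∈ Finset.range m, s * (P η * ∫ ζ, Z η (g (m + 1)) ζ (g (k + 1)) * Φ (k + 1) ζ)
          + s * (P η * Φ (m + 1) η)) := by
    intro η
    rw [discreteSolution_grid L hs, Finset.sum_range_succ]
    have e0 : ∀ ζ, L.frozenKernel (gridClock τ s) η (τ + (m + 1 : ℕ) * s) ζ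
      (τ + (m + 1 : ℕ) * s) = 0 := fun ζ => hZ0 (m + 1) ζ η
    have e1 : g 0 = τ := by simp [hg]
    simp only [e0, zero_mul, integral_zero, mul_zero, add_zero]
    rw [e1, mul_add, mul_add, Finset.mul_sum, add_assoc]
    congr 2
    · exact Finset.sum_congr rfl fun k _ => by ring
    · simp only [hΦ, hg]; ring
  simp_rw [hsol]
  have hsumi : ∀ k ∈ Finset.range m, Integrable fun η =>
      s * (P η * ∫ ζ, Z η (g (m + 1)) ζ (g (k + 1)) * Φ (k + 1) ζ) := fun k hk =>
    (h2 (k + 1) (by omega) (by have := Finset.mem_range.mp hk; omega)).1.const_mul s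
  have h1i' : Integrable fun η => P η * Z η (g (m + 1)) ξ (g 0) := h1i
  have h1' : ∫ η, P η * Z η (g (m + 1)) ξ (g 0)
    = Z x (g (m + 1 + 1)) ξ (g 0) + s * K x (g (m + 1 + 1)) ξ (g 0) := h1
  have hadd : Integrable fun η => (∑ k ∈ Finset.range m,
      s * (P η * ∫ ζ, Z η (g (m + 1)) ζ (g (k + 1)) * Φ (k + 1) ζ)) + s * (P η * Φ (m + 1) η) :=
    (integrable_finsetSum _ hsumi).add (h3i.const_mul s)
  rw [integral_add h1i' hadd, h1',
    integral_add (integrable_finsetSum _ hsumi) (h3i.const_mul s), integral_finsetSum _ hsumi,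
    integral_const_mul]
  simp_rw [h3]
  rw [hsplit (m + 1) (by omega) (by omega)]
  have hsum : ∑ k ∈ Finset.range m, ∫ η, s * (P η * ∫ ζ, Z η (g (m + 1)) ζ (g (k + 1))
        * Φ (k + 1) ζ)
      = ∑ k ∈ Finset.range m, s * ((∫ η, Z x (g (m + 1 + 1)) η (g (k + 1)) * Φ (k + 1) η)
          + s * ∫ η, K x (g (m + 1 + 1)) η (g (k + 1)) * Φ (k + 1) η) := by
    refine Finset.sum_congr rfl fun k hk => ?_
    have hk' := Finset.mem_range.mp hk
    rw [integral_const_mul, (h2 (k + 1) (by omega) (by omega)).2,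
      hsplit (k + 1) (by omega) (by omega)]
  rw [hsum, discreteSolution_grid L hs, S.discreteResolvent_grid h hs ξ τ x (by omega),
    Finset.sum_range_succ, Finset.sum_range_succ, Finset.sum_range_succ, Finset.sum_range_succ]
  have e0 : ∀ ζ, L.frozenKernel (gridClock τ s) x (τ + (m + 1 + 1 : ℕ) * s) ζ
      (τ + (m + 1 + 1 : ℕ) * s) = 0 := fun ζ => hZ0 (m + 1 + 1) ζ x
  have e0' : ∀ ζ, L.defectKernel s (gridClock τ s) x (τ + (m + 1 + 1 : ℕ) * s) ζ
      (τ + (m + 1 + 1 : ℕ) * s) = 0 := fun ζ => hK0 (m + 1 + 1) ζ x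
  have e1 : g 0 = τ := by simp [hg]
  simp only [e0, e0', zero_mul, integral_zero, mul_zero, add_zero]
  rw [e1]
  simp only [mul_add, Finset.sum_add_distrib, Finset.mul_sum, hΦ, hg, hZ, hK, hρ]
  ring

/-- Positivity holds on the grid, where the discrete solution is a product of Euler steps. -/
lemma discreteSolution_nonneg (S : Setting n α N₁ N₂ M κ lam) (h : L.Admissible α N₁ N₂ M κ)
    (hs : 0 < s) (ξ : Space n) (τ : ℝ) (x : Space n) (i : ℕ) :
    0 ≤ L.discreteSolution s ξ τ x (τ + (i + 1 : ℕ) * s) := by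
  induction i generalizing x with
  | zero =>
    rw [zero_add, S.discreteSolution_one h hs]
    exact eulerStep_nonneg _ _ _ _ _
  | succ i ih =>
    rw [S.discreteSolution_succ h hs ξ τ x (by omega)]
    exact integral_nonneg fun η => mul_nonneg (eulerStep_nonneg _ _ _ _ _) (ih η)

lemma measurable_discreteSolution (S : Setting n α N₁ N₂ M κ lam)
    (h : L.Admissible α N₁ N₂ M κ) (hs : 0 < s) (τ : ℝ) (i : ℕ) :
    Measurable fun q : Space n × Space n =>
      L.discreteSolution s q.2 τ q.1 (τ + (i + 1 : ℕ) * s) := by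
  induction i with
  | zero =>
    simp only [zero_add, S.discreteSolution_one h hs]
    exact measurable_eulerStep h s _
  | succ i ih =>
    simp only [S.discreteSolution_succ h hs _ τ _ (by omega : 1 ≤ i + 1)]
    have h1 := (measurable_eulerStep h s (τ + (i + 1 + 1 : ℕ) * s)).comp
      (f := fun p : (Space n × Space n) × Space n => (p.1.1, p.2)) (by fun_prop)
    have h2 := ih.comp (f := fun p : (Space n × Space n) × Space n => (p.2, p.1.2)) (by fun_prop)
    exact ((h1.mul h2).stronglyMeasurable.integral_prod_right').measurable

lemma add_le_grid (hs : 0 < s) (τ : ℝ) (i : ℕ) : τ + s ≤ τ + (i + 1 : ℕ) * s := by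
  push_cast
  have : (0 : ℝ) ≤ i * s := by positivity
  linarith

lemma exists_discreteSolution_le (S : Setting n α N₁ N₂ M κ lam)
    (h : L.Admissible α N₁ N₂ M κ) (hs : 0 < s) (τ : ℝ) (i : ℕ) :
    ∃ B, ∀ x ξ, |L.discreteSolution s ξ τ x (τ + (i + 1 : ℕ) * s)| ≤ B := by
  have hM := S.hM
  have hκ := S.hκ
  have hA := S.correctionConst_nonneg
  refine ⟨_, fun x ξ => (S.abs_discreteSolution_le h hs ξ τ x (add_le_grid hs τ i)).trans
    (mul_le_mul_of_nonneg_left (majorant_le_const (by positivity)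
      (gridClock_anchor_lt hs τ (by omega)) x ξ) ?_)⟩
  have : 0 ≤ τ + (i + 1 : ℕ) * s - τ := by linarith [add_le_grid hs τ i]
  positivity

lemma integrable_discreteSolution (S : Setting n α N₁ N₂ M κ lam)
    (h : L.Admissible α N₁ N₂ M κ) (hs : 0 < s) (ξ : Space n) (τ : ℝ) (i : ℕ) :
    Integrable fun x => L.discreteSolution s ξ τ x (τ + (i + 1 : ℕ) * s) := by
  have hM := S.hM
  refine Integrable.mono' ((integrable_majorant (c := 1 / (8 * M)) (lam := lam) (by positivity)
    (gridClock_anchor_lt hs τ (i := i + 1) (by omega)) ξ).const_mul _)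
    ((S.measurable_discreteSolution h hs τ i).comp (f := fun x => (x, ξ))
      (by fun_prop)).aestronglyMeasurable
    (Filter.Eventually.of_forall fun x => S.abs_discreteSolution_le h hs ξ τ x (add_le_grid hs τ i))

/-- The semigroup property on the grid. -/
lemma discreteSolution_semigroup (S : Setting n α N₁ N₂ M κ lam)
    (h : L.Admissible α N₁ N₂ M κ) (hs : 0 < s) (ξ : Space n) (τ : ℝ) (x : Space n) (i j : ℕ) :
    L.discreteSolution s ξ τ x (τ + (i + 1 + (j + 1) : ℕ) * s)
      = ∫ η, L.discreteSolution s η (τ + (j + 1 : ℕ) * s) x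
          (τ + (j + 1 : ℕ) * s + (i + 1 : ℕ) * s)
        * L.discreteSolution s ξ τ η (τ + (j + 1 : ℕ) * s) := by
  set τ' := τ + (j + 1 : ℕ) * s with hτ'
  have ht : ∀ i : ℕ, τ + (i + (j + 1) : ℕ) * s = τ' + i * s := fun i => by
    rw [hτ']; push_cast; ring
  induction i generalizing x with
  | zero =>
    simp_rw [zero_add, S.discreteSolution_one h hs]
    rw [← ht 1, add_comm 1 (j + 1), S.discreteSolution_succ h hs ξ τ x (by omega)]
  | succ i ih =>
    have e : i + 1 + 1 + (j + 1) = (i + 1 + (j + 1)) + 1 := by ring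
    rw [e, S.discreteSolution_succ h hs ξ τ x (by omega), ← e, ht (i + 1 + 1)]
    simp_rw [ih]
    rw [(integral_mul_integral_comm
      (B := fun ζ η => L.discreteSolution s η τ' ζ (τ' + (i + 1 : ℕ) * s))
      (S.integrable_eulerStep h hs x _) (S.integrable_discreteSolution h hs ξ τ j)
      (S.measurable_discreteSolution h hs τ' i) (S.exists_discreteSolution_le h hs τ' i)).2]
    refine integral_congr_ae (Filter.Eventually.of_forall fun η => ?_)
    simp only
    rw [S.discreteSolution_succ h hs η τ' x (by omega)]

end Setting

/-! ### Convergence of Levi's construction and of the Euler scheme -/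

namespace Setting

variable {L : Operator n} {α N₁ N₂ M κ lam s τ : ℝ}

lemma levi (S : Setting n α N₁ N₂ M κ lam) (h : L.Admissible α N₁ N₂ M κ) :
    KernelBound (1 / (8 * M)) (segmentRate N₂ M) (2 * segmentConst n N₁ N₂ M κ) (α / 2)
      (fun t => t) L.leviKernel :=
  h.kernelBound_leviKernel S.hα S.hα1 S.hN₁ S.hN₂ S.hM S.hκ

lemma iterated_levi (S : Setting n α N₁ N₂ M κ lam) (h : L.Admissible α N₁ N₂ M κ)
    (ξ : Space n) (τ : ℝ) (l : ℕ) :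
    PoleBound (1 / (8 * M)) lam (2 * segmentConst n N₁ N₂ M κ * (1 / 2) ^ l) (α / 2)
      (fun t => t) ξ τ (iterated L.leviKernel ξ τ l) := by
  have hM := S.hM
  have hsc := segmentConst_nonneg (n := n) S.hN₁ S.hN₂ S.hM S.hκ
  exact iterated_bound S.hn (by positivity) isClock_id S.rate_le (by positivity)
    (by linarith [S.hα]) (by linarith [S.hα1]) (S.levi h) S.contraction ξ τ l

lemma frozen_id (S : Setting n α N₁ N₂ M κ lam) (h : L.Admissible α N₁ N₂ M κ) :
    KernelBound (1 / (8 * M)) (segmentRate N₂ M) ((2 * M / κ) ^ ((n : ℝ) / 2)) 1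
      (fun t => t) (L.frozenKernel fun t => t) :=
  h.kernelBound_frozenKernel S.hM S.hκ isClock_id (segmentRate_nonneg S.hN₂ S.hM)

lemma convergesAt (S : Setting n α N₁ N₂ M κ lam) (h : L.Admissible α N₁ N₂ M κ)
    (x : Space n) {t : ℝ} (ξ : Space n) {τ : ℝ} (hτ : τ < t) : L.ConvergesAt x t ξ τ := by
  have hM := S.hM
  have hκ := S.hκ
  have hsc := segmentConst_nonneg (n := n) S.hN₁ S.hN₂ S.hM S.hκ
  have hβ : 0 < α / 2 := by linarith [S.hα]
  have hβ1 : α / 2 ≤ 1 := by linarith [S.hα1]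
  have hmeas : MeasurableSet (Ioo τ t ×ˢ (univ : Set (Space n))) :=
    measurableSet_Ioo.prod MeasurableSet.univ
  refine ⟨fun l => ?_, ?_, ?_⟩
  · refine (integrableOn_product S.hn (by positivity) isClock_id S.rate_le (by positivity)
      (by positivity) hβ hβ1 hβ hβ1 (S.levi h) (S.iterated_levi h ξ τ l) x hτ).congr_fun ?_ hmeas
    intro p hp
    simp only [Operator.iter]
    rw [h.apply_parametrix_eq_leviKernel hκ hp.1.2, h.iter_eq_iterated hκ l hp.1.1]
  · simp_rw [h.iter_eq_iterated hκ _ hτ]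
    exact summable_iterated (S.iterated_levi h ξ τ) x t
  · refine (integrableOn_product S.hn (by positivity) isClock_id S.rate_le (by positivity)
      (by positivity) one_pos le_rfl hβ hβ1 (S.frozen_id h)
      (resolvent_bound (S.iterated_levi h ξ τ)) x hτ).congr_fun ?_ hmeas
    intro p hp
    simp only
    rw [h.parametrix_eq_frozenKernel hκ hp.1.2, h.levi_eq_resolvent hκ hp.1.1]

/-- The Euler scheme converges to Levi's solution. -/
lemma tendsto_discreteSolution (S : Setting n α N₁ N₂ M κ lam) (h : L.Admissible α N₁ N₂ M κ)
    {s : ℕ → ℝ} (hs : ∀ N, 0 < s N) (hs0 : Filter.Tendsto s Filter.atTop (nhds 0))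
    (ξ x : Space n) {τ t : ℝ} (hτ : τ < t) :
    Filter.Tendsto (fun N => L.discreteSolution (s N) ξ τ x t) Filter.atTop
      (nhds (L.fundSol x t ξ τ)) := by
  have hM := S.hM
  have hκ := S.hκ
  have hsc := segmentConst_nonneg (n := n) S.hN₁ S.hN₂ S.hM S.hκ
  have hβ : 0 < α / 2 := by linarith [S.hα]
  have hβ1 : α / 2 ≤ 1 := by linarith [S.hα1]
  have hlim := tendsto_gridClock hs hs0 τ
  have hc : 0 < 1 / (8 * M) := by positivity
  have hC : 0 ≤ 2 * segmentConst n N₁ N₂ M κ := by positivity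
  have hr := segmentRate_nonneg S.hN₂ S.hM
  have hKlim : ∀ (x : Space n) (t : ℝ) (η : Space n) (σ : ℝ), σ < t → Filter.Tendsto
      (fun N => L.defectKernel (s N) (gridClock τ (s N)) x t η σ) Filter.atTop
      (nhds (L.leviKernel x t η σ)) := fun x t η σ hσ =>
    h.tendsto_defectKernel hκ hs hs0 τ x η hσ
  have h1 := tendsto_leviSolution S.hn hc hr S.rate_le hC hβ hβ1
    (fun N => isClock_gridClock (hs N) τ) hlim (fun N => S.defect h (hs N) τ) hKlim
    (fun N l => S.iterated_defect h (hs N) τ ξ τ l) (by positivity)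
    (fun N => S.frozen h (hs N) τ)
    (fun x t η σ hσ => h.tendsto_frozenKernel hκ hlim x η hσ) x hτ
  have h2 := tendsto_resolvent S.hn hc hr S.rate_le hC hβ hβ1
    (fun N => isClock_gridClock (hs N) τ) hlim (fun N => S.defect h (hs N) τ) hKlim
    (fun N l => S.iterated_defect h (hs N) τ ξ τ l) x hτ
  have h3 := h1.add (hs0.mul h2)
  rw [zero_mul, add_zero, ← h.fundSol_eq_leviSolution hκ hτ] at h3
  exact h3

/-! ### The upper bound -/

lemma fundSol_le_majorant (S : Setting n α N₁ N₂ M κ lam) (h : L.Admissible α N₁ N₂ M κ)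
    (x : Space n) {t : ℝ} (ξ : Space n) {τ : ℝ} (hτ : τ < t) :
    L.fundSol x t ξ τ ≤ (2 * M / κ) ^ ((n : ℝ) / 2)
      * (1 + 2 * (2 * segmentConst n N₁ N₂ M κ) / (α / 2) * (t - τ) ^ (α / 2))
      * majorant (1 / (8 * M)) lam (fun r => r) x t ξ τ := by
  have hM := S.hM
  have hκ := S.hκ
  have hc : 0 < 1 / (8 * M) := by positivity
  have hsc := segmentConst_nonneg (n := n) S.hN₁ S.hN₂ S.hM S.hκ
  have h1 := (S.frozen_id h).bound x t ξ τ hτ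
  rw [sub_self, Real.rpow_zero, mul_one] at h1
  have h2 := mul_le_mul_of_nonneg_left (majorant_mono hc isClock_id S.rate_le x ξ hτ.le)
    (by positivity : 0 ≤ (2 * M / κ) ^ ((n : ℝ) / 2))
  have h3 := abs_volterra_resolvent_le (D := (2 * M / κ) ^ ((n : ℝ) / 2)) S.hn hc isClock_id
    S.rate_le (by positivity) (by positivity) (by linarith [S.hα]) (by linarith [S.hα1])
    (S.iterated_levi h ξ τ) (S.frozen_id h) x hτ
  rw [h.fundSol_eq_leviSolution hκ hτ, leviSolution]
  have h4 := add_le_add ((le_abs_self _).trans (h1.trans h2)) ((le_abs_self _).trans h3)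
  refine h4.trans (le_of_eq ?_)
  ring

lemma fundSol_le (S : Setting n α N₁ N₂ M κ lam) (h : L.Admissible α N₁ N₂ M κ)
    (x : Space n) {t : ℝ} (ξ : Space n) {τ : ℝ} (hτ : τ < t) :
    L.fundSol x t ξ τ ≤ (2 * M / κ) ^ ((n : ℝ) / 2)
      * (1 + 2 * (2 * segmentConst n N₁ N₂ M κ) / (α / 2)) * (8 * Real.pi * M) ^ (-((n : ℝ) / 2))
      * Real.exp ((lam + 1) * (t - τ)) * (t - τ) ^ (-((n : ℝ) / 2))
      * Real.exp (-(1 / (8 * M)) * (‖x - ξ‖ ^ 2 / (t - τ))) := by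
  have hM := S.hM
  have hκ := S.hκ
  have hα := S.hα
  have hsc := segmentConst_nonneg (n := n) S.hN₁ S.hN₂ S.hM S.hκ
  have hT : 0 < t - τ := sub_pos.mpr hτ
  refine (S.fundSol_le_majorant h x ξ hτ).trans ?_
  set G := 2 * (2 * segmentConst n N₁ N₂ M κ) / (α / 2)
  have hG : 0 ≤ G := by positivity
  have h1 : (t - τ) ^ (α / 2) ≤ Real.exp (t - τ) := by
    have h2 := rpow_le_one_add hT (by linarith : 0 ≤ α / 2) (by linarith [S.hα1])
    linarith [Real.add_one_le_exp (t - τ)]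
  have h2 : 1 + G * (t - τ) ^ (α / 2) ≤ (1 + G) * Real.exp (t - τ) := by
    have := mul_le_mul_of_nonneg_left h1 hG
    have := Real.one_le_exp hT.le
    linarith
  have e : majorant (1 / (8 * M)) lam (fun r => r) x t ξ τ
      = Real.exp (lam * (t - τ)) * ((8 * Real.pi * M) ^ (-((n : ℝ) / 2))
        * (t - τ) ^ (-((n : ℝ) / 2)) * Real.exp (-(1 / (8 * M)) * (‖x - ξ‖ ^ 2 / (t - τ)))) := by
    rw [majorant, heat, ← Real.mul_rpow (by positivity) hT.le]
    congr 3
    field_simp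
  rw [e, add_mul lam, one_mul, Real.exp_add]
  calc _ ≤ (2 * M / κ) ^ ((n : ℝ) / 2) * ((1 + G) * Real.exp (t - τ)) * _ := by gcongr
    _ = _ := by ring

/-! ### The lower bound near the pole -/

/-- Within the parabolic distance `|x - ξ|² ≤ κ u` and for short times `u` the parametrix dominates
the correction, uniformly in the step of the Euler scheme. -/
lemma exists_discreteSolution_lower (S : Setting n α N₁ N₂ M κ lam) :
    ∃ δ : ℝ, 0 < δ ∧ ∀ L : Operator n, L.Admissible α N₁ N₂ M κ → ∀ s : ℝ, 0 < s →
      ∀ (j : ℕ) (ξ : Space n) (τ : ℝ) (x : Space n), (j + 1 : ℕ) * s ≤ δ →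
      ‖x - ξ‖ ^ 2 ≤ κ * ((j + 1 : ℕ) * s) →
      Real.exp (-1) * (4 * Real.pi * M * ((j + 1 : ℕ) * s)) ^ (-((n : ℝ) / 2))
        ≤ L.discreteSolution s ξ τ x (τ + (j + 1 : ℕ) * s) := by
  have hM := S.hM
  have hκ := S.hκ
  have hα := S.hα
  have hA := S.correctionConst_nonneg
  set A := correctionConst n α N₁ N₂ M κ
  -- the correction is small compared with the parametrix, which keeps the factor `e^{-1/4}`
  have hε : (0 : ℝ) < Real.exp (-(1 / 4)) - Real.exp (-1) :=
    sub_pos.mpr (Real.exp_lt_exp.mpr (by norm_num))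
  have hcont : Filter.Tendsto (fun u : ℝ => A * u ^ (α / 2) * Real.exp (lam * u)) (nhds 0)
      (nhds 0) := by
    have h1 : ContinuousAt (fun u : ℝ => A * u ^ (α / 2) * Real.exp (lam * u)) 0 :=
      (continuousAt_const.mul (Real.continuousAt_rpow_const _ _ (Or.inr (by positivity)))).mul
        (by fun_prop)
    have h2 := h1.tendsto
    simpa [Real.zero_rpow (by positivity : α / 2 ≠ 0)] using h2
  obtain ⟨δ, hδ, hsmall⟩ := Metric.eventually_nhds_iff.mp (hcont.eventually_lt_const hε)
  refine ⟨δ / 2, by positivity, fun L h s hs j ξ τ x hu hx => ?_⟩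
  set u : ℝ := (j + 1 : ℕ) * s with hudef
  have hu0 : 0 < u := by positivity
  have hρ : gridClock τ s (τ + u) = τ + u := gridClock_natCast hs τ (j + 1)
  have hρ0 : gridClock τ s τ = τ := gridClock_self τ
  have h1 := S.abs_discreteSolution_sub_le h hs ξ τ x (add_le_grid hs τ j)
  rw [← hudef, add_sub_cancel_left, majorant, hρ, hρ0, add_sub_cancel_left] at h1
  have h2 : Real.exp (-(1 / 4)) * (4 * Real.pi * M * u) ^ (-((n : ℝ) / 2))
      ≤ L.frozenKernel (gridClock τ s) x (τ + u) ξ τ := by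
    rw [Operator.frozenKernel, hρ, hρ0, if_pos (by linarith), add_sub_cancel_left]
    refine le_trans ?_ (le_gauss (by positivity) (by positivity)
      ((h.elliptic_a (ξ, τ)).smul hu0.le) (x - ξ))
    rw [mul_comm, show 4 * Real.pi * (u * M) = 4 * Real.pi * M * u by ring]
    refine mul_le_mul_of_nonneg_left (Real.exp_le_exp.mpr (neg_le_neg ?_)) (by positivity)
    have : ‖x - ξ‖ ^ 2 / (u * κ) ≤ 1 := by
      rw [div_le_one (by positivity)]; linarith
    linarith
  have h3 : heat (1 / (8 * M)) u (x - ξ) ≤ (4 * Real.pi * M * u) ^ (-((n : ℝ) / 2)) := by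
    rw [heat]
    refine (mul_le_of_le_one_right (by positivity) (Real.exp_le_one_iff.mpr ?_)).trans ?_
    · have : 0 ≤ 1 / (8 * M) * (‖x - ξ‖ ^ 2 / u) := by positivity
      linarith
    · refine Real.rpow_le_rpow_of_nonpos (by positivity) ?_ (by
        have : (0 : ℝ) ≤ n := by positivity
        linarith)
      have e : Real.pi * u / (1 / (8 * M)) = 2 * (4 * Real.pi * M * u) := by field_simp; ring
      have : 0 < 4 * Real.pi * M * u := by positivity
      linarith
  have h4 : A * u ^ (α / 2) * Real.exp (lam * u) < Real.exp (-(1 / 4)) - Real.exp (-1) := by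
    refine hsmall ?_
    rw [Real.dist_eq, sub_zero, abs_of_pos hu0]; linarith
  have h5 : A * u ^ (α / 2) * (Real.exp (lam * u) * heat (1 / (8 * M)) u (x - ξ))
      ≤ (Real.exp (-(1 / 4)) - Real.exp (-1)) * (4 * Real.pi * M * u) ^ (-((n : ℝ) / 2)) := by
    rw [← mul_assoc]
    exact mul_le_mul h4.le h3 (heat_nonneg (by positivity) hu0.le _) hε.le
  have h6 := (abs_le.mp h1).1
  linarith

/-! ### Chaining -/

/-- If a time step of length `(j + 1) s` keeps the value `b` within distance `R`, then a chain of
`i + 1` such steps through balls of radius `r` whose consecutive centres are at distance at most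
`R - 2r` keeps `b (b |B_r|)^i`. -/
lemma discreteSolution_chain (S : Setting n α N₁ N₂ M κ lam) (h : L.Admissible α N₁ N₂ M κ)
    (hs : 0 < s) {j : ℕ} {b r R : ℝ} (hb : 0 ≤ b) (hr : 0 ≤ r)
    (hstep : ∀ (ξ : Space n) (τ : ℝ) (x : Space n), ‖x - ξ‖ ≤ R →
      b ≤ L.discreteSolution s ξ τ x (τ + (j + 1 : ℕ) * s))
    (p : ℕ → Space n) (hp : ∀ k, ‖p (k + 1) - p k‖ ≤ R - 2 * r) (τ : ℝ) (i : ℕ) (z : Space n)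
    (hz : z ∈ Metric.closedBall (p (i + 1)) r) :
    b * (b * volume.real (Metric.closedBall (0 : Space n) r)) ^ i
      ≤ L.discreteSolution s (p 0) τ z (τ + ((i + 1) * (j + 1) : ℕ) * s) := by
  set V := volume.real (Metric.closedBall (0 : Space n) r) with hV
  have hV0 : 0 ≤ V := measureReal_nonneg
  induction i generalizing z with
  | zero =>
    rw [pow_zero, mul_one, zero_add, one_mul]
    refine hstep _ _ _ ?_
    have h1 := hp 0
    have h2 : ‖z - p 1‖ ≤ r := by simpa [dist_eq_norm] using hz
    calc ‖z - p 0‖ = ‖(z - p 1) + (p (0 + 1) - p 0)‖ := by congr 1; abel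
      _ ≤ _ := norm_add_le _ _
      _ ≤ R := by linarith
  | succ i ih =>
    obtain ⟨m, hm⟩ : ∃ m, (i + 1) * (j + 1) = m + 1 := ⟨(i + 1) * (j + 1) - 1, by
      have : 0 < (i + 1) * (j + 1) := by positivity
      omega⟩
    have e : (i + 1 + 1) * (j + 1) = j + 1 + (m + 1) := by rw [← hm]; ring
    rw [e, S.discreteSolution_semigroup h hs]
    rw [hm] at ih
    set τ' := τ + (m + 1 : ℕ) * s with hτ'
    set B := Metric.closedBall (p (i + 1)) r with hB
    have hVB : volume.real B = V := by
      rw [hV, hB, Measure.real, Measure.real, Measure.addHaar_closedBall_center]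
    have hBfin : volume B ≠ ⊤ := measure_closedBall_lt_top.ne
    obtain ⟨D, hD⟩ := S.exists_discreteSolution_le h hs τ' j
    have hint : Integrable fun η => L.discreteSolution s η τ' z (τ' + (j + 1 : ℕ) * s)
        * L.discreteSolution s (p 0) τ η τ' :=
      (S.integrable_discreteSolution h hs (p 0) τ m).bdd_mul (c := D)
        ((S.measurable_discreteSolution h hs τ' j).comp (f := fun η => (z, η))
          (by fun_prop)).aestronglyMeasurable (Filter.Eventually.of_forall fun η => hD z η)
    have hpos : ∀ η, 0 ≤ L.discreteSolution s η τ' z (τ' + (j + 1 : ℕ) * s)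
        * L.discreteSolution s (p 0) τ η τ' := fun η =>
      mul_nonneg (S.discreteSolution_nonneg h hs _ _ _ _) (S.discreteSolution_nonneg h hs _ _ _ _)
    refine le_trans ?_ (setIntegral_le_integral (s := B) hint (Filter.Eventually.of_forall hpos))
    have hconst : b * (b * V) ^ (i + 1) = ∫ _ in B, b * (b * (b * V) ^ i) := by
      rw [setIntegral_const, hVB, smul_eq_mul]; ring
    rw [hconst]
    refine setIntegral_mono_on (integrableOn_const hBfin) hint.integrableOn
      measurableSet_closedBall fun η hη => ?_
    refine mul_le_mul (hstep _ _ _ ?_) (ih η hη) (by positivity)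
      (S.discreteSolution_nonneg h hs _ _ _ _)
    have h1 := hp (i + 1)
    have h2 : ‖z - p (i + 1 + 1)‖ ≤ r := by simpa [dist_eq_norm] using hz
    have h3 : ‖η - p (i + 1)‖ ≤ r := by simpa [hB, dist_eq_norm] using hη
    calc ‖z - η‖ = ‖(z - p (i + 1 + 1)) + (p (i + 1 + 1) - p (i + 1)) - (η - p (i + 1))‖ := by
          congr 1; abel
      _ ≤ ‖(z - p (i + 1 + 1)) + (p (i + 1 + 1) - p (i + 1))‖ + ‖η - p (i + 1)‖ := norm_sub_le _ _
      _ ≤ ‖z - p (i + 1 + 1)‖ + ‖p (i + 1 + 1) - p (i + 1)‖ + ‖η - p (i + 1)‖ := by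
          gcongr; exact norm_add_le _ _
      _ ≤ R := by linarith

/-- The lower bound by a chain of `i + 1` steps of length `u`. -/
lemma fundSol_chain (S : Setting n α N₁ N₂ M κ lam) {δ : ℝ}
    (hδ : ∀ L : Operator n, L.Admissible α N₁ N₂ M κ → ∀ s : ℝ, 0 < s →
      ∀ (j : ℕ) (ξ : Space n) (τ : ℝ) (x : Space n), (j + 1 : ℕ) * s ≤ δ →
      ‖x - ξ‖ ^ 2 ≤ κ * ((j + 1 : ℕ) * s) →
      Real.exp (-1) * (4 * Real.pi * M * ((j + 1 : ℕ) * s)) ^ (-((n : ℝ) / 2))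
        ≤ L.discreteSolution s ξ τ x (τ + (j + 1 : ℕ) * s))
    (h : L.Admissible α N₁ N₂ M κ) (x ξ : Space n) (τ : ℝ) {u : ℝ} (hu : 0 < u) (huδ : u ≤ δ)
    (i : ℕ) (hx : 4 * ‖x - ξ‖ ^ 2 ≤ κ * u * (i + 1 : ℕ) ^ 2) :
    Real.exp (-1) * (4 * Real.pi * M * u) ^ (-((n : ℝ) / 2))
      * (Real.exp (-1) * (4 * Real.pi * M * u) ^ (-((n : ℝ) / 2))
        * volume.real (Metric.closedBall (0 : Space n) (Real.sqrt (κ * u) / 4))) ^ i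
      ≤ L.fundSol x (τ + (i + 1 : ℕ) * u) ξ τ := by
  have hM := S.hM
  have hκ := S.hκ
  have hs : ∀ N : ℕ, 0 < u * (1 / ((N : ℝ) + 1)) := fun N => by positivity
  have hs0 : Filter.Tendsto (fun N : ℕ => u * (1 / ((N : ℝ) + 1))) Filter.atTop (nhds 0) := by
    simpa using (tendsto_one_div_add_atTop_nhds_zero_nat (𝕜 := ℝ)).const_mul u
  refine ge_of_tendsto' (S.tendsto_discreteSolution h hs hs0 ξ x (lt_grid hu (by omega)))
    fun N => ?_
  have hNu : ((N + 1 : ℕ) : ℝ) * (u * (1 / ((N : ℝ) + 1))) = u := by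
    push_cast; field_simp
  set p : ℕ → Space n := fun k => ξ + ((k : ℝ) / (i + 1 : ℕ)) • (x - ξ) with hp
  have hi : (0 : ℝ) < (i + 1 : ℕ) := by positivity
  have hp0 : p 0 = ξ := by simp [hp]
  have hp1 : p (i + 1) = x := by
    simp only [hp]
    rw [div_self hi.ne', one_smul]; abel
  have hps : ∀ k, ‖p (k + 1) - p k‖ ≤ Real.sqrt (κ * u) - 2 * (Real.sqrt (κ * u) / 4) := by
    intro k
    have e1 : p (k + 1) - p k = (1 / ((i + 1 : ℕ) : ℝ)) • (x - ξ) := by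
      simp only [hp]
      rw [add_sub_add_left_eq_sub, ← sub_smul]
      congr 1; push_cast; ring
    have e2 : 2 * (‖x - ξ‖ / (i + 1 : ℕ)) ≤ Real.sqrt (κ * u) := by
      refine Real.le_sqrt_of_sq_le ?_
      rw [mul_pow, div_pow, ← mul_div_assoc, div_le_iff₀ (by positivity)]
      linarith
    rw [e1, norm_smul, Real.norm_of_nonneg (by positivity), one_div_mul_eq_div]
    linarith
  have hc := S.discreteSolution_chain h (hs N) (j := N) (R := Real.sqrt (κ * u))
    (r := Real.sqrt (κ * u) / 4)
    (b := Real.exp (-1) * (4 * Real.pi * M * u) ^ (-((n : ℝ) / 2))) (by positivity)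
    (by positivity) (fun ξ τ x hx => by
      have := hδ L h _ (hs N) N ξ τ x
      rw [hNu] at this ⊢
      refine this huδ ?_
      calc ‖x - ξ‖ ^ 2 ≤ Real.sqrt (κ * u) ^ 2 := by gcongr
        _ = κ * u := Real.sq_sqrt (by positivity)) p hps τ i x
    (by rw [hp1]; exact Metric.mem_closedBall_self (by positivity))
  rw [hp0, Nat.cast_mul, mul_assoc ((i + 1 : ℕ) : ℝ), hNu] at hc
  exact hc

end Setting

/-! ### The constants of the lower bound -/

/-- The constant whose logarithm gives the Gaussian rate `d` in the lower bound. -/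
def chainConst (n : ℕ) (M κ : ℝ) : ℝ :=
  Real.exp 1 * 2 ^ (3 * n) * (M * κ⁻¹) ^ ((n : ℝ) / 2) * Real.Gamma ((n : ℝ) / 2 + 1)

/-- The mass that one step of the chain keeps in the next ball. -/
lemma step_mul_volume (hn : 1 ≤ n) {M κ u : ℝ} (hM : 0 < M) (hκ : 0 < κ) (hu : 0 < u) :
    Real.exp (-1) * (4 * Real.pi * M * u) ^ (-((n : ℝ) / 2))
        * volume.real (Metric.closedBall (0 : Space n) (Real.sqrt (κ * u) / 4))
      = (chainConst n M κ)⁻¹ := by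
  have : Nonempty (Fin n) := ⟨⟨0, hn⟩⟩
  have hΓ : 0 < Real.Gamma ((n : ℝ) / 2 + 1) := Real.Gamma_pos_of_pos (by positivity)
  have e1 : volume.real (Metric.closedBall (0 : Space n) (Real.sqrt (κ * u) / 4))
      = (Real.sqrt (κ * u) / 4) ^ n * (Real.sqrt Real.pi ^ n / Real.Gamma ((n : ℝ) / 2 + 1)) := by
    rw [Measure.real, EuclideanSpace.volume_closedBall, Fintype.card_fin, ENNReal.toReal_mul,
      ENNReal.toReal_pow, ENNReal.toReal_ofReal (by positivity),
      ENNReal.toReal_ofReal (by positivity)]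
  have hsq : ∀ a : ℝ, 0 ≤ a → Real.sqrt a ^ n = a ^ ((n : ℝ) / 2) := fun a ha => by
    rw [Real.sqrt_eq_rpow, ← Real.rpow_natCast, ← Real.rpow_mul ha]; congr 1; ring
  have e2 : (Real.sqrt (κ * u) / 4) ^ n = (κ * u / 16) ^ ((n : ℝ) / 2) := by
    rw [← hsq _ (by positivity), Real.sqrt_div' _ (by norm_num),
      show (16 : ℝ) = 4 ^ 2 by norm_num, Real.sqrt_sq (by norm_num)]
  have e3 : (2 : ℝ) ^ (3 * n) = 64 ^ ((n : ℝ) / 2) := by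
    rw [← hsq _ (by norm_num), show (64 : ℝ) = 8 ^ 2 by norm_num, Real.sqrt_sq (by norm_num),
      pow_mul]; norm_num
  rw [chainConst, e1, e2, e3, hsq _ Real.pi_pos.le, Real.rpow_neg (by positivity), Real.exp_neg]
  have e4 : (κ * u / 16) ^ ((n : ℝ) / 2) * Real.pi ^ ((n : ℝ) / 2)
      * (64 ^ ((n : ℝ) / 2) * (M * κ⁻¹) ^ ((n : ℝ) / 2)) = (4 * Real.pi * M * u) ^ ((n : ℝ) / 2) := by
    rw [← Real.mul_rpow (by positivity) (by positivity),
      ← Real.mul_rpow (by positivity) (by positivity),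
      ← Real.mul_rpow (by positivity) (by positivity)]
    congr 1; field_simp; ring
  rw [← e4]
  have h1 : 0 < (κ * u / 16) ^ ((n : ℝ) / 2) := by positivity
  have h2 : 0 < Real.pi ^ ((n : ℝ) / 2) := by positivity
  have h3 : 0 < (64 : ℝ) ^ ((n : ℝ) / 2) := by positivity
  have h4 : 0 < (M * κ⁻¹) ^ ((n : ℝ) / 2) := by positivity
  field_simp

lemma half_le_Gamma (n : ℕ) : 1 / 2 ≤ Real.Gamma ((n : ℝ) / 2 + 1) := by
  induction n using Nat.twoStepInduction with
  | zero => norm_num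
  | one =>
    rw [Nat.cast_one, Real.Gamma_add_one (by norm_num), Real.Gamma_one_half_eq]
    have : 1 ≤ Real.sqrt Real.pi := Real.one_le_sqrt.mpr (by linarith [Real.pi_gt_three])
    linarith
  | more n ih _ =>
    have e : ((n + 2 : ℕ) : ℝ) / 2 + 1 = ((n : ℝ) / 2 + 1) + 1 := by push_cast; ring
    rw [e, Real.Gamma_add_one (by positivity)]
    have : (0 : ℝ) ≤ n := by positivity
    nlinarith

/-- Hence the rate `d` is nonnegative; the factor `e` compensates the lower bound `1/2` for the
Gamma function. -/
lemma one_le_chainConst {M κ : ℝ} (hκ : 0 < κ) (hMκ : κ ≤ M) : 1 ≤ chainConst n M κ := by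
  have h1 := half_le_Gamma n
  have h2 : 2 ≤ Real.exp 1 := by linarith [Real.add_one_le_exp 1]
  have h3 : (1 : ℝ) ≤ 2 ^ (3 * n) := one_le_pow₀ (by norm_num)
  have h4 : 1 ≤ (M * κ⁻¹) ^ ((n : ℝ) / 2) := by
    refine Real.one_le_rpow ?_ (by positivity)
    rw [← div_eq_mul_inv, one_le_div hκ]; exact hMκ
  calc (1 : ℝ) = 2 * 1 * 1 * (1 / 2) := by norm_num
    _ ≤ chainConst n M κ := by unfold chainConst; gcongr

lemma Operator.Admissible.ellipticity_le (hn : 1 ≤ n) {L : Operator n} {α N₁ N₂ M κ : ℝ}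
    (h : L.Admissible α N₁ N₂ M κ) : κ ≤ M := by
  have h1 := h.elliptic 0 (EuclideanSpace.single ⟨0, hn⟩ 1)
  have h2 : ‖(EuclideanSpace.single (⟨0, hn⟩ : Fin n) 1 : Space n)‖ = 1 := by simp
  rw [h2] at h1
  linarith [h1.1, h1.2]

lemma Setting.exists_fundSol_lower {α N₁ N₂ M κ lam : ℝ} (S : Setting n α N₁ N₂ M κ lam)
    (hMκ : κ ≤ M) : ∃ A₀ A₁ : ℝ, 0 < A₀ ∧ 0 ≤ A₁ ∧ ∀ L : Operator n,
      L.Admissible α N₁ N₂ M κ → ∀ (x : Space n) (t : ℝ) (ξ : Space n) (τ : ℝ), τ < t →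
      A₀ * Real.exp (-A₁ * (t - τ)) * (t - τ) ^ (-((n : ℝ) / 2))
          * Real.exp (-(4 * Real.log (chainConst n M κ) / κ) * (‖x - ξ‖ ^ 2 / (t - τ)))
        ≤ L.fundSol x t ξ τ := by
  have hM := S.hM
  have hκ := S.hκ
  obtain ⟨δ, hδ, hlow⟩ := S.exists_discreteSolution_lower
  have hQ1 : 1 ≤ chainConst n M κ := one_le_chainConst hκ hMκ
  have hQ0 : 0 < chainConst n M κ := by linarith
  have hlog := Real.log_nonneg hQ1
  set lq := Real.log (chainConst n M κ) with hlq
  refine ⟨Real.exp (-1) * (4 * Real.pi * M) ^ (-((n : ℝ) / 2)), lq / δ, by positivity,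
    by positivity, fun L h x t ξ τ hτ => ?_⟩
  have hT : 0 < t - τ := sub_pos.mpr hτ
  set T := t - τ with hTdef
  set y := ‖x - ξ‖ with hy
  -- the least number of steps for which the chain lemma applies and the step is at most `δ`
  set w := max (4 * y ^ 2 / (κ * T)) (T / δ) with hw
  have hw0 : 0 < w := lt_max_of_lt_right (by positivity)
  obtain ⟨i, hi⟩ : ∃ i, ⌈w⌉₊ = i + 1 := ⟨⌈w⌉₊ - 1, by
    have := Nat.ceil_pos.mpr hw0
    omega⟩
  have hwi : w ≤ (i + 1 : ℕ) := hi ▸ Nat.le_ceil w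
  have hiw : (i : ℝ) ≤ 4 * y ^ 2 / (κ * T) + T / δ := by
    have h1 := Nat.ceil_lt_add_one hw0.le
    rw [hi] at h1
    push_cast at h1
    have h2 : w ≤ 4 * y ^ 2 / (κ * T) + T / δ :=
      max_le (le_add_of_nonneg_right (by positivity)) (le_add_of_nonneg_left (by positivity))
    linarith
  have hm : (0 : ℝ) < (i + 1 : ℕ) := by positivity
  set u := T / (i + 1 : ℕ) with hu
  have hu0 : 0 < u := by positivity
  have huT : (i + 1 : ℕ) * u = T := by rw [hu]; field_simp
  have huδ : u ≤ δ := by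
    rw [hu, div_le_iff₀ hm]
    have := (div_le_iff₀ hδ).mp ((le_max_right _ _).trans hwi)
    linarith
  have hyu : 4 * y ^ 2 ≤ κ * u * (i + 1 : ℕ) ^ 2 := by
    have h1 := (div_le_iff₀ (by positivity)).mp ((le_max_left _ _).trans hwi)
    calc 4 * y ^ 2 ≤ (i + 1 : ℕ) * (κ * T) := h1
      _ = _ := by rw [← huT]; ring
  have hc := S.fundSol_chain hlow h x ξ τ hu0 huδ i hyu
  rw [step_mul_volume S.hn hM hκ hu0, huT, hTdef, add_sub_cancel] at hc
  refine le_trans ?_ hc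
  have h1 : (4 * Real.pi * M) ^ (-((n : ℝ) / 2)) * T ^ (-((n : ℝ) / 2))
      ≤ (4 * Real.pi * M * u) ^ (-((n : ℝ) / 2)) := by
    rw [← Real.mul_rpow (by positivity) hT.le]
    refine Real.rpow_le_rpow_of_nonpos (by positivity) ?_ (by
      have : (0 : ℝ) ≤ n := by positivity
      linarith)
    have : u ≤ T := div_le_self hT.le (by push_cast; linarith [(Nat.cast_nonneg i : (0 : ℝ) ≤ i)])
    gcongr
  have h2 : Real.exp (-(lq / δ) * T) * Real.exp (-(4 * lq / κ) * (y ^ 2 / T))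
      ≤ (chainConst n M κ)⁻¹ ^ i := by
    rw [← Real.exp_log hQ0, ← hlq, ← Real.exp_neg, ← Real.exp_nat_mul, ← Real.exp_add]
    refine Real.exp_le_exp.mpr ?_
    have h3 := mul_le_mul_of_nonneg_right hiw hlog
    have h4 : (4 * y ^ 2 / (κ * T) + T / δ) * lq = lq / δ * T + 4 * lq / κ * (y ^ 2 / T) := by
      field_simp; ring
    linarith
  calc _ = Real.exp (-1) * ((4 * Real.pi * M) ^ (-((n : ℝ) / 2)) * T ^ (-((n : ℝ) / 2)))
        * (Real.exp (-(lq / δ) * T) * Real.exp (-(4 * lq / κ) * (y ^ 2 / T))) := by ring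
    _ ≤ _ := by gcongr

end Parabolic

end

theorem theorem1p1 (n : ℕ) (hn : 1 ≤ n) (α N₁ N₂ M κ : ℝ) (hα : 0 < α) (hα1 : α ≤ 1)
    (hN₁ : 0 < N₁) (hN₂ : 0 < N₂) (hM : 0 < M) (hκ : 0 < κ) (c d : ℝ)
    (hc : c = 1 / (8 * M))
    (hd : d = 4 * Real.log (Real.exp 1 * 2 ^ (3 * n) * (M * κ⁻¹) ^ ((n : ℝ) / 2)
      * Real.Gamma ((n : ℝ) / 2 + 1)) / κ) :
    ∃ A₀ A₁ A₂ A₃ : ℝ, 0 < A₀ ∧ 0 ≤ A₁ ∧ 0 < A₂ ∧ 0 ≤ A₃ ∧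
      ∀ L : Parabolic.Operator n, L.Admissible α N₁ N₂ M κ →
        ∀ (x : Parabolic.Space n) (t : ℝ) (ξ : Parabolic.Space n) (τ : ℝ), τ < t →
          L.ConvergesAt x t ξ τ ∧
          A₀ * Real.exp (-A₁ * (t - τ)) * (t - τ) ^ (-((n : ℝ) / 2))
              * Real.exp (-d * (‖x - ξ‖ ^ 2 / (t - τ)))
            ≤ L.fundSol x t ξ τ ∧
          L.fundSol x t ξ τ
            ≤ A₂ * Real.exp (A₃ * (t - τ)) * (t - τ) ^ (-((n : ℝ) / 2))
              * Real.exp (-c * (‖x - ξ‖ ^ 2 / (t - τ))) := by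
  subst hc hd
  rcases lt_or_ge M κ with hlt | hMκ
  · -- no operator is admissible for these constants
    exact ⟨1, 0, 1, 0, one_pos, le_rfl, one_pos, le_rfl, fun L h =>
      absurd (h.ellipticity_le hn) (not_le.mpr hlt)⟩
  obtain ⟨lam, S⟩ := Parabolic.exists_setting hn hα hα1 hN₁ hN₂ hM hκ
  obtain ⟨A₀, A₁, hA₀, hA₁, hlow⟩ := S.exists_fundSol_lower hMκ
  have hsc := Parabolic.segmentConst_nonneg (n := n) hN₁ hN₂ hM hκ
  have hlam : 0 ≤ lam := (Parabolic.segmentRate_nonneg hN₂ hM).trans S.rate_le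
  exact ⟨A₀, A₁, _, lam + 1, hA₀, hA₁, by positivity, by linarith, fun L h x t ξ τ hτ =>
    ⟨S.convergesAt h x ξ hτ, hlow L h x t ξ τ hτ, S.fundSol_le h x ξ hτ⟩⟩
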